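/- **Resource calculus.** Simple terms are $t ::= \star \mid x \mid \lambda x.t \mid t\,T$, where $T=[s_1,\dots,s_n]$ ($n\ge 0$) is a finite multiset of simple terms; they are taken up to $\alpha$-equivalence. Terms are finite formal sums of simple terms with coefficients in $\mathbb N$, and all constructors are extended to sums by (bi)linearity. Reduction is the context closure, applied to one addend of a sum at a time, of $(\lambda x.s)[t_1,\dots,t_n]\to\sum_{\sigma\in S_n}s\{t_1/x_{\sigma(1)},\dots,t_n/x_{\sigma(n)}\}$ if $x$ has exactly $n$ free occurrences $x_1,\dots,x_n$ in $s$, and $(\lambda x.s)[t_1,\dots,t_n]\to 0$ otherwise. A normal form of $t$ is an irreducible $t'$ with $t\to^* t'$. **Nets.** Types are $A ::= \star\mid {!A}\multimap A$. A link $\langle P\mid v\rangle$ has a sequence $P$ of premises, a conclusion $v\notin P$ and a kind among $\star$ (no premises), $\multimap$ and $\overline{\multimap}$ (two premises), $!$ and $?$ (any number of premises). Polarities assigned by a link: $\langle\mid v^{out}\rangle_\star$, $\langle u^{out},w^{in}\mid v^{out}\rangle_\multimap$, $\langle u^{in},w^{out}\mid v^{in}\rangle_{\overline\multimap}$, $\langle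 u_1^{in},\dots,u_n^{in}\mid v^{out}\rangle_!$, $\langle u_1^{out},\dots,u_n^{out}\mid v^{in}\rangle_?$. A typing must satisfy $\langle\mid\star\rangle_\star$, $\langle {!A},B\mid {!A}\multimap B\rangle$ for $\multimap,\overline\multimap$ and $\langle A,\dots,A\mid {!A}\rangle$ for $!,?$. A simple pre-net is a typed finite set of vertices and links in which every vertex is linked by one or two links, of opposite polarity at the vertex if two; the vertices linked by only one link are its conclusions; there is at least one, and if there is only one, it is $out$. A pre-net is closed of type $\star$ if it has a single conclusion and this has type $\star$. The translation $⟦t⟧$ of a simple term is the usual graph with root $v$: a $\star$-link $\langle\mid v\rangle$ for $\star$; the vertex $v$ itself for an occurrence of a variable; $\langle u,w\mid v\rangle_\multimap$ for $\lambda x.s$, where $w$ is the root of $s$ and $u$ the conclusion of a $?$-link whose premises are the occurrences of $x$; $\langle u,v\mid w\rangle_{\overline\multimap}$ for $s\,[s_1,\dots,s_n]$, where $w$ is the root of $s$ and $u$ the conclusion of a $!$-link whose premises are the roots of $s_1,\dots,s_n$; finally one $?$-link collects the occurrences of each free variable. A sum is translated to the sum of the (vertex-disjoint) translations of its addends, and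 it is closed of type $\star$ if all these are closed simple pre-nets of type $\star$ for some typing. **Paths.** A path in a simple net is a non-empty sequence of vertices, any two consecutive ones being vertices of a common link, which is crossed. It is bouncing if it crosses the same link twice consecutively, and twisting if it crosses a link other than a $\star$-link from conclusion to conclusion or from premise to premise; it is straight if it is neither. It is maximal if it is not a proper contiguous subsequence of a non-bouncing path, comprehensive if it crosses all the premises of all the $!$- and $?$-links, and an execution path if it is straight and maximal. **Weights.** The algebra $\mathfrak{rL}^*$ is generated by $0,1,p,q,\star$ and $e_n$ ($n\in\mathbb N$) under an associative concatenation with unit $1$ and absorbing element $0$ and an inversion with $(a^*)^*=a$, $(ab)^*=b^*a^*$, subject to $aa^*=1$ for every symbol $a\in\{p,q,e_n,\star\}$, $qp^*=pq^*=0$, and $e_ie_j^*=0$ for $i\ne j$. A resource permutation $\sigma$ assigns to each $!$-link $r$ a permutation $\sigma_r$ of the indices of its premises. The weight $w^\sigma(u,v)$ of a crossing is $\star$ for a $\star$-link with conclusion $u=v$; $p$ (resp. $q$) from the first (resp. second) premise to the conclusion of a $\multimap$- or $\overline\multimap$-link; $e_i$ (resp. $e_{\sigma_r(i)}$) from the $i$-th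 premise to the conclusion of a $?$-link (resp. of a $!$-link $r$); and $(w^\sigma(v,u))^*$ for the reverse crossings. The weight $w^\sigma(\pi)$ of a straight path is the product of the weights of its crossings in order, and $w(\pi)=\sum_\sigma w^\sigma(\pi)$ is the formal sum over all resource permutations. The path $\pi$ is regular if $w(\pi)\neq0$ (the $0$ of the algebra being identified with the empty sum). **Statement.** Let $t$ be a term whose translation $⟦t⟧$ is closed of type $\star$. Then there is $n\in\mathbb N$ such that $t\to^*n\star$, the sum $n\star$ is the only normal form of $t$, and the number of regular comprehensive execution paths in $⟦t⟧$ (in all its addends) is exactly $n$, the number of addends $\star$ of the normal form. -/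

import Mathlib

namespace RC

/-! ## The resource calculus -/

/-! Simple terms and simple polyterms, with de Bruijn indices for the variables and with the
elements of a bag listed in some order. The order is forgotten in `STerm` below. -/
mutual
  /-- Ordered simple terms: `⋆`, variables, abstractions, applications to a bag. -/
  inductive Tm : Type
    | star : Tm
    | var (k : ℕ) : Tm
    | lam (t : Tm) : Tm
    | app (t : Tm) (b : Bag) : Tm
  /-- Ordered bags: the empty bag `1`, and `[t] · b`. -/
  inductive Bag : Type
    | nil : Bag
    | cons (t : Tm) (b : Bag) : Bag
end

/-! Equality of simple (poly)terms up to the order of the elements of bags: the congruence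
generated by the commutativity of `·`. -/
mutual
  inductive Tm.Eqv : Tm → Tm → Prop
    | star : Tm.Eqv .star .star
    | var (k : ℕ) : Tm.Eqv (.var k) (.var k)
    | lam {t t' : Tm} : Tm.Eqv t t' → Tm.Eqv (.lam t) (.lam t')
    | app {t t' : Tm} {b b' : Bag} :
        Tm.Eqv t t' → Bag.Eqv b b' → Tm.Eqv (.app t b) (.app t' b')
  inductive Bag.Eqv : Bag → Bag → Prop
    | nil : Bag.Eqv .nil .nil
    | cons {t t' : Tm} {b b' : Bag} :
        Tm.Eqv t t' → Bag.Eqv b b' → Bag.Eqv (.cons t b) (.cons t' b')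
    | swap (s t : Tm) (b : Bag) : Bag.Eqv (.cons s (.cons t b)) (.cons t (.cons s b))
    | trans {b b' b'' : Bag} : Bag.Eqv b b' → Bag.Eqv b' b'' → Bag.Eqv b b''
end

/-- Simple terms, in which bags are finite multisets. -/
def STerm : Type := Quot Tm.Eqv

/-- The simple term presented by an ordered simple term. -/
def Tm.toSTerm (t : Tm) : STerm := Quot.mk _ t

/-- Terms: finite formal sums of simple terms with coefficients in `ℕ`. -/
abbrev Term : Type := Multiset STerm

/-- The elements of a bag. -/
def Bag.toList : Bag → List Tm
  | .nil => []
  | .cons t b => t :: b.toList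

mutual
  /-- Number of free occurrences of the variable `k`. -/
  def Tm.occ (k : ℕ) : Tm → ℕ
    | .star => 0
    | .var x => if x = k then 1 else 0
    | .lam t => t.occ (k + 1)
    | .app t b => t.occ k + b.occ k
  def Bag.occ (k : ℕ) : Bag → ℕ
    | .nil => 0
    | .cons t b => t.occ k + b.occ k
end

mutual
  /-- Add `d` to all the variables that are at least `c`. -/
  def Tm.lift (c d : ℕ) : Tm → Tm
    | .star => .star
    | .var x => .var (if x < c then x else x + d)
    | .lam t => .lam (t.lift (c + 1) d)
    | .app t b => .app (t.lift c d) (b.lift c d)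
  def Bag.lift (c d : ℕ) : Bag → Bag
    | .nil => .nil
    | .cons t b => .cons (t.lift c d) (b.lift c d)
end

mutual
  /-- Linear substitution: the free occurrences of the variable `k` are numbered from left to
  right, starting with `o`; the `j`-th of them is replaced with `f j`, where every occurrence may
  receive a different term, and the variables above `k` are decremented, since the binder of `k`
  disappears. -/
  def Tm.lsubst (f : ℕ → Tm) (k o : ℕ) : Tm → Tm
    | .star => .star
    | .var x => if x < k then .var x else if x = k then (f o).lift 0 k else .var (x - 1)
    | .lam t => .lam (t.lsubst f (k + 1) o)
    | .app t b => .app (t.lsubst f k o) (b.lsubst f k (o + t.occ k))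
  def Bag.lsubst (f : ℕ → Tm) (k o : ℕ) : Bag → Bag
    | .nil => .nil
    | .cons t b => .cons (t.lsubst f k o) (b.lsubst f k (o + t.occ k))
end

/-- The reduct of the redex `(λ x. s) [t₀, …, tₙ₋₁]`: if `x` has exactly `n` free occurrences
`x₀, …, xₙ₋₁` in `s`, the sum over all the permutations `σ` of
`s {t₀ / x_{σ 0}, …, tₙ₋₁ / x_{σ (n-1)}}`, and `0` otherwise. -/
def betaReduct (s : Tm) (ts : List Tm) : Multiset Tm :=
  if ts.length = s.occ 0 then
    (Finset.univ : Finset (Equiv.Perm (Fin ts.length))).val.map fun σ =>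
      s.lsubst (fun j => if h : j < ts.length then ts.get (σ.symm ⟨j, h⟩) else .star) 0 0
  else 0

/-! Context closure of the elementary reduction; all the constructors are extended to sums by
linearity. -/
mutual
  inductive Tm.Step : Tm → Multiset Tm → Prop
    | beta (s : Tm) (b : Bag) : Tm.Step (.app (.lam s) b) (betaReduct s b.toList)
    | lam {t : Tm} {S : Multiset Tm} : Tm.Step t S → Tm.Step (.lam t) (S.map fun t' => .lam t')
    | appL {t : Tm} {S : Multiset Tm} (b : Bag) :
        Tm.Step t S → Tm.Step (.app t b) (S.map fun t' => .app t' b)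
    | appR (t : Tm) {b : Bag} {B : Multiset Bag} :
        Bag.Step b B → Tm.Step (.app t b) (B.map fun b' => .app t b')
  inductive Bag.Step : Bag → Multiset Bag → Prop
    | head {t : Tm} {S : Multiset Tm} (b : Bag) :
        Tm.Step t S → Bag.Step (.cons t b) (S.map fun t' => .cons t' b)
    | tail (t : Tm) {b : Bag} {B : Multiset Bag} :
        Bag.Step b B → Bag.Step (.cons t b) (B.map fun b' => .cons t b')
end

/-- Reduction of terms: one addend of the sum is reduced. -/
inductive Term.Step : Term → Term → Prop
  | mk (t : Tm) (S : Multiset Tm) (R : Term) :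
      t.Step S → Term.Step (t.toSTerm ::ₘ R) (S.map Tm.toSTerm + R)

/-- `S` is a normal form of `T`: `T →* S` and `S` does not reduce. -/
def Term.IsNormalForm (T S : Term) : Prop :=
  Relation.ReflTransGen Term.Step T S ∧ ∀ S', ¬ Term.Step S S'

/-! ## Pre-nets -/

/-- A denumerable set of vertices. -/
abbrev Vertex : Type := List ℕ

/-- Links `⟨premises | conclusion⟩`, by kind: `⋆`, `⊸`, its dual, `!` and `?`. -/
inductive Link : Type
  | star (w : Vertex) : Link
  | imp (u v w : Vertex) : Link
  | nimp (u v w : Vertex) : Link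
  | oc (us : List Vertex) (w : Vertex) : Link
  | wn (us : List Vertex) (w : Vertex) : Link
  deriving DecidableEq

namespace Link

/-- The sequence of premises. -/
def premises : Link → List Vertex
  | star _ => []
  | imp u v _ => [u, v]
  | nimp u v _ => [u, v]
  | oc us _ => us
  | wn us _ => us

/-- The conclusion. -/
def concl : Link → Vertex
  | star w => w
  | imp _ _ w => w
  | nimp _ _ w => w
  | oc _ w => w
  | wn _ w => w

/-- The vertices to which the link associates the polarity `out`. -/
def outs : Link → List Vertex
  | star w => [w]
  | imp u _ w => [u, w]
  | nimp _ v _ => [v]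
  | oc _ w => [w]
  | wn us _ => us

/-- The vertices to which the link associates the polarity `in`. -/
def ins : Link → List Vertex
  | star _ => []
  | imp _ v _ => [v]
  | nimp u _ w => [u, w]
  | oc us _ => us
  | wn _ w => [w]

/-- The vertices linked by the link. -/
def verts (l : Link) : Finset Vertex := insert l.concl l.premises.toFinset

/-- The link is a `⋆`-link. -/
def IsStar : Link → Prop
  | star _ => True
  | _ => False

/-- The link is a `!`-link. -/
def isOc : Link → Bool
  | oc _ _ => true
  | _ => false

/-- The link is exponential, i.e. a `!`-link or a `?`-link. -/
def IsExponential : Link → Prop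
  | oc _ _ => True
  | wn _ _ => True
  | _ => False

end Link

/-- Types: the ground type `⋆`, and `arr A B` for `!A ⊸ B`. -/
inductive Ty : Type
  | star : Ty
  | arr (A B : Ty) : Ty

/-- Formulas: types, and `!A` for a type `A`. -/
inductive Formula : Type
  | ty (A : Ty) : Formula
  | bang (A : Ty) : Formula

/-- A link respects a typing of the vertices. -/
def Link.Typed (τ : Vertex → Formula) : Link → Prop
  | .star w => τ w = .ty .star
  | .imp u v w => ∃ A B, τ u = .bang A ∧ τ v = .ty B ∧ τ w = .ty (.arr A B)
  | .nimp u v w => ∃ A B, τ u = .bang A ∧ τ v = .ty B ∧ τ w = .ty (.arr A B)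
  | .oc us w => ∃ A, (∀ u ∈ us, τ u = .ty A) ∧ τ w = .bang A
  | .wn us w => ∃ A, (∀ u ∈ us, τ u = .ty A) ∧ τ w = .bang A

/-- A finite set of vertices with a finite set of links. -/
structure Graph where
  verts : Finset Vertex
  links : Finset Link

namespace Graph

/-- The links of `G` that link the vertex `v`. -/
def linksAt (G : Graph) (v : Vertex) : Finset Link := G.links.filter fun l => v ∈ l.verts

/-- The conclusions of `G`: the vertices linked by only one link. -/
def conclusions (G : Graph) : Finset Vertex := G.verts.filter fun v => (G.linksAt v).card = 1

/-- `(G, τ)` is a simple pre-net. -/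
structure IsSimplePreNet (G : Graph) (τ : Vertex → Formula) : Prop where
  link_verts : ∀ l ∈ G.links, l.verts ⊆ G.verts
  link_disjoint : ∀ l ∈ G.links, l.concl ∉ l.premises
  typed : ∀ l ∈ G.links, l.Typed τ
  linked : ∀ v ∈ G.verts, 1 ≤ (G.linksAt v).card ∧ (G.linksAt v).card ≤ 2
  conclusions_nonempty : G.conclusions.Nonempty
  conclusion_out : ∀ v, G.conclusions = {v} → ∀ l ∈ G.linksAt v, v ∈ l.outs
  polarity : ∀ v ∈ G.verts, ∀ l ∈ G.linksAt v, ∀ l' ∈ G.linksAt v, l ≠ l' →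
    (v ∈ l.outs ∧ v ∈ l'.ins) ∨ (v ∈ l.ins ∧ v ∈ l'.outs)

/-- `G` is (for some typing function) a closed simple pre-net of type `A`: it has only one
conclusion, of polarity `out` and type `A`. -/
def IsClosedOfType (G : Graph) (A : Ty) : Prop :=
  ∃ τ, G.IsSimplePreNet τ ∧ ∃ v, G.conclusions = {v} ∧ τ v = .ty A

end Graph

/-! ## Translation of terms

The vertices are addresses of subterms: the subterm at the address `a` has the `out` conclusion
`a`; the body of an abstraction at `a` is at `0 :: a`, and `1 :: a` is the conclusion of the
`?`-link that collects the occurrences of the bound variable; the function of an application at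
`a` is at `0 :: a` and its bag at `1 :: a`; the `i`-th element of a bag at `a` is at `i :: a`. -/

mutual
  /-- The occurrences of the variable `k` in a term at the address `a`. -/
  def Tm.occs (k : ℕ) (a : Vertex) : Tm → List Vertex
    | .star => []
    | .var x => if x = k then [a] else []
    | .lam t => t.occs (k + 1) (0 :: a)
    | .app t b => t.occs k (0 :: a) ++ b.occs k 0 (1 :: a)
  /-- The same for a bag, whose first element has index `i`. -/
  def Bag.occs (k i : ℕ) (a : Vertex) : Bag → List Vertex
    | .nil => []
    | .cons t b => t.occs k (i :: a) ++ b.occs k (i + 1) a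
end

/-- The roots of the elements of a bag at the address `a`, whose first element has index `i`. -/
def Bag.roots (i : ℕ) (a : Vertex) : Bag → List Vertex
  | .nil => []
  | .cons _ b => (i :: a) :: b.roots (i + 1) a

mutual
  /-- The links of the pre-translation of a term at the address `a`. -/
  def Tm.pretrans (a : Vertex) : Tm → Finset Link
    | .star => {.star a}
    | .var _ => ∅
    | .lam t =>
        {.imp (1 :: a) (0 :: a) a, .wn (t.occs 0 (0 :: a)) (1 :: a)} ∪ t.pretrans (0 :: a)
    | .app t b =>
        {.nimp (1 :: a) a (0 :: a), .oc (b.roots 0 (1 :: a)) (1 :: a)} ∪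
          t.pretrans (0 :: a) ∪ b.pretrans 0 (1 :: a)
  /-- The links of the pre-translations of the elements of a bag at the address `a`, whose first
  element has index `i`. -/
  def Bag.pretrans (i : ℕ) (a : Vertex) : Bag → Finset Link
    | .nil => ∅
    | .cons t b => t.pretrans (i :: a) ∪ b.pretrans (i + 1) a
end

mutual
  /-- The free variables of a term. -/
  def Tm.fv : Tm → Finset ℕ
    | .star => ∅
    | .var x => {x}
    | .lam t => (t.fv.erase 0).image fun k => k - 1
    | .app t b => t.fv ∪ b.fv
  def Bag.fv : Bag → Finset ℕ
    | .nil => ∅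
    | .cons t b => t.fv ∪ b.fv
end

/-- The links of the translation of a simple term at the address `a`: to the pre-translation one
`?`-link is added for every free variable `k`, with the new conclusion `(k + 2) :: a`. -/
def Tm.transLinks (a : Vertex) (t : Tm) : Finset Link :=
  t.pretrans a ∪ t.fv.image fun k => .wn (t.occs k a) ((k + 2) :: a)

/-- The translation of a simple term at the address `a` (every vertex is linked). -/
def Tm.trans (a : Vertex) (t : Tm) : Graph where
  verts := (t.transLinks a).biUnion Link.verts
  links := t.transLinks a

/-- The translation of a sum of simple terms: the formal sum of the translations of its addends,
on pairwise disjoint sets of vertices. -/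
def transSum (ts : List Tm) : List Graph := ts.mapIdx fun i t => t.trans [i]

/-! ## Paths -/

namespace Graph

/-- `G.Crosses π ls`: `π` is a path in `G`, and its consecutive vertices are linked by the
consecutive elements of `ls`, which are the links crossed by `π`. -/
inductive Crosses (G : Graph) : List Vertex → List Link → Prop
  | trivial {v : Vertex} : v ∈ G.verts → Crosses G [v] []
  | cons {u v : Vertex} {π : List Vertex} {l : Link} {ls : List Link} :
      l ∈ G.links → u ∈ l.verts → v ∈ l.verts → Crosses G (v :: π) ls →
      Crosses G (u :: v :: π) (l :: ls)

/-- No link is crossed twice consecutively. -/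
def NonBouncing (ls : List Link) : Prop := ls.IsChain (· ≠ ·)

/-- No link other than a `⋆`-link is crossed from conclusion to conclusion or from premise to
premise. -/
def NonTwisting (π : List Vertex) (ls : List Link) : Prop :=
  ∀ (i : ℕ) (u v : Vertex) (l : Link), π[i]? = some u → π[i + 1]? = some v → ls[i]? = some l →
    ¬ l.IsStar → ¬ (u = l.concl ∧ v = l.concl) ∧ ¬ (u ∈ l.premises ∧ v ∈ l.premises)

/-- `π` is a straight path in `G`. -/
def IsStraight (G : Graph) (π : List Vertex) : Prop :=
  ∃ ls, G.Crosses π ls ∧ NonBouncing ls ∧ NonTwisting π ls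

/-- `π` is maximal in `G`: at neither end can it be prolonged to another non-bouncing path. -/
def IsMaximal (G : Graph) (π : List Vertex) : Prop :=
  ∀ π' ls', G.Crosses π' ls' → NonBouncing ls' → π <:+: π' → π' = π

/-- `π` crosses all the premises of all the exponential links of `G`. -/
def IsComprehensive (G : Graph) (π : List Vertex) : Prop :=
  ∀ l ∈ G.links, l.IsExponential → ∀ u ∈ l.premises, [u, l.concl] <:+: π ∨ [l.concl, u] <:+: π

/-- The comprehensive execution paths of `G`. -/
def ecPaths (G : Graph) : Set (List Vertex) :=
  {π | G.IsStraight π ∧ G.IsMaximal π ∧ G.IsComprehensive π}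

end Graph

/-! ## The dynamic algebra -/

/-- Weights: words over `0, 1, p, q, eₙ, ⋆`, built by inversion and concatenation. -/
inductive Word : Type
  | zero : Word
  | one : Word
  | p : Word
  | q : Word
  | e (n : ℕ) : Word
  | star : Word
  | inv (a : Word) : Word
  | mul (a b : Word) : Word

/-- The equations of the algebra. Neutralisation `a a* = 1` is about the symbols
`p, q, eₙ, ⋆`. -/
inductive Word.Rel : Word → Word → Prop
  | assoc (a b c : Word) : Rel (.mul a (.mul b c)) (.mul (.mul a b) c)
  | mul_one (a : Word) : Rel (.mul a .one) a
  | one_mul (a : Word) : Rel (.mul .one a) a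
  | mul_zero (a : Word) : Rel (.mul a .zero) .zero
  | zero_mul (a : Word) : Rel (.mul .zero a) .zero
  | inv_inv (a : Word) : Rel (.inv (.inv a)) a
  | inv_mul (a b : Word) : Rel (.inv (.mul a b)) (.mul (.inv b) (.inv a))
  | neutr_p : Rel (.mul .p (.inv .p)) .one
  | neutr_q : Rel (.mul .q (.inv .q)) .one
  | neutr_e (n : ℕ) : Rel (.mul (.e n) (.inv (.e n))) .one
  | neutr_star : Rel (.mul .star (.inv .star)) .one
  | annihil_qp : Rel (.mul .q (.inv .p)) .zero
  | annihil_pq : Rel (.mul .p (.inv .q)) .zero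
  | annihil_e (i j : ℕ) : i ≠ j → Rel (.mul (.e i) (.inv (.e j))) .zero
  | congr_inv {a b : Word} : Rel a b → Rel (.inv a) (.inv b)
  | congr_left {a b : Word} (c : Word) : Rel a b → Rel (.mul a c) (.mul b c)
  | congr_right (c : Word) {a b : Word} : Rel a b → Rel (.mul c a) (.mul c b)

/-- The algebra `rL*`: words up to the congruence generated by the equations. -/
def RL : Type := Quot Word.Rel

namespace RL

/-- The class of a word. -/
def mk (a : Word) : RL := Quot.mk _ a

instance : Zero RL := ⟨mk .zero⟩
instance : One RL := ⟨mk .one⟩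
instance : Mul RL :=
  ⟨Quot.map₂ Word.mul (fun c _ _ h => .congr_right c h) (fun _ _ c h => .congr_left c h)⟩

/-- Inversion. -/
def inv : RL → RL := Quot.map Word.inv fun _ _ h => .congr_inv h

end RL

/-- Formal sums of weights, in which the addends equal to the `0` of the algebra are identified
with the empty sum. -/
def SumEq (x y : RL →₀ ℕ) : Prop := ∀ a : RL, a ≠ 0 → x a = y a

/-! ## Weighting -/

/-- The `!`-links of `G`. -/
def Graph.ocLinks (G : Graph) : Finset Link := G.links.filter fun l => l.isOc = true

/-- Resource permutations: a permutation of the premises for every `!`-link. -/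
abbrev Graph.ResPerm (G : Graph) : Type :=
  (r : {l : Link // l ∈ G.ocLinks}) → Equiv.Perm (Fin r.1.premises.length)

open Classical in
/-- The permuted base weight of a crossing from a premise to the conclusion of a link (the five
explicit clauses), where the premises of a link are numbered from `0`. -/
noncomputable def Graph.upWeight (G : Graph) (σ : G.ResPerm) (u v : Vertex) : Option RL :=
  if Link.star u ∈ G.links ∧ u = v then some (RL.mk .star)
  else if ∃ w, Link.imp u w v ∈ G.links ∨ Link.nimp u w v ∈ G.links then some (RL.mk .p)
  else if ∃ w, Link.imp w u v ∈ G.links ∨ Link.nimp w u v ∈ G.links then some (RL.mk .q)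
  else if h : ∃ us, Link.wn us v ∈ G.links ∧ u ∈ us then
    some (RL.mk (.e (h.choose.idxOf u)))
  else if h : ∃ r : {l : Link // l ∈ G.ocLinks}, r.1.concl = v ∧ u ∈ r.1.premises then
    some (RL.mk (.e (σ h.choose
      ⟨h.choose.1.premises.idxOf u, List.idxOf_lt_length_of_mem h.choose_spec.2⟩)))
  else none

/-- The permuted base weighting of the unitary path `(u, v)`. (On pairs that are not crossings
from premise to conclusion or vice versa, which never occur in a straight path, it is `0`.) -/
noncomputable def Graph.baseWeight (G : Graph) (σ : G.ResPerm) (u v : Vertex) : RL :=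
  match G.upWeight σ u v with
  | some a => a
  | none =>
    match G.upWeight σ v u with
    | some a => a.inv
    | none => 0

/-- The permuted weighting of a path. -/
noncomputable def Graph.permWeight (G : Graph) (σ : G.ResPerm) : List Vertex → RL
  | u :: v :: π => G.baseWeight σ u v * G.permWeight σ (v :: π)
  | _ => 1

/-- The weight of a path: the formal sum of its permuted weights. -/
noncomputable def Graph.weight (G : Graph) (π : List Vertex) : RL →₀ ℕ :=
  ∑ σ : G.ResPerm, Finsupp.single (G.permWeight σ π) 1

/-- A path is regular if its weight is not `0`. -/
def Graph.IsRegular (G : Graph) (π : List Vertex) : Prop := ¬ SumEq (G.weight π) 0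

/-- The regular comprehensive execution paths in the addends of a sum of nets. -/
def regularPaths (S : List Graph) : Set (List Vertex) :=
  {π | ∃ G ∈ S, π ∈ G.ecPaths ∧ G.IsRegular π}

end RC

namespace RC

-- Both sides of the equality are compared with a third number, the number of head reductions of a
-- term to `⋆`, counted with multiplicity (`count`, the total over all lengths of `headCount`).
--
-- On the side of terms, resources are neither copied nor discarded. Hence in a reduction that
-- reaches `⋆` every redex is fired exactly once, in whatever order, and a step performed anywhere
-- in a term shortens its head reductions to `⋆` by exactly one (`headCount_step_aux`). The total is
-- therefore invariant under reduction (`count_step`). The proof rests on describing the reduct of a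
-- redex as an iterated linear derivative (`bred`, `betaReduct_toList`). The chain rule `der_der`
-- and the symmetry of second derivatives `der_comm` then make firing a redex commute with the other
-- reductions and with the reordering of bags. The typing of a closed net yields a simple typing of
-- the term (`hasTy_of_typed`); progress and the decrease of size give a normal form that is a
-- multiple of `⋆`. Since `⋆` has count one, the multiple is the count, and so the normal form is
-- unique (`normal_form`).
--
-- On the side of nets, a resource permutation σ is fixed and weights are read as instructions of a
-- stack machine: crossing a link upwards pushes the symbol of the premise, crossing it downwards
-- pops it, and popping the wrong symbol is an annihilation. The machine is deterministic, so a
-- straight maximal path of non-zero σ-weight must follow its run from the root to a `⋆`-link and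
-- then retrace it (`Seg.follow`, `Graph.Rooted.eq_runPath`). Hence every σ supports at most one
-- such path. Conversely a complete run has weight `⋆`, which is not zero because the algebra has a
-- model by partial injections on stacks (`star_ne_zero`).
--
-- The run of σ simulates the head reduction in which σ decides which element of a bag replaces
-- which occurrence. Terms labelled with their addresses record this: an occurrence that has been
-- replaced remembers a run to its replacement. The tokens of a labelled term are the exponential
-- premises still to be crossed. By `exists_run` the run meets all of them exactly when no redex
-- with a wrong number of arguments is fired, that is when the evaluation is `Good`. So the
-- comprehensive regular paths come from the good permutations, and from distinct ones. Indeed a run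
-- crosses each premise of a `!`-link downwards before upwards, and the symbol popped the first time
-- reveals its number (`Seg.numbering_unique`).
--
-- Finally `card_good` counts the good permutations. The permutation attached to the `!`-link of a
-- fired redex ranges over exactly the permutations that index the addends of its reduct, so the
-- number of good permutations satisfies the recursion of `count`.

theorem Tm.ind {P : Tm → Prop} {Q : Bag → Prop} (star : P .star) (var : ∀ k, P (.var k))
    (lam : ∀ t, P t → P (.lam t)) (app : ∀ t b, P t → Q b → P (.app t b)) (nil : Q .nil)
    (cons : ∀ t b, P t → Q b → Q (.cons t b)) : (∀ t, P t) ∧ (∀ b, Q b) :=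
  ⟨fun t => Tm.rec (motive_1 := P) (motive_2 := Q) star var lam app nil cons t,
   fun b => Bag.rec (motive_1 := P) (motive_2 := Q) star var lam app nil cons b⟩

/-! ### Renamings -/

/-- The extension of a renaming under a binder. -/
def upr (ρ : ℕ → ℕ) : ℕ → ℕ
  | 0 => 0
  | n + 1 => ρ n + 1

mutual
  /-- Renaming of the free variables. -/
  def Tm.ren (ρ : ℕ → ℕ) : Tm → Tm
    | .star => .star
    | .var x => .var (ρ x)
    | .lam t => .lam (t.ren (upr ρ))
    | .app t b => .app (t.ren ρ) (b.ren ρ)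
  def Bag.ren (ρ : ℕ → ℕ) : Bag → Bag
    | .nil => .nil
    | .cons t b => .cons (t.ren ρ) (b.ren ρ)
end

theorem upr_id : upr (fun x => x) = fun x => x := by
  funext x; cases x <;> rfl

theorem upr_comp (ρ ρ' : ℕ → ℕ) : (fun x => upr ρ (upr ρ' x)) = upr fun x => ρ (ρ' x) := by
  funext x; cases x <;> rfl

theorem ren_congr :
    (∀ (t : Tm) (ρ ρ' : ℕ → ℕ), (∀ x, 0 < t.occ x → ρ x = ρ' x) → t.ren ρ = t.ren ρ') ∧
    (∀ (b : Bag) (ρ ρ' : ℕ → ℕ), (∀ x, 0 < b.occ x → ρ x = ρ' x) → b.ren ρ = b.ren ρ') := by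
  refine Tm.ind ?_ ?_ ?_ ?_ ?_ ?_
  · intros; rfl
  · intro k ρ ρ' h
    simp only [Tm.ren, h k (by simp [Tm.occ])]
  · intro t ih ρ ρ' h
    simp only [Tm.ren]
    rw [ih]
    rintro (_ | x) hx
    · rfl
    · exact congrArg (· + 1) (h x (by simpa [Tm.occ] using hx))
  · intro t b iht ihb ρ ρ' h
    simp only [Tm.ren]
    rw [iht ρ ρ' fun x hx => h x (by simp only [Tm.occ]; omega),
      ihb ρ ρ' fun x hx => h x (by simp only [Tm.occ]; omega)]
  · intros; rfl
  · intro t b iht ihb ρ ρ' h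
    simp only [Bag.ren]
    rw [iht ρ ρ' fun x hx => h x (by simp only [Bag.occ]; omega),
      ihb ρ ρ' fun x hx => h x (by simp only [Bag.occ]; omega)]

theorem ren_ren :
    (∀ (t : Tm) (ρ ρ' : ℕ → ℕ), (t.ren ρ').ren ρ = t.ren fun x => ρ (ρ' x)) ∧
    (∀ (b : Bag) (ρ ρ' : ℕ → ℕ), (b.ren ρ').ren ρ = b.ren fun x => ρ (ρ' x)) := by
  refine Tm.ind ?_ ?_ ?_ ?_ ?_ ?_ <;> simp +contextual [Tm.ren, Bag.ren, upr_comp]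

theorem ren_id :
    (∀ (t : Tm), t.ren (fun x => x) = t) ∧ (∀ (b : Bag), b.ren (fun x => x) = b) := by
  refine Tm.ind ?_ ?_ ?_ ?_ ?_ ?_ <;> simp +contextual [Tm.ren, Bag.ren, upr_id]

theorem occ_ren :
    (∀ (t : Tm) (ρ : ℕ → ℕ) (j k : ℕ), (∀ x, ρ x = j ↔ x = k) → (t.ren ρ).occ j = t.occ k) ∧
    (∀ (b : Bag) (ρ : ℕ → ℕ) (j k : ℕ), (∀ x, ρ x = j ↔ x = k) → (b.ren ρ).occ j = b.occ k) := by
  refine Tm.ind ?_ ?_ ?_ ?_ ?_ ?_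
  · intros; rfl
  · intro x ρ j k h
    simp only [Tm.ren, Tm.occ, h]
  · intro t ih ρ j k h
    simp only [Tm.ren, Tm.occ]
    apply ih
    rintro (_ | x) <;> simp [upr, h]
  · intro t b iht ihb ρ j k h
    simp only [Tm.ren, Tm.occ, iht ρ j k h, ihb ρ j k h]
  · intros; rfl
  · intro t b iht ihb ρ j k h
    simp only [Bag.ren, Bag.occ, iht ρ j k h, ihb ρ j k h]

theorem occ_ren_zero :
    (∀ (t : Tm) (ρ : ℕ → ℕ) (j : ℕ), (∀ x, ρ x ≠ j) → (t.ren ρ).occ j = 0) ∧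
    (∀ (b : Bag) (ρ : ℕ → ℕ) (j : ℕ), (∀ x, ρ x ≠ j) → (b.ren ρ).occ j = 0) := by
  refine Tm.ind ?_ ?_ ?_ ?_ ?_ ?_
  · intros; rfl
  · intro x ρ j h
    simp [Tm.ren, Tm.occ, h]
  · intro t ih ρ j h
    simp only [Tm.ren, Tm.occ]
    apply ih
    rintro (_ | x) <;> simp [upr, h]
  · intro t b iht ihb ρ j h
    simp only [Tm.ren, Tm.occ, iht ρ j h, ihb ρ j h]
  · intros; rfl
  · intro t b iht ihb ρ j h
    simp only [Bag.ren, Bag.occ, iht ρ j h, ihb ρ j h]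

theorem upr_lift (c d : ℕ) :
    upr (fun x => if x < c then x else x + d) = fun x => if x < c + 1 then x else x + d := by
  funext x
  rcases x with _ | x
  · simp [upr]
  · simp only [upr, Nat.add_lt_add_iff_right]
    split_ifs <;> omega

/-- Lifting is treated as a special renaming, so that the lemmas on occurrences, typing and
derivatives are needed for renamings only. -/
theorem lift_eq_ren :
    (∀ (t : Tm) (c d : ℕ), t.lift c d = t.ren fun x => if x < c then x else x + d) ∧
    (∀ (b : Bag) (c d : ℕ), b.lift c d = b.ren fun x => if x < c then x else x + d) := by
  refine Tm.ind ?_ ?_ ?_ ?_ ?_ ?_ <;>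
    simp +contextual [Tm.ren, Bag.ren, Tm.lift, Bag.lift, upr_lift]

theorem lift_zero_eq_ren (t : Tm) (d : ℕ) : t.lift 0 d = t.ren (· + d) := by
  rw [lift_eq_ren.1]; simp

/-- The renaming that closes the gap left by the variable `k`. -/
def decr (k x : ℕ) : ℕ := if x ≤ k then x else x - 1

theorem upr_decr (k : ℕ) : upr (decr k) = decr (k + 1) := by
  funext x
  rcases x with _ | x
  · simp [upr, decr]
  · simp only [upr, decr, Nat.add_le_add_iff_right]
    split_ifs <;> omega

/-- When `k` does not occur, `f` is never consulted and only the removal of the binder is left. The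
value of `decr k` at `k` itself is immaterial here. -/
theorem lsubst_eq_ren (f : ℕ → Tm) :
    (∀ (t : Tm) (k o : ℕ), t.occ k = 0 → t.lsubst f k o = t.ren (decr k)) ∧
    (∀ (b : Bag) (k o : ℕ), b.occ k = 0 → b.lsubst f k o = b.ren (decr k)) := by
  refine Tm.ind ?_ ?_ ?_ ?_ ?_ ?_
  · intros; rfl
  · intro x k o h
    have hx : x ≠ k := by simpa [Tm.occ] using h
    simp only [Tm.lsubst, Tm.ren, decr]
    split_ifs <;> first | rfl | omega
  · intro t ih k o h
    simp only [Tm.lsubst, Tm.ren, upr_decr]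
    rw [ih _ _ (by simpa [Tm.occ] using h)]
  · intro t b iht ihb k o h
    simp only [Tm.occ] at h
    simp only [Tm.lsubst, Tm.ren]
    rw [iht _ _ (by omega), ihb _ _ (by omega)]
  · intros; rfl
  · intro t b iht ihb k o h
    simp only [Bag.occ] at h
    simp only [Bag.lsubst, Bag.ren]
    rw [iht _ _ (by omega), ihb _ _ (by omega)]

/-- Linear substitution reads its sequence only at the consecutive positions from `o` on, one for
each occurrence. Two offsets are allowed because inserting an element shifts the later positions. -/
theorem lsubst_congr :
    (∀ (t : Tm) (f g : ℕ → Tm) (k o o' : ℕ), (∀ i < t.occ k, f (o + i) = g (o' + i)) →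
      t.lsubst f k o = t.lsubst g k o') ∧
    (∀ (b : Bag) (f g : ℕ → Tm) (k o o' : ℕ), (∀ i < b.occ k, f (o + i) = g (o' + i)) →
      b.lsubst f k o = b.lsubst g k o') := by
  refine Tm.ind ?_ ?_ ?_ ?_ ?_ ?_
  · intros; rfl
  · intro x f g k o o' h
    simp only [Tm.lsubst]
    split_ifs with h1 h2
    · rfl
    · rw [show f o = g o' by simpa using h 0 (by simp [Tm.occ, h2])]
    · rfl
  · intro t ih f g k o o' h
    simp only [Tm.lsubst]
    rw [ih f g _ _ o' (by simpa [Tm.occ] using h)]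
  · intro t b iht ihb f g k o o' h
    simp only [Tm.occ] at h
    simp only [Tm.lsubst]
    rw [iht f g _ _ o' fun i hi => h i (by omega),
      ihb f g _ _ (o' + t.occ k) fun i hi => by
        have := h (t.occ k + i) (by omega)
        simpa only [Nat.add_assoc] using this]
  · intros; rfl
  · intro t b iht ihb f g k o o' h
    simp only [Bag.occ] at h
    simp only [Bag.lsubst]
    rw [iht f g _ _ o' fun i hi => h i (by omega),
      ihb f g _ _ (o' + t.occ k) fun i hi => by
        have := h (t.occ k + i) (by omega)
        simpa only [Nat.add_assoc] using this]

/-! ### Linear derivatives -/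

mutual
  /-- The sum of the terms obtained by replacing one free occurrence of the variable `k`
  with `u`, whose variables live outside the first `k + 1` binders. -/
  def Tm.der (k : ℕ) : Tm → Tm → Multiset Tm
    | .star, _ => 0
    | .var x, u => if x = k then {u.ren (· + (k + 1))} else 0
    | .lam t, u => (t.der (k + 1) u).map .lam
    | .app t b, u => (t.der k u).map (.app · b) + (b.der k u).map (.app t ·)
  def Bag.der (k : ℕ) : Bag → Tm → Multiset Bag
    | .nil, _ => 0
    | .cons t b, u => (t.der k u).map (.cons · b) + (b.der k u).map (.cons t ·)
end

theorem der_eq_zero (u : Tm) :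
    (∀ (t : Tm) (k : ℕ), t.occ k = 0 → t.der k u = 0) ∧
    (∀ (b : Bag) (k : ℕ), b.occ k = 0 → b.der k u = 0) := by
  refine Tm.ind ?_ ?_ ?_ ?_ ?_ ?_
  · intros; rfl
  · intro x k h
    simp only [Tm.occ, ite_eq_right_iff, one_ne_zero, imp_false] at h
    simp [Tm.der, h]
  · intro t ih k h
    simp [Tm.der, ih (k + 1) h]
  · intro t b iht ihb k h
    simp only [Tm.occ] at h
    simp [Tm.der, iht k (by omega), ihb k (by omega)]
  · intros; rfl
  · intro t b iht ihb k h
    simp only [Bag.occ] at h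
    simp [Bag.der, iht k (by omega), ihb k (by omega)]

/-- Naturality of the derivative. `ρ₀` is the action of `ρ` on the variables beyond the first `k +
1`, where those of `u` live. The condition on `k` concerns only variables that occur, so that the
lemma applies to `decr 0`, which is not injective, on terms where `0` is absent. -/
theorem der_ren (u : Tm) :
    (∀ (t : Tm) (ρ ρ₀ : ℕ → ℕ) (k k' : ℕ), (∀ x, 0 < t.occ x → (ρ x = k' ↔ x = k)) →
      (∀ x, ρ (x + (k + 1)) = ρ₀ x + (k' + 1)) →
      (t.ren ρ).der k' (u.ren ρ₀) = (t.der k u).map (Tm.ren ρ)) ∧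
    (∀ (b : Bag) (ρ ρ₀ : ℕ → ℕ) (k k' : ℕ), (∀ x, 0 < b.occ x → (ρ x = k' ↔ x = k)) →
      (∀ x, ρ (x + (k + 1)) = ρ₀ x + (k' + 1)) →
      (b.ren ρ).der k' (u.ren ρ₀) = (b.der k u).map (Bag.ren ρ)) := by
  refine Tm.ind ?_ ?_ ?_ ?_ ?_ ?_
  · intros; rfl
  · intro x ρ ρ₀ k k' h h'
    simp only [Tm.ren, Tm.der, h x (by simp [Tm.occ])]
    split_ifs
    · simp [ren_ren.1, h']
    · simp
  · intro t ih ρ ρ₀ k k' h h'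
    simp only [Tm.ren, Tm.der]
    rw [ih (upr ρ) ρ₀ (k + 1) (k' + 1)]
    · simp [Multiset.map_map, Function.comp_def, Tm.ren]
    · rintro (_ | x) hx
      · simp [upr]
      · simpa [upr] using h x hx
    · intro x
      change ρ (x + (k + 1)) + 1 = _
      rw [h' x]; omega
  · intro t b iht ihb ρ ρ₀ k k' h h'
    have h1 := iht ρ ρ₀ k k' (fun x hx => h x (by simp only [Tm.occ]; omega)) h'
    have h2 := ihb ρ ρ₀ k k' (fun x hx => h x (by simp only [Tm.occ]; omega)) h'
    simp [Tm.ren, Tm.der, h1, h2, Multiset.map_map,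
      Function.comp_def]
  · intros; rfl
  · intro t b iht ihb ρ ρ₀ k k' h h'
    have h1 := iht ρ ρ₀ k k' (fun x hx => h x (by simp only [Bag.occ]; omega)) h'
    have h2 := ihb ρ ρ₀ k k' (fun x hx => h x (by simp only [Bag.occ]; omega)) h'
    simp [Bag.ren, Bag.der, h1, h2, Multiset.map_map,
      Function.comp_def]

/-- The inserted copy of `u` is shifted by `j + 1`, so its variable `k` appears as `j + k + 1` and
adds to the occurrences already there. -/
theorem occ_der_add (u : Tm) (k : ℕ) :
    (∀ (t : Tm) (j : ℕ), ∀ w ∈ t.der j u, w.occ (j + k + 1) = t.occ (j + k + 1) + u.occ k) ∧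
    (∀ (b : Bag) (j : ℕ), ∀ w ∈ b.der j u, w.occ (j + k + 1) = b.occ (j + k + 1) + u.occ k) := by
  refine Tm.ind ?_ ?_ ?_ ?_ ?_ ?_
  · intro j w hw; simp [Tm.der] at hw
  · intro x j w hw
    simp only [Tm.der] at hw
    split_ifs at hw with h
    · simp only [Multiset.mem_singleton] at hw
      subst hw
      rw [occ_ren.1 u _ (j + k + 1) k fun x => by omega]
      simp only [Tm.occ]
      rw [if_neg (by omega), zero_add]
    · simp at hw
  · intro t ih j w hw
    simp only [Tm.der, Multiset.mem_map] at hw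
    obtain ⟨w, hw, rfl⟩ := hw
    have := ih _ _ hw
    simp only [Tm.occ]
    rw [show j + k + 1 + 1 = j + 1 + k + 1 by omega, this]
  · intro t b iht ihb j w hw
    simp only [Tm.der, Multiset.mem_map, Multiset.mem_add] at hw
    obtain ⟨w, hw, rfl⟩ | ⟨w, hw, rfl⟩ := hw
    · have := iht _ _ hw; simp only [Tm.occ]; omega
    · have := ihb _ _ hw; simp only [Tm.occ]; omega
  · intro j w hw; simp [Bag.der] at hw
  · intro t b iht ihb j w hw
    simp only [Bag.der, Multiset.mem_map, Multiset.mem_add] at hw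
    obtain ⟨w, hw, rfl⟩ | ⟨w, hw, rfl⟩ := hw
    · have := iht _ _ hw; simp only [Bag.occ]; omega
    · have := ihb _ _ hw; simp only [Bag.occ]; omega

/-- A derivative consumes exactly one occurrence: the shift applied to `u` prevents it from bringing
new ones. -/
theorem occ_der_self (u : Tm) :
    (∀ (t : Tm) (k : ℕ), ∀ w ∈ t.der k u, w.occ k + 1 = t.occ k) ∧
    (∀ (b : Bag) (k : ℕ), ∀ w ∈ b.der k u, w.occ k + 1 = b.occ k) := by
  refine Tm.ind ?_ ?_ ?_ ?_ ?_ ?_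
  · intro k w hw; simp [Tm.der] at hw
  · intro x k w hw
    simp only [Tm.der] at hw
    split_ifs at hw with h
    · simp only [Multiset.mem_singleton] at hw
      subst hw
      simp only [Tm.occ, h, if_true]
      rw [occ_ren_zero.1]
      intro x; omega
    · simp at hw
  · intro t ih k w hw
    simp only [Tm.der, Multiset.mem_map] at hw
    obtain ⟨w, hw, rfl⟩ := hw
    exact ih _ _ hw
  · intro t b iht ihb k w hw
    simp only [Tm.der, Multiset.mem_map, Multiset.mem_add] at hw
    obtain ⟨w, hw, rfl⟩ | ⟨w, hw, rfl⟩ := hw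
    · have := iht _ _ hw; simp only [Tm.occ]; omega
    · have := ihb _ _ hw; simp only [Tm.occ]; omega
  · intro k w hw; simp [Bag.der] at hw
  · intro t b iht ihb k w hw
    simp only [Bag.der, Multiset.mem_map, Multiset.mem_add] at hw
    obtain ⟨w, hw, rfl⟩ | ⟨w, hw, rfl⟩ := hw
    · have := iht _ _ hw; simp only [Bag.occ]; omega
    · have := ihb _ _ hw; simp only [Bag.occ]; omega

theorem occ_der_lt (u : Tm) :
    (∀ (t : Tm) (j k : ℕ), j < k → ∀ w ∈ t.der k u, w.occ j = t.occ j) ∧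
    (∀ (b : Bag) (j k : ℕ), j < k → ∀ w ∈ b.der k u, w.occ j = b.occ j) := by
  refine Tm.ind ?_ ?_ ?_ ?_ ?_ ?_
  · intro j k h w hw; simp [Tm.der] at hw
  · intro x j k hjk w hw
    simp only [Tm.der] at hw
    split_ifs at hw with h
    · simp only [Multiset.mem_singleton] at hw
      subst hw
      simp only [Tm.occ]
      rw [if_neg (by omega), occ_ren_zero.1]
      intro x; omega
    · simp at hw
  · intro t ih j k h w hw
    simp only [Tm.der, Multiset.mem_map] at hw
    obtain ⟨w, hw, rfl⟩ := hw
    exact ih _ _ (by omega) _ hw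
  · intro t b iht ihb j k h w hw
    simp only [Tm.der, Multiset.mem_map, Multiset.mem_add] at hw
    obtain ⟨w, hw, rfl⟩ | ⟨w, hw, rfl⟩ := hw
    · have := iht _ _ h _ hw; simp only [Tm.occ]; omega
    · have := ihb _ _ h _ hw; simp only [Tm.occ]; omega
  · intro j k h w hw; simp [Bag.der] at hw
  · intro t b iht ihb j k h w hw
    simp only [Bag.der, Multiset.mem_map, Multiset.mem_add] at hw
    obtain ⟨w, hw, rfl⟩ | ⟨w, hw, rfl⟩ := hw
    · have := iht _ _ h _ hw; simp only [Bag.occ]; omega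
    · have := ihb _ _ h _ hw; simp only [Bag.occ]; omega

theorem der_shift_zero (u v : Tm) {j n : ℕ} (h : j < n) : (v.ren (· + n)).der j u = 0 :=
  (der_eq_zero u).1 _ _ (occ_ren_zero.1 _ _ _ fun x => by omega)

theorem bind_map_left {α β γ : Type*} (S : Multiset α) (f : α → β) (g : β → Multiset γ) :
    (S.map f).bind g = S.bind fun a => g (f a) := by
  simp [Multiset.bind_map]

/-- Derivatives with respect to different variables: the chain rule. -/
theorem der_der (u v : Tm) (k : ℕ) :
    (∀ (t : Tm) (j : ℕ), (t.der j v).bind (fun w => w.der (j + k + 1) u) =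
      (t.der (j + k + 1) u).bind (fun w => w.der j v) + (v.der k u).bind fun v' => t.der j v') ∧
    (∀ (b : Bag) (j : ℕ), (b.der j v).bind (fun w => w.der (j + k + 1) u) =
      (b.der (j + k + 1) u).bind (fun w => w.der j v) + (v.der k u).bind fun v' => b.der j v') := by
  refine Tm.ind ?_ ?_ ?_ ?_ ?_ ?_
  · intro j; simp [Tm.der]
  · intro x j
    simp only [Tm.der]
    by_cases h : x = j
    · subst h
      rw [if_pos rfl, if_neg (by omega)]
      simp only [Multiset.singleton_bind, if_true, Multiset.zero_bind, zero_add]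
      -- The occurrence has become a copy of `v` shifted by `x + 1`, whose variable `k` is now `x +
      -- k + 1`. The second derivative acts inside this copy, which gives the chain rule term.
      have := (der_ren u).1 v (· + (x + 1)) (fun x => x) k (x + k + 1) (by intro y _; omega)
        (by intro y; omega)
      rw [ren_id.1] at this
      rw [this, Multiset.bind_singleton]
    · rw [if_neg h]
      simp only [h, if_false, Multiset.zero_bind, Multiset.bind_zero, add_zero]
      split_ifs
      · rw [Multiset.singleton_bind, der_shift_zero _ _ (by omega)]
      · simp
  · intro t ih j
    have := ih (j + 1)
    simp only [Tm.der, bind_map_left, ← Multiset.map_bind]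
    rw [show j + k + 1 + 1 = j + 1 + k + 1 by omega, this, Multiset.map_add]
  · intro t b iht ihb j
    simp only [Tm.der, Multiset.add_bind, bind_map_left, Multiset.bind_add]
    simp only [← Multiset.map_bind, iht j, ihb j, Multiset.map_add]
    -- The mixed terms, with one derivative in the function and the other in the bag, are the same
    -- on both sides up to the order of the two sums.
    rw [Multiset.bind_map_comm (b.der j v), Multiset.bind_map_comm (t.der j v)]
    abel
  · intro j; simp [Bag.der]
  · intro t b iht ihb j
    simp only [Bag.der, Multiset.add_bind, bind_map_left, Multiset.bind_add]
    simp only [← Multiset.map_bind, iht j, ihb j, Multiset.map_add]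
    rw [Multiset.bind_map_comm (b.der j v), Multiset.bind_map_comm (t.der j v)]
    abel

/-- Symmetry of second derivatives: `u` and `v` replace two distinct occurrences, because an
inserted term contains no occurrence of the variable, so the order of replacement is irrelevant. -/
theorem der_comm (u v : Tm) :
    (∀ (t : Tm) (j : ℕ), (t.der j v).bind (fun w => w.der j u) =
      (t.der j u).bind (fun w => w.der j v)) ∧
    (∀ (b : Bag) (j : ℕ), (b.der j v).bind (fun w => w.der j u) =
      (b.der j u).bind (fun w => w.der j v)) := by
  refine Tm.ind ?_ ?_ ?_ ?_ ?_ ?_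
  · intro j; simp [Tm.der]
  · intro x j
    simp only [Tm.der]
    split_ifs
    · rw [Multiset.singleton_bind, Multiset.singleton_bind, der_shift_zero _ _ (by omega),
        der_shift_zero _ _ (by omega)]
    · simp
  · intro t ih j
    simp only [Tm.der, bind_map_left, ← Multiset.map_bind, ih]
  · intro t b iht ihb j
    simp only [Tm.der, Multiset.add_bind, bind_map_left, Multiset.bind_add]
    simp only [← Multiset.map_bind, iht j, ihb j]
    rw [Multiset.bind_map_comm (b.der j v), Multiset.bind_map_comm (t.der j v)]
    abel
  · intro j; simp [Bag.der]
  · intro t b iht ihb j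
    simp only [Bag.der, Multiset.add_bind, bind_map_left, Multiset.bind_add]
    simp only [← Multiset.map_bind, iht j, ihb j]
    rw [Multiset.bind_map_comm (b.der j v), Multiset.bind_map_comm (t.der j v)]
    abel

/-! ### The elementary reduction as an iterated derivative -/

/-- The reduct of a redex, by recursion on the bag. -/
def bred (s : Tm) : Bag → Multiset Tm
  | .nil => if s.occ 0 = 0 then {s.ren (decr 0)} else 0
  | .cons v b => (s.der 0 v).bind fun w => bred w b

/-- Insertion of `u` at the position `i` of a sequence. -/
def insAt {α : Type*} (i : ℕ) (u : α) (f : ℕ → α) (j : ℕ) : α :=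
  if j < i then f j else if j = i then u else f (j - 1)

/-- Substituting a sequence whose `i`-th entry is `u` amounts to replacing the `i`-th occurrence
first and the remaining ones afterwards. Letting `i` range over all the occurrences produces the
derivative. -/
theorem map_lsubst_insAt (u : Tm) (f : ℕ → Tm) :
    (∀ (t : Tm) (k o : ℕ), (Multiset.range (t.occ k)).map
        (fun i => t.lsubst (insAt (o + i) u f) k o) =
      (t.der k u).map fun w => w.lsubst f k o) ∧
    (∀ (b : Bag) (k o : ℕ), (Multiset.range (b.occ k)).map
        (fun i => b.lsubst (insAt (o + i) u f) k o) =
      (b.der k u).map fun w => w.lsubst f k o) := by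
  have key : ∀ (t : Tm) (b : Bag) (k o : ℕ),
      ((Multiset.range (t.occ k)).map (fun i => t.lsubst (insAt (o + i) u f) k o) =
        (t.der k u).map fun w => w.lsubst f k o) →
      (∀ o, (Multiset.range (b.occ k)).map (fun i => b.lsubst (insAt (o + i) u f) k o) =
        (b.der k u).map fun w => w.lsubst f k o) →
      (Multiset.range (t.occ k + b.occ k)).map (fun i => (t.lsubst (insAt (o + i) u f) k o,
          b.lsubst (insAt (o + i) u f) k (o + t.occ k))) =
        ((t.der k u).map fun w => (w.lsubst f k o, b.lsubst f k (o + w.occ k))) +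
        ((b.der k u).map fun w => (t.lsubst f k o, w.lsubst f k (o + t.occ k))) := by
    intro t b k o iht ihb
    have hr : Multiset.range (t.occ k + b.occ k) =
        Multiset.range (t.occ k) + (Multiset.range (b.occ k)).map (t.occ k + ·) := by
      rw [Multiset.range_add]
    rw [hr, Multiset.map_add, Multiset.map_map]
    congr 1
    -- A derivative taken in `t` uses up one of its occurrences, so the numbering in `b` starts one
    -- position earlier. This compensates for the predecessor in `insAt`.
    · have h1 : ((t.der k u).map fun w => (w.lsubst f k o, b.lsubst f k (o + w.occ k))) =
          ((t.der k u).map fun w => w.lsubst f k o).map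
            fun w => (w, b.lsubst f k (o + (t.occ k - 1))) := by
        rw [Multiset.map_map]
        refine Multiset.map_congr rfl fun w hw => ?_
        have := (occ_der_self u).1 t k w hw
        simp only [Function.comp]
        rw [show w.occ k = t.occ k - 1 by omega]
      rw [h1, ← iht, Multiset.map_map]
      refine Multiset.map_congr rfl fun i hi => ?_
      rw [Multiset.mem_range] at hi
      simp only [Function.comp, Prod.mk.injEq, true_and]
      refine lsubst_congr.2 _ _ _ _ _ _ fun l _ => ?_
      rw [insAt, if_neg (by omega), if_neg (by omega)]
      congr 1; omega
    · have h1 : ((b.der k u).map fun w => (t.lsubst f k o, w.lsubst f k (o + t.occ k))) =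
          ((b.der k u).map fun w => w.lsubst f k (o + t.occ k)).map
            fun w => (t.lsubst f k o, w) := by
        rw [Multiset.map_map]; rfl
      rw [h1, ← ihb, Multiset.map_map]
      refine Multiset.map_congr rfl fun i hi => ?_
      simp only [Function.comp, Prod.mk.injEq, Nat.add_assoc, and_true]
      refine lsubst_congr.1 _ _ _ _ _ _ fun l hl => ?_
      rw [insAt, if_pos (by omega)]
  refine Tm.ind ?_ ?_ ?_ ?_ ?_ ?_
  · intro k o; simp [Tm.der, Tm.occ]
  · intro x k o
    simp only [Tm.der, Tm.occ]
    split_ifs with h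
    · subst h
      -- No occurrence of `x` is left in the inserted copy, so the later substitution only
      -- decrements it, turning the shift by `x + 1` into the shift by `x` that `lsubst` performs.
      have : (u.ren (· + (x + 1))).occ x = 0 := occ_ren_zero.1 _ _ _ fun y => by omega
      simp [Tm.lsubst, insAt, (lsubst_eq_ren f).1 _ _ _ this, ren_ren.1, lift_zero_eq_ren,
        Multiset.range_succ]
      congr 1; funext y; simp [decr]; omega
    · simp
  · intro t ih k o
    have := congrArg (Multiset.map Tm.lam) (ih (k + 1) o)
    simpa only [Tm.der, Multiset.map_map, Function.comp_def, Tm.lsubst, Tm.occ] using this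
  · intro t b iht ihb k o
    have := congrArg (Multiset.map fun p : Tm × Bag => Tm.app p.1 p.2)
      (key t b k o (iht k o) (ihb k))
    simpa only [Tm.der, Multiset.map_map, Function.comp_def, Tm.lsubst, Tm.occ, Multiset.map_add]
      using this
  · intro k o; simp [Bag.der, Bag.occ]
  · intro t b iht ihb k o
    have := congrArg (Multiset.map fun p : Tm × Bag => Bag.cons p.1 p.2)
      (key t b k o (iht k o) (ihb k))
    simpa only [Bag.der, Multiset.map_map, Function.comp_def, Bag.lsubst, Bag.occ,
      Multiset.map_add] using this


-- Sums over permutations as recursive insertions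

theorem permutations'Aux_eq_map {α : Type*} (x : α) (l : List α) :
    List.permutations'Aux x l = (List.range (l.length + 1)).map fun i => l.insertIdx i x := by
  apply List.ext_getElem
  · simp
  · intro i h1 h2
    simp [List.getElem_permutations'Aux]

theorem getD_insertIdx {α : Type*} (x d : α) (l : List α) (i : ℕ) (h : i ≤ l.length) :
    (fun j => (l.insertIdx i x).getD j d) = insAt i x fun j => l.getD j d := by
  funext j
  simp only [List.getD_eq_getElem?_getD, insAt, List.getElem?_insertIdx]
  split_ifs <;> first | rfl | omega

/-- Since `ts` may have repeated entries, multiplicities matter. The two enumerations are first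
compared on the list of positions, which has no repetition, and then mapped along `ts.get`. -/
theorem perm_map_ofFn {α : Type*} (ts : List α) :
    ((Finset.univ : Finset (Equiv.Perm (Fin ts.length))).val.map fun σ =>
      List.ofFn fun j => ts.get (σ.symm j)) = (ts.permutations' : Multiset (List α)) := by
  have h1 : ((Finset.univ : Finset (Equiv.Perm (Fin ts.length))).val.map fun σ =>
      List.ofFn fun j => σ.symm j) = ((List.finRange ts.length).permutations : Multiset _) := by
    refine (Multiset.Nodup.ext ?_ ?_).2 ?_
    · refine Finset.univ.nodup.map fun σ τ h => ?_
      have := List.ofFn_injective h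
      ext j
      have h2 : σ.symm = τ.symm := Equiv.ext fun j => congrFun this j
      rw [← Equiv.symm_symm σ, h2, Equiv.symm_symm]
    · exact Multiset.coe_nodup.2 (List.nodup_permutations _ (List.nodup_finRange _))
    · intro l
      simp only [Multiset.mem_map, Finset.mem_val, Finset.mem_univ, true_and, Multiset.mem_coe,
        List.mem_permutations]
      constructor
      · rintro ⟨σ, rfl⟩
        rw [List.ofFn_eq_map]
        exact Equiv.Perm.map_finRange_perm σ.symm
      · intro h
        have hl : l.length = ts.length := by simpa using h.length_eq
        have hn : l.Nodup := h.nodup_iff.2 (List.nodup_finRange _)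
        let f : Fin ts.length → Fin ts.length := fun j => l.get (j.cast hl.symm)
        have hf : Function.Injective f := fun a b hab => by
          have := List.nodup_iff_injective_get.1 hn hab
          simpa [Fin.ext_iff] using this
        refine ⟨(Equiv.ofBijective f (Finite.injective_iff_bijective.1 hf)).symm, ?_⟩
        apply List.ext_getElem
        · simp [hl]
        · intro i h1 h2
          simp [f]
  have h2 := congrArg (Multiset.map (List.map ts.get)) h1
  rw [Multiset.map_map, Multiset.map_coe, List.map_permutations,
    show List.map ts.get (List.finRange ts.length) = ts from List.ext_getElem (by simp) (by simp)] at h2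
  have h3 : (ts.permutations : Multiset (List α)) = ts.permutations' :=
    Multiset.coe_eq_coe.2 (List.permutations_perm_permutations' ts)
  rw [← h3, ← h2]
  refine Multiset.map_congr rfl fun σ _ => ?_
  simp [List.map_ofFn, Function.comp_def]

/-- The permutations of a list arise by inserting its head at every position of the permutations of
the tail, and by `map_lsubst_insAt` such an insertion is a derivative. A wrong number of arguments
stays wrong along the recursion, because each derivative consumes one occurrence and one element. -/
theorem bred_eq (s : Tm) (b : Bag) : bred s b =
    if b.toList.length = s.occ 0 then
      (b.toList.permutations' : Multiset (List Tm)).map fun l =>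
        s.lsubst (fun j => l.getD j .star) 0 0
    else 0 := by
  induction b using Bag.rec (motive_1 := fun _ => True) generalizing s with
  | star => trivial
  | var => trivial
  | lam => trivial
  | app => trivial
  | nil =>
    simp only [bred, Bag.toList, List.length_nil, List.permutations']
    by_cases h : s.occ 0 = 0
    · simp [h, (lsubst_eq_ren _).1 s 0 0 h]
    · rw [if_neg h, if_neg (Ne.symm h)]
  | cons v b _ ih =>
    simp only [bred, ih]
    have hlen : (Bag.cons v b).toList.length = b.toList.length + 1 := rfl
    have hocc := (occ_der_self v).1 s 0
    by_cases h : (Bag.cons v b).toList.length = s.occ 0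
    · rw [if_pos h]
      have h1 : ((s.der 0 v).bind fun w => if b.toList.length = w.occ 0 then
            (b.toList.permutations' : Multiset (List Tm)).map fun l =>
              w.lsubst (fun j => l.getD j .star) 0 0 else 0) =
          (s.der 0 v).bind fun w => (b.toList.permutations' : Multiset (List Tm)).map fun l =>
              w.lsubst (fun j => l.getD j .star) 0 0 := by
        refine Multiset.bind_congr fun w hw => if_pos ?_
        have := hocc w hw; omega
      rw [h1, Multiset.bind_map_comm, Bag.toList, List.permutations', ← Multiset.coe_bind, Multiset.map_bind]
      refine Multiset.bind_congr fun l hl => ?_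
      have hl' : l.length = b.toList.length :=
        (List.mem_permutations'.1 (Multiset.mem_coe.1 hl)).length_eq
      rw [← (map_lsubst_insAt v _).1, permutations'Aux_eq_map, ← h, hlen, ← hl']
      simp only [Nat.zero_add, Multiset.range, Multiset.map_coe, List.map_map, Function.comp_def]
      congr 1
      refine List.map_congr_left fun i hi => ?_
      rw [getD_insertIdx _ _ _ _ (by simpa [Nat.lt_succ_iff] using hi)]
    · rw [if_neg h]
      refine (Multiset.bind_congr fun w hw => if_neg ?_).trans (Multiset.bind_zero _)
      have := hocc w hw; omega

theorem betaReduct_toList (s : Tm) (b : Bag) : betaReduct s b.toList = bred s b := by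
  rw [bred_eq, betaReduct, ← perm_map_ofFn, Multiset.map_map]
  split_ifs with h
  · refine Multiset.map_congr rfl fun σ _ => lsubst_congr.1 _ _ _ _ _ _ fun i hi => ?_
    have hi' : i < b.toList.length := by omega
    simp [hi']
  · rfl


/-! ### Functions compatible with the reduction -/

/-- The extension of a function to sums. -/
def ssum {α : Type*} (F : α → ℕ) (S : Multiset α) : ℕ := (S.map F).sum

@[simp] theorem ssum_zero {α : Type*} (F : α → ℕ) : ssum F 0 = 0 := rfl

@[simp] theorem ssum_singleton {α : Type*} (F : α → ℕ) (a : α) : ssum F {a} = F a := by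
  simp [ssum]

@[simp] theorem ssum_add {α : Type*} (F : α → ℕ) (S T : Multiset α) :
    ssum F (S + T) = ssum F S + ssum F T := by
  simp [ssum]

@[simp] theorem ssum_map {α β : Type*} (F : β → ℕ) (g : α → β) (S : Multiset α) :
    ssum F (S.map g) = ssum (fun a => F (g a)) S := by
  simp [ssum]

@[simp] theorem ssum_bind {α β : Type*} (F : β → ℕ) (g : α → Multiset β) (S : Multiset α) :
    ssum F (S.bind g) = ssum (fun a => ssum F (g a)) S := by
  simp [ssum, Multiset.map_bind, Multiset.sum_bind]

theorem ssum_fun_add {α : Type*} (F G : α → ℕ) (S : Multiset α) :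
    ssum (fun a => F a + G a) S = ssum F S + ssum G S := by
  simp [ssum, Multiset.sum_map_add]

theorem ssum_congr {α : Type*} {F G : α → ℕ} {S : Multiset α} (h : ∀ a ∈ S, F a = G a) :
    ssum F S = ssum G S := by
  rw [ssum, ssum, Multiset.map_congr rfl h]

theorem ssum_fun_zero {α : Type*} (S : Multiset α) : ssum (fun _ => 0) S = 0 := by
  simp [ssum]

theorem ssum_comm {α β : Type*} (F : α → β → ℕ) (S : Multiset α) (T : Multiset β) :
    ssum (fun a => ssum (fun b => F a b) T) S = ssum (fun b => ssum (fun a => F a b) S) T := by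
  induction S using Multiset.induction with
  | empty => simp [ssum]
  | cons a S ih =>
    rw [← Multiset.singleton_add]
    simp only [ssum_add, ssum_singleton, ih, ssum_fun_add]

theorem Step.ind {P : Tm → Multiset Tm → Prop} {Q : Bag → Multiset Bag → Prop}
    (beta : ∀ s b, P (.app (.lam s) b) (bred s b))
    (lam : ∀ t S, t.Step S → P t S → P (.lam t) (S.map .lam))
    (appL : ∀ t S b, t.Step S → P t S → P (.app t b) (S.map (.app · b)))
    (appR : ∀ t b B, b.Step B → Q b B → P (.app t b) (B.map (.app t ·)))
    (head : ∀ t S b, t.Step S → P t S → Q (.cons t b) (S.map (.cons · b)))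
    (tail : ∀ t b B, b.Step B → Q b B → Q (.cons t b) (B.map (.cons t ·))) :
    (∀ t S, t.Step S → P t S) ∧ (∀ b B, b.Step B → Q b B) :=
  ⟨fun _ _ h => Tm.Step.rec (motive_1 := fun t S _ => P t S) (motive_2 := fun b B _ => Q b B)
      (fun s b => betaReduct_toList s b ▸ beta s b) (fun h ih => lam _ _ h ih)
      (fun b h ih => appL _ _ b h ih)
      (fun t _ _ h ih => appR t _ _ h ih) (fun b h ih => head _ _ b h ih)
      (fun t _ _ h ih => tail t _ _ h ih) h,
   fun _ _ h => Bag.Step.rec (motive_1 := fun t S _ => P t S) (motive_2 := fun b B _ => Q b B)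
      (fun s b => betaReduct_toList s b ▸ beta s b) (fun h ih => lam _ _ h ih)
      (fun b h ih => appL _ _ b h ih)
      (fun t _ _ h ih => appR t _ _ h ih) (fun b h ih => head _ _ b h ih)
      (fun t _ _ h ih => tail t _ _ h ih) h⟩

theorem Tm.Step.beta' (s : Tm) (b : Bag) : (Tm.app (.lam s) b).Step (bred s b) :=
  betaReduct_toList s b ▸ Tm.Step.beta s b

theorem bred_ren (s : Tm) (b : Bag) (ρ : ℕ → ℕ) :
    bred (s.ren (upr ρ)) (b.ren ρ) = (bred s b).map (Tm.ren ρ) := by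
  induction b using Bag.rec (motive_1 := fun _ => True) generalizing s with
  | star => trivial
  | var => trivial
  | lam => trivial
  | app => trivial
  | nil =>
    have : (s.ren (upr ρ)).occ 0 = s.occ 0 :=
      occ_ren.1 _ _ _ _ fun x => by rcases x with _ | x <;> simp [upr]
    simp only [Bag.ren, bred, this]
    split_ifs with h
    · rw [Multiset.map_singleton, ren_ren.1, ren_ren.1]
      congr 1
      refine ren_congr.1 _ _ _ ?_
      rintro (_ | x) hx
      · omega
      · simp [upr, decr]
    · simp
  | cons v b _ ih =>
    have := (der_ren v).1 s (upr ρ) ρ 0 0 (fun x _ => by rcases x with _ | x <;> simp [upr])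
      (fun x => rfl)
    simp only [Bag.ren, bred, this, bind_map_left, ih, Multiset.map_bind]

theorem step_ren :
    (∀ t S, Tm.Step t S → ∀ ρ, (t.ren ρ).Step (S.map (Tm.ren ρ))) ∧
    (∀ b B, Bag.Step b B → ∀ ρ, (b.ren ρ).Step (B.map (Bag.ren ρ))) := by
  refine Step.ind ?_ ?_ ?_ ?_ ?_ ?_
  · intro s b ρ
    rw [← bred_ren]
    exact Tm.Step.beta' _ _
  all_goals
    intros
    simp only [Tm.ren, Bag.ren, Multiset.map_map, Function.comp_def]
  · rename_i ih ρ
    simpa only [Multiset.map_map, Function.comp_def] using Tm.Step.lam (ih (upr ρ))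
  · rename_i b _ ih ρ
    simpa only [Multiset.map_map, Function.comp_def] using Tm.Step.appL (b.ren ρ) (ih ρ)
  · rename_i t _ _ _ ih ρ
    simpa only [Multiset.map_map, Function.comp_def] using Tm.Step.appR (t.ren ρ) (ih ρ)
  · rename_i b _ ih ρ
    simpa only [Multiset.map_map, Function.comp_def] using Bag.Step.head (b.ren ρ) (ih ρ)
  · rename_i t _ _ _ ih ρ
    simpa only [Multiset.map_map, Function.comp_def] using Bag.Step.tail (t.ren ρ) (ih ρ)

/-- Every reduction step from `t` to a sum turns the value of `G` into the sum of the values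
of `G'`. -/
def Compat (G G' : Tm → ℕ) : Prop := ∀ t S, Tm.Step t S → G t = ssum G' S

/-- The same for bags. -/
def BCompat (G G' : Bag → ℕ) : Prop := ∀ b B, Bag.Step b B → G b = ssum G' B

/-- A step of `t` can be performed in every addend of the derivative, so differentiating and
reducing commute. When the step is a redex fired at the top, this is the Leibniz rule `leibniz`: the
derivative of a reduct is the reduct with the derivative taken in the body, plus that with the
derivative taken in the bag. -/
theorem Compat.ssum_der (u : Tm) :
    (∀ t S, Tm.Step t S → ∀ G G' k, Compat G G' →
      ssum G (t.der k u) = ssum (fun w => ssum G' (w.der k u)) S) ∧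
    (∀ b B, Bag.Step b B → ∀ G G' k, BCompat G G' →
      ssum G (b.der k u) = ssum (fun w => ssum G' (w.der k u)) B) := by
  have leibniz : ∀ (b : Bag) (s : Tm) (k : ℕ), (bred s b).bind (fun w => w.der k u) =
      (s.der (k + 1) u).bind (fun s' => bred s' b) + (b.der k u).bind (fun b' => bred s b') := by
    intro b
    induction b using Bag.rec (motive_1 := fun _ => True) with
    | star => trivial
    | var => trivial
    | lam => trivial
    | app => trivial
    | nil =>
      intro s k
      simp only [bred, Bag.der, Multiset.zero_bind, add_zero]
      have ho := (occ_der_lt u).1 s 0 (k + 1) (by omega)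
      split_ifs with h
      · rw [Multiset.singleton_bind]
        have : (s.der (k + 1) u).bind (fun s' => if s'.occ 0 = 0 then {s'.ren (decr 0)} else 0) =
            (s.der (k + 1) u).bind fun s' => {s'.ren (decr 0)} :=
          Multiset.bind_congr fun w hw => if_pos ((ho w hw).trans h)
        rw [this, Multiset.bind_singleton]
        -- Variable `0` is absent from `s`, so `decr 0` identifies no variables that occur and
        -- derivatives can be transported along it.
        have := (der_ren u).1 s (decr 0) (fun x => x) (k + 1) k
          (fun x hx => by
            have : x ≠ 0 := by rintro rfl; omega
            simp only [decr]; split_ifs <;> omega)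
          (fun x => by simp only [decr]; split_ifs <;> omega)
        rw [ren_id.1] at this
        exact this
      · refine ((Multiset.bind_congr fun w hw => if_neg ?_).trans (Multiset.bind_zero _)).symm
        rw [ho w hw]; exact h
    | cons v b _ ih =>
      intro s k
      simp only [bred, Bag.der, Multiset.bind_assoc, ih, Multiset.bind_add, Multiset.add_bind,
        bind_map_left]
      -- The chain rule at the bound variable: the part of the derivative that falls inside the copy
      -- of `v` is the part of the derivative of the bag that falls in its first element.
      have := congrArg (fun S => S.bind fun w => bred w b) ((der_der u v k).1 s 0)
      simp only [Multiset.bind_assoc, Multiset.add_bind, Nat.zero_add] at this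
      rw [this]
      rw [Multiset.bind_bind (b.der k u)]
      abel
  refine Step.ind ?_ ?_ ?_ ?_ ?_ ?_
  · intro s b G G' k hG
    rw [← ssum_bind, leibniz]
    simp only [Tm.der, ssum_add, ssum_map, ssum_bind]
    congr 1
    · exact ssum_congr fun s' _ => hG _ _ (Tm.Step.beta' _ _)
    · exact ssum_congr fun s' _ => hG _ _ (Tm.Step.beta' _ _)
  · intro t S h ih G G' k hG
    simp only [Tm.der, ssum_map]
    exact ih _ _ _ fun t S h => by rw [hG _ _ (.lam h), ssum_map]
  · intro t S b h ih G G' k hG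
    simp only [Tm.der, ssum_map, ssum_add, ssum_fun_add]
    congr 1
    · exact ih (fun t => G (.app t b)) _ _ fun t S h => by beta_reduce; rw [hG _ _ (.appL b h), ssum_map]
    -- Here the derivative falls in the bag while the step is in the function: the two operations
    -- are independent and the sums are exchanged.
    · rw [ssum_comm]
      exact ssum_congr fun b' _ => by rw [hG _ _ (.appL b' h), ssum_map]
  · intro t b B h ih G G' k hG
    simp only [Tm.der, ssum_map, ssum_add, ssum_fun_add]
    congr 1
    · rw [ssum_comm]
      exact ssum_congr fun b' _ => by rw [hG _ _ (.appR b' h), ssum_map]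
    · exact ih (fun b => G (.app t b)) _ _ fun _ _ h => by beta_reduce; rw [hG _ _ (.appR t h), ssum_map]
  · intro t S b h ih G G' k hG
    simp only [Bag.der, ssum_map, ssum_add, ssum_fun_add]
    congr 1
    · exact ih (fun t => G (.cons t b)) _ _ fun t S h => by beta_reduce; rw [hG _ _ (.head b h), ssum_map]
    · rw [ssum_comm]
      exact ssum_congr fun b' _ => by rw [hG _ _ (.head b' h), ssum_map]
  · intro t b B h ih G G' k hG
    simp only [Bag.der, ssum_map, ssum_add, ssum_fun_add]
    congr 1
    · rw [ssum_comm]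
      exact ssum_congr fun b' _ => by rw [hG _ _ (.tail b' h), ssum_map]
    · exact ih (fun b => G (.cons t b)) _ _ fun _ _ h => by beta_reduce; rw [hG _ _ (.tail t h), ssum_map]

/-- Reducing the inserted term. -/
theorem Compat.ssum_der_right {v : Tm} {V : Multiset Tm} (h : v.Step V) :
    (∀ (t : Tm) (G G' : Tm → ℕ) (k : ℕ), Compat G G' →
      ssum G (t.der k v) = ssum (fun v' => ssum G' (t.der k v')) V) ∧
    (∀ (b : Bag) (G G' : Bag → ℕ) (k : ℕ), BCompat G G' →
      ssum G (b.der k v) = ssum (fun v' => ssum G' (b.der k v')) V) := by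
  refine Tm.ind ?_ ?_ ?_ ?_ ?_ ?_
  · intros; simp [Tm.der, ssum_fun_zero]
  · intro x G G' k hG
    simp only [Tm.der]
    split_ifs
    · simp only [ssum_singleton]
      rw [hG _ _ (step_ren.1 _ _ h _), ssum_map]
    · simp [ssum_fun_zero]
  · intro t ih G G' k hG
    simp only [Tm.der, ssum_map]
    exact ih _ _ _ fun t S h => by rw [hG _ _ (.lam h), ssum_map]
  · intro t b iht ihb G G' k hG
    simp only [Tm.der, ssum_map, ssum_add, ssum_fun_add]
    congr 1
    · exact iht (fun t => G (.app t b)) _ _ fun t S h => by beta_reduce; rw [hG _ _ (.appL b h), ssum_map]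
    · exact ihb (fun b => G (.app t b)) _ _ fun _ _ h => by beta_reduce; rw [hG _ _ (.appR t h), ssum_map]
  · intros; simp [Bag.der, ssum_fun_zero]
  · intro t b iht ihb G G' k hG
    simp only [Bag.der, ssum_map, ssum_add, ssum_fun_add]
    congr 1
    · exact iht (fun t => G (.cons t b)) _ _ fun t S h => by beta_reduce; rw [hG _ _ (.head b h), ssum_map]
    · exact ihb (fun b => G (.cons t b)) _ _ fun _ _ h => by beta_reduce; rw [hG _ _ (.tail t h), ssum_map]

theorem occ_bred (b : Bag) (s : Tm) (k : ℕ) :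
    ∀ w ∈ bred s b, w.occ k = s.occ (k + 1) + b.occ k := by
  induction b using Bag.rec (motive_1 := fun _ => True) generalizing s with
  | star => trivial
  | var => trivial
  | lam => trivial
  | app => trivial
  | nil =>
    intro w hw
    simp only [bred] at hw
    split_ifs at hw with h
    · rw [Multiset.mem_singleton] at hw
      subst hw
      -- `decr 0` sends both `0` and `1` to `0`. It is altered at the absent variable `0`, with a
      -- value other than `k`, so that `k + 1` becomes the only preimage of `k`.
      have h1 : s.ren (decr 0) = (s.ren fun x => if x = 0 then k + 1 else x - 1) :=
        ren_congr.1 _ _ _ fun x hx => by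
          have : x ≠ 0 := by rintro rfl; omega
          simp only [decr]; split_ifs <;> omega
      rw [h1, occ_ren.1 s _ k (k + 1) fun x => by split_ifs <;> omega]
      simp [Bag.occ]
    · simp at hw
  | cons v b _ ih =>
    intro w hw
    simp only [bred, Multiset.mem_bind] at hw
    obtain ⟨s', hs', hw⟩ := hw
    have h1 := ih s' w hw
    have h2 := (occ_der_add v k).1 s 0 s' hs'
    simp only [Nat.zero_add] at h2
    simp only [Bag.occ]
    omega

/-- Linearity: each addend of a reduct contains every resource exactly once, so the numbers of free
occurrences never change. -/
theorem step_occ :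
    (∀ t S, Tm.Step t S → ∀ k, ∀ w ∈ S, w.occ k = t.occ k) ∧
    (∀ b B, Bag.Step b B → ∀ k, ∀ w ∈ B, w.occ k = b.occ k) := by
  refine Step.ind ?_ ?_ ?_ ?_ ?_ ?_
  · exact fun s b k => occ_bred b s k
  all_goals
    intros
    rename_i hw
    rw [Multiset.mem_map] at hw
    obtain ⟨w, hw, rfl⟩ := hw
    simp only [Tm.occ, Bag.occ]
    rename_i ih _
    rw [ih _ _ hw]

/-- Reducing the body of an abstraction before or after the redex is fired makes no difference for a
compatible pair. The bag is consumed one element at a time by `Compat.ssum_der`. -/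
theorem Compat.ssum_bred {G G' : Tm → ℕ} (hG : Compat G G') (b : Bag) :
    Compat (fun s => ssum G (bred s b)) (fun s => ssum G' (bred s b)) := by
  induction b using Bag.rec (motive_1 := fun _ => True) with
  | star => trivial
  | var => trivial
  | lam => trivial
  | app => trivial
  | nil =>
    intro t S h
    simp only [bred]
    have ho := step_occ.1 _ _ h 0
    split_ifs with h0
    · rw [ssum_singleton, hG _ _ (step_ren.1 _ _ h _), ssum_map]
      refine ssum_congr fun w hw => ?_
      rw [if_pos ((ho w hw).trans h0), ssum_singleton]
    · rw [ssum_zero]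
      refine Eq.symm ((ssum_congr fun w hw => ?_).trans (ssum_fun_zero S))
      rw [if_neg (by rw [ho w hw]; exact h0), ssum_zero]
  | cons v b _ ih =>
    intro t S h
    simp only [bred, ssum_bind]
    exact (Compat.ssum_der v).1 _ _ h _ _ _ ih

/-- A step in a bag is a step in one of its elements. It is followed into the place where that
element is inserted by `Compat.ssum_der_right`, while the preceding insertions only exchange sums.
-/
theorem Compat.ssum_bred_right {G G' : Tm → ℕ} (hG : Compat G G') (s : Tm) :
    BCompat (fun b => ssum G (bred s b)) (fun b => ssum G' (bred s b)) := by
  intro b B h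
  suffices H : (∀ t S, Tm.Step t S → True) ∧ (∀ b B, Bag.Step b B → ∀ s,
      ssum G (bred s b) = ssum (fun b => ssum G' (bred s b)) B) from H.2 b B h s
  refine Step.ind ?_ ?_ ?_ ?_ ?_ ?_ <;> try (intros; trivial)
  · intro t S b h _ s
    simp only [bred, ssum_bind, ssum_map]
    exact (Compat.ssum_der_right h).1 s _ _ 0 (hG.ssum_bred b)
  · intro t b B h ih s
    simp only [bred, ssum_bind, ssum_map]
    rw [ssum_comm]
    exact ssum_congr fun w _ => ih w

end RC

open scoped ENNReal
namespace RC

/-! ### Counting the head reductions to `⋆` -/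

/-- The value of the head configuration of a term applied to a list of bags, given the values
of its reducts. -/
def spine (F : Tm → List Bag → ℕ) : Tm → List Bag → ℕ
  | .star, _ => 0
  | .var _, _ => 0
  | .lam _, [] => 0
  | .lam s, b :: S => ssum (F · S) (bred s b)
  | .app t b, S => spine F t (b :: S)

/-- The number of ways in which `t` applied to the bags in `S` reaches `⋆` in exactly `f` head
reduction steps. -/
def headCount : ℕ → Tm → List Bag → ℕ
  | 0, .star, [] => 1
  | 0, _, _ => 0
  | f + 1, t, S => spine (headCount f) t S

/-- `headCount` with one step less. -/
def headCountPred : ℕ → Tm → List Bag → ℕ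
  | 0, _, _ => 0
  | f + 1, t, S => headCount f t S

theorem headCount_star_cons (f : ℕ) (b : Bag) (S : List Bag) :
    headCount f .star (b :: S) = 0 := by
  cases f <;> rfl

theorem headCount_var (f k : ℕ) (S : List Bag) : headCount f (.var k) S = 0 := by
  cases f <;> rfl

theorem headCount_lam_nil (f : ℕ) (s : Tm) : headCount f (.lam s) [] = 0 := by
  cases f <;> rfl

theorem headCount_lam_cons (f : ℕ) (s : Tm) (b : Bag) (S : List Bag) :
    headCount f (.lam s) (b :: S) = ssum (headCountPred f · S) (bred s b) := by
  cases f
  · exact (ssum_fun_zero _).symm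
  · rfl

theorem headCount_zero_cons (t : Tm) (b : Bag) (S : List Bag) : headCount 0 t (b :: S) = 0 := by
  cases t <;> rfl

theorem headCount_app (f : ℕ) (t : Tm) (b : Bag) (S : List Bag) :
    headCount f (.app t b) S = headCount f t (b :: S) := by
  cases f
  · rw [headCount_zero_cons]; rfl
  · rfl

/-- One bag of a list is reduced. -/
inductive BagsStep : List Bag → Multiset (List Bag) → Prop
  | head {b : Bag} {B : Multiset Bag} (S : List Bag) : b.Step B →
      BagsStep (b :: S) (B.map (· :: S))
  | tail (b : Bag) {S : List Bag} {X : Multiset (List Bag)} : BagsStep S X →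
      BagsStep (b :: S) (X.map (b :: ·))

/-- A head reduction to `⋆` fires each redex once, so a step performed in advance saves exactly one
step later. At the head redex this is the definition of `headCount`. A step in the body or in the
argument of the head redex is moved past its firing by the two commutation lemmas for `bred`, with
the induction hypothesis for one step less. Steps in the term and in the pending bags have to be
treated together, since an argument becomes a pending bag. -/
theorem headCount_step_aux (f : ℕ) :
    (∀ S, Compat (headCount f · S) (headCountPred f · S)) ∧
    (∀ t S X, BagsStep S X → headCount f t S = ssum (headCountPred f t) X) := by
  induction f with
  | zero =>
    constructor
    · intro S t T h
      cases h <;> exact (ssum_fun_zero _).symm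
    · intro t S X h
      cases h <;> exact (headCount_zero_cons _ _ _).trans (ssum_fun_zero _).symm
  | succ f ih =>
    obtain ⟨ih1, ih2⟩ := ih
    -- The statement on bags comes first, because a step in the argument of an application is a step
    -- in the first pending bag.
    have h2 : ∀ t S X, BagsStep S X → headCount (f + 1) t S = ssum (headCount f t) X := by
      intro t
      induction t using Tm.rec (motive_2 := fun _ => True) with
      | star =>
        intro S X h
        cases h <;>
          simp [headCount_star_cons, ssum_fun_zero]
      | var k =>
        intro S X h
        cases h <;> simp [headCount_var, ssum_fun_zero]
      | lam s _ =>
        intro S X h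
        cases h with
        | head S h =>
          simp only [ssum_map, headCount_lam_cons]
          exact Compat.ssum_bred_right (ih1 S) s _ _ h
        | tail b h =>
          simp only [ssum_map, headCount_lam_cons]
          rw [ssum_comm]
          exact ssum_congr fun u _ => ih2 u _ _ h
      | app t b iht _ =>
        intro S X h
        rw [headCount_app, iht _ _ (.tail b h), ssum_map]
        exact ssum_congr fun _ _ => (headCount_app _ _ _ _).symm
      | nil => trivial
      | cons => trivial
    refine ⟨fun S t T h => ?_, h2⟩
    suffices H : (∀ t T, Tm.Step t T → ∀ S, headCount (f + 1) t S = ssum (headCount f · S) T) ∧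
        (∀ b B, Bag.Step b B → True) from H.1 t T h S
    refine Step.ind ?_ ?_ ?_ ?_ ?_ ?_
    · intro s b S; rfl
    · intro t T h _ S
      cases S with
      | nil => simp [headCount_lam_nil, ssum_fun_zero]
      | cons b S =>
        simp only [ssum_map, headCount_lam_cons]
        exact Compat.ssum_bred (ih1 S) b _ _ h
    · intro t T b h ih S
      rw [headCount_app, ih, ssum_map]
      exact ssum_congr fun _ _ => (headCount_app _ _ _ _).symm
    · intro t b B h _ S
      rw [headCount_app, h2 _ _ _ (.head S h), ssum_map, ssum_map]
      exact ssum_congr fun _ _ => (headCount_app _ _ _ _).symm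
    · intros; trivial
    · intros; trivial

/-- The total number of head reductions to `⋆`. -/
noncomputable def count (t : Tm) (S : List Bag) : ℝ≥0∞ := ∑' f, (headCount f t S : ℝ≥0∞)

/-- Totals are taken in `ℝ≥0∞`, where sums can be exchanged before anything is known about the
finiteness of the number of head reductions. -/
theorem tsum_ssum {α : Type*} (F : ℕ → α → ℕ) (S : Multiset α) :
    ∑' f, (ssum (F f) S : ℝ≥0∞) = (S.map fun a => ∑' f, (F f a : ℝ≥0∞)).sum := by
  induction S using Multiset.induction with
  | empty => simp
  | cons a S ih =>
    rw [Multiset.map_cons, Multiset.sum_cons, ← ih, ← ENNReal.tsum_add]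
    simp [ssum]

theorem tsum_headCount_succ (t : Tm) (S : List Bag) (h : headCount 0 t S = 0) :
    count t S = ∑' f, (headCount (f + 1) t S : ℝ≥0∞) := by
  rw [count, tsum_eq_zero_add' ENNReal.summable, h]
  simp

theorem count_star_nil : count .star [] = 1 := by
  rw [count, tsum_eq_single 0]
  · simp [headCount]
  · rintro (_ | f) h
    · exact absurd rfl h
    · simp [headCount, spine]

theorem count_app (t : Tm) (b : Bag) (S : List Bag) :
    count (.app t b) S = count t (b :: S) := by
  simp only [count, headCount_app]

theorem count_lam_cons (s : Tm) (b : Bag) (S : List Bag) :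
    count (.lam s) (b :: S) = ((bred s b).map (count · S)).sum := by
  rw [tsum_headCount_succ _ _ rfl]
  exact tsum_ssum _ _

/-- Shortening every head reduction by one step only reindexes the sum over lengths, so the total is
an invariant of reduction. -/
theorem count_step {t : Tm} {T : Multiset Tm} (h : t.Step T) (S : List Bag) :
    count t S = (T.map (count · S)).sum := by
  have h0 : ∀ f, headCount f t S = ssum (headCountPred f · S) T :=
    fun f => (headCount_step_aux f).1 S _ _ h
  rw [tsum_headCount_succ _ _ ((h0 0).trans (ssum_fun_zero _))]
  simp only [h0]
  exact tsum_ssum _ _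

/-! ### Invariance under the permutation of bags -/

theorem Eqv.ind {P : Tm → Tm → Prop} {Q : Bag → Bag → Prop} (star : P .star .star)
    (var : ∀ k, P (.var k) (.var k))
    (lam : ∀ t t', Tm.Eqv t t' → P t t' → P (.lam t) (.lam t'))
    (app : ∀ t t' b b', Tm.Eqv t t' → Bag.Eqv b b' → P t t' → Q b b' →
      P (.app t b) (.app t' b'))
    (nil : Q .nil .nil)
    (cons : ∀ t t' b b', Tm.Eqv t t' → Bag.Eqv b b' → P t t' → Q b b' →
      Q (.cons t b) (.cons t' b'))
    (swap : ∀ s t b, Q (.cons s (.cons t b)) (.cons t (.cons s b)))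
    (trans : ∀ b b' b'', Bag.Eqv b b' → Bag.Eqv b' b'' → Q b b' → Q b' b'' → Q b b'') :
    (∀ t t', Tm.Eqv t t' → P t t') ∧ (∀ b b', Bag.Eqv b b' → Q b b') :=
  ⟨fun _ _ h => Tm.Eqv.rec (motive_1 := fun t t' _ => P t t') (motive_2 := fun b b' _ => Q b b')
      star var (fun h ih => lam _ _ h ih) (fun h h' ih ih' => app _ _ _ _ h h' ih ih') nil
      (fun h h' ih ih' => cons _ _ _ _ h h' ih ih') swap
      (fun h h' ih ih' => trans _ _ _ h h' ih ih') h,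
   fun _ _ h => Bag.Eqv.rec (motive_1 := fun t t' _ => P t t') (motive_2 := fun b b' _ => Q b b')
      star var (fun h ih => lam _ _ h ih) (fun h h' ih ih' => app _ _ _ _ h h' ih ih') nil
      (fun h h' ih ih' => cons _ _ _ _ h h' ih ih') swap
      (fun h h' ih ih' => trans _ _ _ h h' ih ih') h⟩

theorem eqv_refl : (∀ t, Tm.Eqv t t) ∧ (∀ b, Bag.Eqv b b) :=
  Tm.ind .star .var (fun _ => .lam) (fun _ _ => .app) .nil (fun _ _ => .cons)

theorem eqv_ren :
    (∀ t t', Tm.Eqv t t' → ∀ ρ, Tm.Eqv (t.ren ρ) (t'.ren ρ)) ∧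
    (∀ b b', Bag.Eqv b b' → ∀ ρ, Bag.Eqv (b.ren ρ) (b'.ren ρ)) :=
  Eqv.ind (fun _ => .star) (fun _ _ => .var _) (fun _ _ _ ih _ => .lam (ih _))
    (fun _ _ _ _ _ _ h h' _ => .app (h _) (h' _)) (fun _ => .nil)
    (fun _ _ _ _ _ _ h h' _ => .cons (h _) (h' _)) (fun _ _ _ _ => .swap _ _ _)
    (fun _ _ _ _ _ h h' _ => .trans (h _) (h' _))

theorem eqv_occ :
    (∀ t t', Tm.Eqv t t' → ∀ k, t.occ k = t'.occ k) ∧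
    (∀ b b', Bag.Eqv b b' → ∀ k, b.occ k = b'.occ k) := by
  refine Eqv.ind ?_ ?_ ?_ ?_ ?_ ?_ ?_ ?_ <;> intros <;> simp_all [Tm.occ, Bag.occ]
  omega

/-- The function does not depend on the order of bags. -/
def Resp (F : Tm → ℕ) : Prop := ∀ t t', Tm.Eqv t t' → F t = F t'

/-- The same for bags. -/
def BResp (F : Bag → ℕ) : Prop := ∀ b b', Bag.Eqv b b' → F b = F b'

theorem resp_der (u : Tm) :
    (∀ t t', Tm.Eqv t t' → ∀ F k, Resp F → ssum F (t.der k u) = ssum F (t'.der k u)) ∧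
    (∀ b b', Bag.Eqv b b' → ∀ F k, BResp F → ssum F (b.der k u) = ssum F (b'.der k u)) := by
  refine Eqv.ind ?_ ?_ ?_ ?_ ?_ ?_ ?_ ?_
  · intros; rfl
  · intros; rfl
  · intro t t' h ih F k hF
    simp only [Tm.der, ssum_map]
    exact ih _ _ fun _ _ h => hF _ _ (.lam h)
  · intro t t' b b' h h' ih ih' F k hF
    simp only [Tm.der, ssum_map, ssum_add]
    rw [ih (fun a => F (.app a b)) _ fun _ _ h => hF _ _ (.app h (eqv_refl.2 _)),
      ih' (fun a => F (.app t a)) _ fun _ _ h => hF _ _ (.app (eqv_refl.1 _) h)]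
    rw [ssum_congr fun a _ => hF _ _ (.app (eqv_refl.1 a) h'),
      ssum_congr fun a _ => hF _ _ (.app h (eqv_refl.2 a))]
  · intros; rfl
  · intro t t' b b' h h' ih ih' F k hF
    simp only [Bag.der, ssum_map, ssum_add]
    rw [ih (fun a => F (.cons a b)) _ fun _ _ h => hF _ _ (.cons h (eqv_refl.2 _)),
      ih' (fun a => F (.cons t a)) _ fun _ _ h => hF _ _ (.cons (eqv_refl.1 _) h)]
    rw [ssum_congr fun a _ => hF _ _ (.cons (eqv_refl.1 a) h'),
      ssum_congr fun a _ => hF _ _ (.cons h (eqv_refl.2 a))]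
  · intro s t b F k hF
    simp only [Bag.der, ssum_map, ssum_add]
    rw [ssum_congr fun a _ => hF _ _ (.swap a t b), ssum_congr fun a _ => hF _ _ (.swap s a b),
      ssum_congr fun a _ => hF _ _ (.swap s t a)]
    ring
  · intro b b' b'' _ _ h h' F k hF
    exact (h F k hF).trans (h' F k hF)

theorem resp_der_right {u u' : Tm} (hu : Tm.Eqv u u') :
    (∀ t F k, Resp F → ssum F (Tm.der k t u) = ssum F (t.der k u')) ∧
    (∀ b F k, BResp F → ssum F (Bag.der k b u) = ssum F (b.der k u')) := by
  refine Tm.ind ?_ ?_ ?_ ?_ ?_ ?_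
  · intros; rfl
  · intro x F k hF
    simp only [Tm.der]
    split_ifs
    · simpa using hF _ _ (eqv_ren.1 _ _ hu _)
    · rfl
  · intro t ih F k hF
    simp only [Tm.der, ssum_map]
    exact ih _ _ fun _ _ h => hF _ _ (.lam h)
  · intro t b ih ih' F k hF
    simp only [Tm.der, ssum_map, ssum_add]
    rw [ih (fun a => F (.app a b)) _ fun _ _ h => hF _ _ (.app h (eqv_refl.2 _)),
      ih' (fun a => F (.app t a)) _ fun _ _ h => hF _ _ (.app (eqv_refl.1 _) h)]
  · intros; rfl
  · intro t b ih ih' F k hF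
    simp only [Bag.der, ssum_map, ssum_add]
    rw [ih (fun a => F (.cons a b)) _ fun _ _ h => hF _ _ (.cons h (eqv_refl.2 _)),
      ih' (fun a => F (.cons t a)) _ fun _ _ h => hF _ _ (.cons (eqv_refl.1 _) h)]

theorem resp_bred {F : Tm → ℕ} (hF : Resp F) (b : Bag) : Resp fun s => ssum F (bred s b) := by
  induction b using Bag.rec (motive_1 := fun _ => True) with
  | star => trivial
  | var => trivial
  | lam => trivial
  | app => trivial
  | nil =>
    intro t t' h
    simp only [bred, eqv_occ.1 _ _ h]
    split_ifs
    · simpa using hF _ _ (eqv_ren.1 _ _ h _)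
    · rfl
  | cons v b _ ih =>
    intro t t' h
    simp only [bred, ssum_bind]
    exact (resp_der v).1 _ _ h _ _ ih

theorem resp_bred_right {F : Tm → ℕ} (hF : Resp F) {b b' : Bag} (h : Bag.Eqv b b') (s : Tm) :
    ssum F (bred s b) = ssum F (bred s b') := by
  suffices H : (∀ t t', Tm.Eqv t t' → True) ∧ (∀ b b', Bag.Eqv b b' → ∀ s,
      ssum F (bred s b) = ssum F (bred s b')) from H.2 b b' h s
  refine Eqv.ind ?_ ?_ ?_ ?_ ?_ ?_ ?_ ?_
  iterate 4 (intros; trivial)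
  · intros; rfl
  · intro t t' b b' ht hb _ ih s
    simp only [bred, ssum_bind]
    rw [ssum_congr fun w _ => ih w]
    exact (resp_der_right ht).1 _ _ _ (resp_bred hF b')
  · intro u t b s
    simp only [bred, ← Multiset.bind_assoc]
    -- Exchanging two elements of a bag exchanges the first two derivatives.
    rw [(der_comm t u).1]
  · intro b b' b'' _ _ h h' s
    exact (h s).trans (h' s)

/-- This lets the count descend to simple terms with multisets as bags, where a step may use any
representative. -/
theorem headCount_resp (f : ℕ) : ∀ t t', Tm.Eqv t t' → ∀ S S', List.Forall₂ Bag.Eqv S S' →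
    headCount f t S = headCount f t' S' := by
  induction f with
  | zero =>
    intro t t' h S S' hS
    cases h <;> cases hS <;> simp [headCount]
  | succ f ih =>
    suffices H : (∀ t t', Tm.Eqv t t' → ∀ S S', List.Forall₂ Bag.Eqv S S' →
        headCount (f + 1) t S = headCount (f + 1) t' S') ∧ (∀ b b', Bag.Eqv b b' → True) from H.1
    refine Eqv.ind ?_ ?_ ?_ ?_ ?_ ?_ ?_ ?_
    · intros; rfl
    · intros; rfl
    · intro t t' h _ S S' hS
      cases hS with
      | nil => rfl
      | @cons _ _ _ l hb hS =>
        simp only [headCount_lam_cons, headCountPred]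
        rw [ssum_congr fun u _ => ih u u (eqv_refl.1 u) _ _ hS]
        have hR : Resp (headCount f · l) := fun t t' h =>
          ih _ _ h _ _ (List.forall₂_same.2 fun b _ => eqv_refl.2 b)
        rw [resp_bred_right hR hb]
        exact resp_bred hR _ _ _ h
    · intro t t' b b' _ hb ih _ S S' hS
      rw [headCount_app, headCount_app]
      exact ih _ _ (.cons hb hS)
    iterate 4 (intros; trivial)

/-- The number of head reductions to `⋆`, for terms up to the order of bags. -/
noncomputable def STerm.count (t : STerm) : ℝ≥0∞ :=
  Quot.lift (fun t : Tm => RC.count t []) (fun t t' h => by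
    simp only [RC.count, headCount_resp _ _ _ h [] [] .nil]) t

theorem count_toSTerm (t : Tm) : t.toSTerm.count = count t [] := rfl

/-- The same for sums. -/
noncomputable def Term.count (T : Term) : ℝ≥0∞ := (T.map STerm.count).sum

theorem Term.Step.count_eq {T T' : Term} (h : Term.Step T T') : T.count = T'.count := by
  obtain ⟨t, S, R, h⟩ := h
  simp only [Term.count, Multiset.map_cons, Multiset.sum_cons, Multiset.map_add,
    Multiset.sum_add, Multiset.map_map, Function.comp_def, count_toSTerm, count_step h []]

theorem Term.count_eq_of_reflTransGen {T T' : Term} (h : Relation.ReflTransGen Term.Step T T') :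
    T.count = T'.count := by
  induction h with
  | refl => rfl
  | tail _ h ih => exact ih.trans h.count_eq

theorem Term.count_replicate_star (n : ℕ) :
    Term.count (Multiset.replicate n Tm.star.toSTerm) = n := by
  simp [Term.count, Multiset.map_replicate, count_toSTerm, count_star_nil]


/-! ### Simple types -/

/-- The extension of a typing context. -/
def extend (A : Ty) (Γ : ℕ → Option Ty) : ℕ → Option Ty
  | 0 => some A
  | k + 1 => Γ k

mutual
  /-- The term has the type `A` in the context `Γ`. -/
  def Tm.HasTy : Tm → (ℕ → Option Ty) → Ty → Prop
    | .star, _, A => A = .star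
    | .var k, Γ, A => Γ k = some A
    | .lam t, Γ, A => ∃ B C, A = .arr B C ∧ t.HasTy (extend B Γ) C
    | .app t b, Γ, A => ∃ B, t.HasTy Γ (.arr B A) ∧ b.HasTy Γ B
  def Bag.HasTy : Bag → (ℕ → Option Ty) → Ty → Prop
    | .nil, _, _ => True
    | .cons t b, Γ, A => t.HasTy Γ A ∧ b.HasTy Γ A
end

theorem hasTy_ren :
    (∀ (t : Tm) (ρ : ℕ → ℕ) (Γ Γ' : ℕ → Option Ty) (A : Ty),
      (∀ x, 0 < t.occ x → Γ' (ρ x) = Γ x) → t.HasTy Γ A → (t.ren ρ).HasTy Γ' A) ∧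
    (∀ (b : Bag) (ρ : ℕ → ℕ) (Γ Γ' : ℕ → Option Ty) (A : Ty),
      (∀ x, 0 < b.occ x → Γ' (ρ x) = Γ x) → b.HasTy Γ A → (b.ren ρ).HasTy Γ' A) := by
  refine Tm.ind ?_ ?_ ?_ ?_ ?_ ?_
  · intro ρ Γ Γ' A _ h; exact h
  · intro x ρ Γ Γ' A h h'
    exact (h x (by simp [Tm.occ])).trans h'
  · rintro t ih ρ Γ Γ' A h ⟨B, C, rfl, h'⟩
    refine ⟨B, C, rfl, ih _ _ _ _ ?_ h'⟩
    rintro (_ | x) hx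
    · rfl
    · exact h x hx
  · rintro t b iht ihb ρ Γ Γ' A h ⟨B, h1, h2⟩
    exact ⟨B, iht _ _ _ _ (fun x hx => h x (by simp only [Tm.occ]; omega)) h1,
      ihb _ _ _ _ (fun x hx => h x (by simp only [Tm.occ]; omega)) h2⟩
  · intros; trivial
  · rintro t b iht ihb ρ Γ Γ' A h ⟨h1, h2⟩
    exact ⟨iht _ _ _ _ (fun x hx => h x (by simp only [Bag.occ]; omega)) h1,
      ihb _ _ _ _ (fun x hx => h x (by simp only [Bag.occ]; omega)) h2⟩

/-- Subject reduction reduces to this: a derivative replaces a variable of type `A` with a term of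
type `A`, typed in the context without the first `k + 1` variables. -/
theorem hasTy_der (u : Tm) (A : Ty) :
    (∀ (t : Tm) (k : ℕ) (Γ : ℕ → Option Ty) (B : Ty), Γ k = some A →
      u.HasTy (fun x => Γ (x + (k + 1))) A → t.HasTy Γ B → ∀ w ∈ t.der k u, w.HasTy Γ B) ∧
    (∀ (b : Bag) (k : ℕ) (Γ : ℕ → Option Ty) (B : Ty), Γ k = some A →
      u.HasTy (fun x => Γ (x + (k + 1))) A → b.HasTy Γ B → ∀ w ∈ b.der k u, w.HasTy Γ B) := by
  refine Tm.ind ?_ ?_ ?_ ?_ ?_ ?_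
  · intro k Γ B _ _ _ w hw; simp [Tm.der] at hw
  · intro x k Γ B hk hu hx w hw
    simp only [Tm.der] at hw
    split_ifs at hw with h
    · subst h
      rw [Multiset.mem_singleton] at hw
      subst hw
      obtain rfl : A = B := Option.some.inj (hk.symm.trans hx)
      exact hasTy_ren.1 _ _ _ _ _ (fun y _ => rfl) hu
    · simp at hw
  · rintro t ih k Γ B hk hu ⟨C, D, rfl, h⟩ w hw
    simp only [Tm.der, Multiset.mem_map] at hw
    obtain ⟨w, hw, rfl⟩ := hw
    exact ⟨C, D, rfl, ih (k + 1) (extend C Γ) D hk hu h w hw⟩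
  · rintro t b iht ihb k Γ B hk hu ⟨C, h1, h2⟩ w hw
    simp only [Tm.der, Multiset.mem_map, Multiset.mem_add] at hw
    obtain ⟨w, hw, rfl⟩ | ⟨w, hw, rfl⟩ := hw
    · exact ⟨C, iht _ _ _ hk hu h1 _ hw, h2⟩
    · exact ⟨C, h1, ihb _ _ _ hk hu h2 _ hw⟩
  · intro k Γ B _ _ _ w hw; simp [Bag.der] at hw
  · rintro t b iht ihb k Γ B hk hu ⟨h1, h2⟩ w hw
    simp only [Bag.der, Multiset.mem_map, Multiset.mem_add] at hw
    obtain ⟨w, hw, rfl⟩ | ⟨w, hw, rfl⟩ := hw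
    · exact ⟨iht _ _ _ hk hu h1 _ hw, h2⟩
    · exact ⟨h1, ihb _ _ _ hk hu h2 _ hw⟩

theorem hasTy_bred (b : Bag) {s : Tm} {Γ : ℕ → Option Ty} {A B : Ty}
    (hs : s.HasTy (extend A Γ) B) (hb : b.HasTy Γ A) : ∀ w ∈ bred s b, w.HasTy Γ B := by
  induction b using Bag.rec (motive_1 := fun _ => True) generalizing s with
  | star => trivial
  | var => trivial
  | lam => trivial
  | app => trivial
  | nil =>
    intro w hw
    simp only [bred] at hw
    split_ifs at hw with h
    · rw [Multiset.mem_singleton] at hw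
      subst hw
      refine hasTy_ren.1 _ _ _ _ _ ?_ hs
      rintro (_ | x) hx
      · omega
      · simp [decr, extend]
    · simp at hw
  | cons v b _ ih =>
    intro w hw
    simp only [bred, Multiset.mem_bind] at hw
    obtain ⟨s', hs', hw⟩ := hw
    exact ih ((hasTy_der v A).1 s 0 _ B rfl hb.1 hs s' hs') hb.2 w hw

theorem hasTy_step :
    (∀ t S, Tm.Step t S → ∀ Γ A, t.HasTy Γ A → ∀ w ∈ S, w.HasTy Γ A) ∧
    (∀ b B, Bag.Step b B → ∀ Γ A, b.HasTy Γ A → ∀ w ∈ B, w.HasTy Γ A) := by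
  refine Step.ind ?_ ?_ ?_ ?_ ?_ ?_
  · rintro s b Γ A ⟨B, ⟨_, _, h, hs⟩, hb⟩
    cases h
    exact hasTy_bred b hs hb
  · rintro t S _ ih Γ _ ⟨B, C, rfl, h⟩ w hw
    obtain ⟨w, hw', rfl⟩ := Multiset.mem_map.1 hw
    exact ⟨B, C, rfl, ih _ _ h w hw'⟩
  · rintro t S b _ ih Γ A ⟨B, h, h'⟩ w hw
    obtain ⟨w, hw', rfl⟩ := Multiset.mem_map.1 hw
    exact ⟨B, ih _ _ h w hw', h'⟩
  · rintro t b B _ ih Γ A ⟨C, h, h'⟩ w hw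
    obtain ⟨w, hw', rfl⟩ := Multiset.mem_map.1 hw
    exact ⟨C, h, ih _ _ h' w hw'⟩
  · rintro t S b _ ih Γ A ⟨h, h'⟩ w hw
    obtain ⟨w, hw', rfl⟩ := Multiset.mem_map.1 hw
    exact ⟨ih _ _ h w hw', h'⟩
  · rintro t b B _ ih Γ A ⟨h, h'⟩ w hw
    obtain ⟨w, hw', rfl⟩ := Multiset.mem_map.1 hw
    exact ⟨h, ih _ _ h' w hw'⟩

theorem hasTy_eqv :
    (∀ t t', Tm.Eqv t t' → ∀ Γ A, t.HasTy Γ A ↔ t'.HasTy Γ A) ∧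
    (∀ b b', Bag.Eqv b b' → ∀ Γ A, b.HasTy Γ A ↔ b'.HasTy Γ A) := by
  refine Eqv.ind ?_ ?_ ?_ ?_ ?_ ?_ ?_ ?_ <;> intros <;> simp_all [Tm.HasTy, Bag.HasTy]
  exact and_left_comm

/-- The function of a closed application has an arrow type, so it cannot be `⋆`: it is an
abstraction, which makes a redex, or it reduces. -/
theorem progress (t : Tm) (A : Ty) (h : t.HasTy (fun _ => none) A) :
    t = .star ∨ (∃ s, t = .lam s) ∨ ∃ S, t.Step S := by
  induction t using Tm.rec (motive_2 := fun _ => True) generalizing A with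
  | star => exact .inl rfl
  | var k => cases h
  | lam s _ => exact .inr (.inl ⟨s, rfl⟩)
  | app t b ih _ =>
    obtain ⟨B, h1, h2⟩ := h
    right; right
    rcases ih _ h1 with rfl | ⟨s, rfl⟩ | ⟨S, hS⟩
    · cases h1
    · exact ⟨_, .beta s b⟩
    · exact ⟨_, .appL b hS⟩
  | nil => trivial
  | cons => trivial

-- Reduction decreases the size

mutual
  /-- The size of a term. -/
  def Tm.size : Tm → ℕ
    | .star => 1
    | .var _ => 1
    | .lam t => t.size + 1
    | .app t b => t.size + b.size + 1
  def Bag.size : Bag → ℕ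
    | .nil => 0
    | .cons t b => t.size + b.size
end

theorem size_ren : (∀ (t : Tm) ρ, (t.ren ρ).size = t.size) ∧
    (∀ (b : Bag) ρ, (b.ren ρ).size = b.size) := by
  refine Tm.ind ?_ ?_ ?_ ?_ ?_ ?_ <;> intros <;> simp_all [Tm.size, Bag.size, Tm.ren, Bag.ren]

theorem size_der (u : Tm) : (∀ (t : Tm) k, ∀ w ∈ t.der k u, w.size ≤ t.size + u.size) ∧
    (∀ (b : Bag) k, ∀ w ∈ b.der k u, w.size ≤ b.size + u.size) := by
  refine Tm.ind ?_ ?_ ?_ ?_ ?_ ?_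
  · intro k w hw; simp [Tm.der] at hw
  · intro x k w hw
    simp only [Tm.der] at hw
    split_ifs at hw with h
    · rw [Multiset.mem_singleton] at hw
      subst hw
      simp [size_ren.1, Tm.size]
    · simp at hw
  · intro t ih k w hw
    obtain ⟨w, hw', rfl⟩ := Multiset.mem_map.1 hw
    have := ih _ _ hw'
    simp only [Tm.size]; omega
  · intro t b iht ihb k w hw
    simp only [Tm.der, Multiset.mem_map, Multiset.mem_add] at hw
    obtain ⟨w, hw, rfl⟩ | ⟨w, hw, rfl⟩ := hw
    · have := iht _ _ hw; simp only [Tm.size]; omega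
    · have := ihb _ _ hw; simp only [Tm.size]; omega
  · intro k w hw; simp [Bag.der] at hw
  · intro t b iht ihb k w hw
    simp only [Bag.der, Multiset.mem_map, Multiset.mem_add] at hw
    obtain ⟨w, hw, rfl⟩ | ⟨w, hw, rfl⟩ := hw
    · have := iht _ _ hw; simp only [Bag.size]; omega
    · have := ihb _ _ hw; simp only [Bag.size]; omega

theorem size_bred (b : Bag) (s : Tm) : ∀ w ∈ bred s b, w.size ≤ s.size + b.size := by
  induction b using Bag.rec (motive_1 := fun _ => True) generalizing s with
  | star => trivial
  | var => trivial
  | lam => trivial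
  | app => trivial
  | nil =>
    intro w hw
    simp only [bred] at hw
    split_ifs at hw with h
    · rw [Multiset.mem_singleton] at hw
      subst hw
      simp [size_ren.1]
    · simp at hw
  | cons v b _ ih =>
    intro w hw
    simp only [bred, Multiset.mem_bind] at hw
    obtain ⟨s', hs', hw⟩ := hw
    have h1 := ih s' w hw
    have h2 := (size_der v).1 s 0 s' hs'
    simp only [Bag.size]; omega

/-- Arguments are moved without being copied, so a fired redex loses at least its application and
its abstraction. Termination needs no typing. -/
theorem size_step :
    (∀ t S, Tm.Step t S → ∀ w ∈ S, w.size < t.size) ∧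
    (∀ b B, Bag.Step b B → ∀ w ∈ B, w.size < b.size) := by
  refine Step.ind ?_ ?_ ?_ ?_ ?_ ?_
  · intro s b w hw
    have := size_bred b s w hw
    simp only [Tm.size]; omega
  all_goals
    intros
    rename_i ih _ hw
    rw [Multiset.mem_map] at hw
    obtain ⟨w, hw, rfl⟩ := hw
    have := ih _ hw
    simp only [Tm.size, Bag.size]
    omega

/-! ### Normalisation -/

theorem Term.Step.add_right {T T' : Term} (h : Term.Step T T') (R : Term) :
    Term.Step (T + R) (T' + R) := by
  obtain ⟨t, S, R', h⟩ := h
  rw [Multiset.cons_add, add_assoc]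
  exact .mk t S (R' + R) h

theorem Term.reflTransGen_add {T T' R R' : Term} (h : Relation.ReflTransGen Term.Step T T')
    (h' : Relation.ReflTransGen Term.Step R R') :
    Relation.ReflTransGen Term.Step (T + R) (T' + R') := by
  refine Relation.ReflTransGen.trans (b := T' + R) ?_ ?_
  · exact h.lift (· + R) fun _ _ h => h.add_right R
  · simp only [add_comm T']
    exact h'.lift (· + T') fun _ _ h => h.add_right T'

theorem normalises_sum (S : Multiset Tm)
    (h : ∀ t ∈ S, ∃ n, Relation.ReflTransGen Term.Step {t.toSTerm}
      (Multiset.replicate n Tm.star.toSTerm)) :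
    ∃ n, Relation.ReflTransGen Term.Step (S.map Tm.toSTerm)
      (Multiset.replicate n Tm.star.toSTerm) := by
  induction S using Multiset.induction with
  | empty => exact ⟨0, .refl⟩
  | cons t S ih =>
    obtain ⟨n, hn⟩ := h t (Multiset.mem_cons_self _ _)
    obtain ⟨m, hm⟩ := ih fun t ht => h t (Multiset.mem_cons_of_mem ht)
    refine ⟨n + m, ?_⟩
    rw [Multiset.map_cons, ← Multiset.singleton_add, Multiset.replicate_add]
    exact Term.reflTransGen_add hn hm

theorem normalises (t : Tm) (h : t.HasTy (fun _ => none) .star) :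
    ∃ n, Relation.ReflTransGen Term.Step {t.toSTerm}
      (Multiset.replicate n Tm.star.toSTerm) := by
  induction hn : t.size using Nat.strong_induction_on generalizing t with
  | _ N ih =>
    rcases progress t _ h with rfl | ⟨s, rfl⟩ | ⟨S, hS⟩
    · exact ⟨1, .refl⟩
    · obtain ⟨_, _, h, _⟩ := h
      cases h
    · obtain ⟨n, hn'⟩ := normalises_sum S fun w hw =>
        ih _ (hn ▸ size_step.1 _ _ hS w hw) w (hasTy_step.1 _ _ hS _ _ h w hw) rfl
      refine ⟨n, .head ?_ hn'⟩
      have := Term.Step.mk t S 0 hS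
      simpa using this

/-- The simple term is closed and has the ground type. -/
def STerm.IsGround (t : STerm) : Prop :=
  Quot.lift (fun t : Tm => t.HasTy (fun _ => none) .star)
    (fun _ _ h => propext (hasTy_eqv.1 _ _ h _ _)) t

theorem Term.Step.isGround {T T' : Term} (h : Term.Step T T') (hT : ∀ t ∈ T, t.IsGround) :
    ∀ t ∈ T', t.IsGround := by
  obtain ⟨t, S, R, h⟩ := h
  intro u hu
  rcases Multiset.mem_add.1 hu with hu | hu
  · obtain ⟨w, hw, rfl⟩ := Multiset.mem_map.1 hu
    exact hasTy_step.1 _ _ h _ _ (hT _ (Multiset.mem_cons_self _ _)) w hw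
  · exact hT _ (Multiset.mem_cons_of_mem hu)

theorem Term.isGround_of_reflTransGen {T T' : Term} (h : Relation.ReflTransGen Term.Step T T')
    (hT : ∀ t ∈ T, t.IsGround) : ∀ t ∈ T', t.IsGround := by
  induction h with
  | refl => exact hT
  | tail _ h ih => exact h.isGround ih

theorem Term.eq_replicate_of_normal {T : Term} (hT : ∀ t ∈ T, t.IsGround)
    (hn : ∀ T', ¬ Term.Step T T') : T = Multiset.replicate T.card Tm.star.toSTerm := by
  rw [Multiset.eq_replicate]
  refine ⟨rfl, fun u hu => ?_⟩
  induction u using Quot.inductionOn with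
  | _ t =>
    rcases progress t _ (hT _ hu) with rfl | ⟨s, rfl⟩ | ⟨S, hS⟩
    · rfl
    · obtain ⟨_, _, h, _⟩ := hT _ hu
      cases h
    · obtain ⟨R, rfl⟩ := Multiset.exists_cons_of_mem hu
      exact absurd (Term.Step.mk t S R hS) (hn _)

theorem star_normal {S : Multiset Tm} {t : Tm} (h : t.toSTerm = Tm.star.toSTerm) :
    ¬ t.Step S := by
  intro hS
  have h1 : ∀ u : Tm, u.toSTerm = Tm.star.toSTerm → u = .star := by
    intro u hu
    -- Being `⋆` is compatible with the reordering of bags, so it is a predicate on the quotient,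
    -- and the equality of classes gives equality of the representatives.
    let P : STerm → Prop := Quot.lift (fun u : Tm => u = .star) fun a b h => by
      cases h <;> simp
    have : P u.toSTerm := hu ▸ (rfl : Tm.star = .star)
    exact this
  rw [h1 t h] at hS
  cases hS

theorem Term.replicate_star_normal (n : ℕ) (T' : Term) :
    ¬ Term.Step (Multiset.replicate n Tm.star.toSTerm) T' := by
  intro h
  generalize hT : (Multiset.replicate n Tm.star.toSTerm : Term) = T at h
  obtain ⟨t, S, R, h⟩ := h
  refine star_normal (Multiset.eq_of_mem_replicate (n := n) ?_) h
  rw [hT]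
  exact Multiset.mem_cons_self _ _

/-- A sum of closed terms of the ground type has exactly one normal form, which is a multiple
of `⋆`, and the coefficient is the number of head reductions to `⋆`. -/
theorem normal_form (t : List Tm) (h : ∀ u ∈ t, u.HasTy (fun _ => none) .star) :
    ∃ n : ℕ, Term.IsNormalForm (t.map Tm.toSTerm : List STerm)
        (Multiset.replicate n Tm.star.toSTerm) ∧
      (∀ S : Term, Term.IsNormalForm (t.map Tm.toSTerm : List STerm) S →
        S = Multiset.replicate n Tm.star.toSTerm) ∧
      (t.map (count · [])).sum = n := by
  obtain ⟨n, hn⟩ := normalises_sum (t : Multiset Tm) fun u hu => normalises u (h u hu)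
  rw [Multiset.map_coe] at hn
  have hg : ∀ u ∈ ((t.map Tm.toSTerm : List STerm) : Term), u.IsGround := by
    intro u hu
    obtain ⟨v, hv, rfl⟩ := List.mem_map.1 (Multiset.mem_coe.1 hu)
    exact h v hv
  have hc := Term.count_eq_of_reflTransGen hn
  rw [Term.count_replicate_star] at hc
  refine ⟨n, ⟨hn, Term.replicate_star_normal n⟩, fun S hS => ?_, ?_⟩
  · have h1 := Term.eq_replicate_of_normal (Term.isGround_of_reflTransGen hS.1 hg) hS.2
    have h2 := Term.count_eq_of_reflTransGen hS.1
    rw [h1, Term.count_replicate_star, hc] at h2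
    rw [h1, Nat.cast_inj.1 h2.symm]
  · rw [← hc, Term.count, Multiset.map_coe, Multiset.sum_coe, List.map_map]
    rfl


/-! ### Addresses of subterms -/

/-- `u` is the subterm at the address `b` of the term `t` at the address `a`. -/
inductive Sub (t : Tm) (a : Vertex) : Tm → Vertex → Prop
  | refl : Sub t a t a
  | lam {s : Tm} {b : Vertex} : Sub t a (.lam s) b → Sub t a s (0 :: b)
  | fn {s : Tm} {B : Bag} {b : Vertex} : Sub t a (.app s B) b → Sub t a s (0 :: b)
  | arg {s u : Tm} {B : Bag} {b : Vertex} {i : ℕ} : Sub t a (.app s B) b →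
      B.toList[i]? = some u → Sub t a u (i :: 1 :: b)

theorem Sub.suffix {t u : Tm} {a b : Vertex} (h : Sub t a u b) : a <:+ b := by
  induction h with
  | refl => exact List.suffix_rfl
  | lam _ ih => exact ih.trans (List.suffix_cons _ _)
  | fn _ ih => exact ih.trans (List.suffix_cons _ _)
  | arg _ _ ih => exact ih.trans ((List.suffix_cons _ _).trans (List.suffix_cons _ _))

theorem not_cons_suffix {α : Type*} (x : α) (l : List α) : ¬ x :: l <:+ l := by
  intro h
  have := h.length_le
  simp at this

/-- Addresses of bags are not addresses of subterms. If `1 :: b` were one, it could only be the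
element of index `1` of a bag whose address is `b = 1 :: b'`. Then `b` would again be the address of
both a subterm and a bag, and one descends to the shorter `b'`. -/
theorem Sub.not_bag {t u u' : Tm} {a b : Vertex} (h : Sub t a u b) : ¬ Sub t a u' (1 :: b) := by
  induction hn : b.length using Nat.strong_induction_on generalizing b u u' with
  | _ n ih =>
    intro h'
    generalize hc : 1 :: b = c at h'
    cases h' with
    | refl => subst hc; exact not_cons_suffix _ _ h.suffix
    | lam => simp at hc
    | fn => simp at hc
    | @arg _ _ _ b' _ hb' =>
      simp only [List.cons.injEq] at hc
      obtain ⟨_, rfl⟩ := hc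
      exact ih b'.length (by subst hn; simp) hb' rfl h

/-- The end of an address tells how it was reached. The entry `0` may mean a body, a function or the
first element of a bag. The first two are told apart by uniqueness one level up, and the third by
`Sub.not_bag`. -/
theorem Sub.unique {t u u' : Tm} {a b : Vertex} (h : Sub t a u b) (h' : Sub t a u' b) :
    u = u' := by
  induction h generalizing u' with
  | refl =>
    generalize hc : a = c at h'
    cases h' with
    | refl => rfl
    | lam h => subst hc; exact absurd h.suffix (not_cons_suffix _ _)
    | fn h => subst hc; exact absurd h.suffix (not_cons_suffix _ _)
    | arg h =>
      subst hc
      exact absurd ((List.suffix_cons _ _).trans h.suffix) (not_cons_suffix _ _)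
  | @lam s b h ih =>
    generalize hc : 0 :: b = c at h'
    cases h' with
    | refl => subst hc; exact absurd h.suffix (not_cons_suffix _ _)
    | lam h' =>
      obtain rfl := (List.cons.inj hc).2
      exact Tm.lam.inj (ih h')
    | fn h' =>
      obtain rfl := (List.cons.inj hc).2
      cases ih h'
    | arg h' =>
      obtain rfl := (List.cons.inj hc).2
      exact absurd h h'.not_bag
  | @fn s B b h ih =>
    generalize hc : 0 :: b = c at h'
    cases h' with
    | refl => subst hc; exact absurd h.suffix (not_cons_suffix _ _)
    | lam h' =>
      obtain rfl := (List.cons.inj hc).2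
      cases ih h'
    | fn h' =>
      obtain rfl := (List.cons.inj hc).2
      exact (Tm.app.inj (ih h')).1
    | arg h' =>
      obtain rfl := (List.cons.inj hc).2
      exact absurd h h'.not_bag
  | @arg s u B b i h hi ih =>
    generalize hc : i :: 1 :: b = c at h'
    cases h' with
    | refl =>
      subst hc
      exact absurd ((List.suffix_cons _ _).trans h.suffix) (not_cons_suffix _ _)
    | lam h' =>
      obtain rfl := (List.cons.inj hc).2
      exact absurd h' h.not_bag
    | fn h' =>
      obtain rfl := (List.cons.inj hc).2
      exact absurd h' h.not_bag
    | arg h' hi' =>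
      simp only [List.cons.injEq, true_and] at hc
      obtain ⟨rfl, rfl⟩ := hc
      cases ih h'
      exact Option.some.inj (hi.symm.trans hi')

/-- The links that a subterm contributes to the translation. -/
inductive Own : Tm → Vertex → Link → Prop
  | star (b : Vertex) : Own .star b (.star b)
  | imp (s : Tm) (b : Vertex) : Own (.lam s) b (.imp (1 :: b) (0 :: b) b)
  | wn (s : Tm) (b : Vertex) : Own (.lam s) b (.wn (s.occs 0 (0 :: b)) (1 :: b))
  | nimp (s : Tm) (B : Bag) (b : Vertex) : Own (.app s B) b (.nimp (1 :: b) b (0 :: b))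
  | oc (s : Tm) (B : Bag) (b : Vertex) :
      Own (.app s B) b (.oc (B.roots 0 (1 :: b)) (1 :: b))

theorem exists_own (t₀ : Tm) (a₀ : Vertex) :
    (∀ (t : Tm) (a : Vertex), Sub t₀ a₀ t a → ∀ l ∈ t.pretrans a,
      ∃ u b, Sub t₀ a₀ u b ∧ Own u b l) ∧
    (∀ (B : Bag) (a : Vertex) (i : ℕ),
      (∀ j u, B.toList[j]? = some u → Sub t₀ a₀ u ((i + j) :: a)) → ∀ l ∈ B.pretrans i a,
      ∃ u b, Sub t₀ a₀ u b ∧ Own u b l) := by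
  refine Tm.ind ?_ ?_ ?_ ?_ ?_ ?_
  · intro a h l hl
    simp only [Tm.pretrans, Finset.mem_singleton] at hl
    subst hl
    exact ⟨_, _, h, .star a⟩
  · intro k a h l hl
    simp [Tm.pretrans] at hl
  · intro t ih a h l hl
    simp only [Tm.pretrans, Finset.mem_union, Finset.mem_insert, Finset.mem_singleton] at hl
    obtain (rfl | rfl) | hl := hl
    · exact ⟨_, _, h, .imp _ _⟩
    · exact ⟨_, _, h, .wn _ _⟩
    · exact ih _ h.lam l hl
  · intro t B iht ihB a h l hl
    simp only [Tm.pretrans, Finset.mem_union, Finset.mem_insert, Finset.mem_singleton] at hl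
    obtain ((rfl | rfl) | hl) | hl := hl
    · exact ⟨_, _, h, .nimp _ _ _⟩
    · exact ⟨_, _, h, .oc _ _ _⟩
    · exact iht _ h.fn l hl
    · exact ihB _ 0 (fun j u hj => by simpa using h.arg hj) l hl
  · intro a i h l hl
    simp [Bag.pretrans] at hl
  · intro t B iht ihB a i h l hl
    simp only [Bag.pretrans, Finset.mem_union] at hl
    obtain hl | hl := hl
    · exact iht _ (h 0 t rfl) l hl
    · refine ihB a (i + 1) (fun j u hj => ?_) l hl
      have := h (j + 1) u hj
      rwa [show i + 1 + j = i + (j + 1) by omega]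

theorem mem_occs_suffix :
    (∀ (t : Tm) (k : ℕ) (a : Vertex), ∀ o ∈ t.occs k a, a <:+ o) ∧
    (∀ (B : Bag) (k i : ℕ) (a : Vertex), ∀ o ∈ B.occs k i a, ∃ j, (i + j) :: a <:+ o) := by
  refine Tm.ind ?_ ?_ ?_ ?_ ?_ ?_
  · intro k a o ho; simp [Tm.occs] at ho
  · intro x k a o ho
    simp only [Tm.occs] at ho
    split_ifs at ho
    · simp only [List.mem_singleton] at ho; subst ho; exact List.suffix_rfl
    · simp at ho
  · intro t ih k a o ho
    exact (List.suffix_cons _ _).trans (ih _ _ o ho)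
  · intro t B iht ihB k a o ho
    simp only [Tm.occs, List.mem_append] at ho
    obtain ho | ho := ho
    · exact (List.suffix_cons _ _).trans (iht _ _ o ho)
    · obtain ⟨j, hj⟩ := ihB _ _ _ o ho
      exact ((List.suffix_cons _ _).trans (List.suffix_cons _ _)).trans hj
  · intro k i a o ho; simp [Bag.occs] at ho
  · intro t B iht ihB k i a o ho
    simp only [Bag.occs, List.mem_append] at ho
    obtain ho | ho := ho
    · exact ⟨0, iht _ _ o ho⟩
    · obtain ⟨j, hj⟩ := ihB _ _ _ o ho
      exact ⟨j + 1, by rwa [show i + (j + 1) = i + 1 + j by omega]⟩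

theorem mem_roots {B : Bag} {i : ℕ} {a r : Vertex} (h : r ∈ B.roots i a) :
    ∃ j, r = (i + j) :: a := by
  induction B using Bag.rec (motive_1 := fun _ => True) generalizing i with
  | star => trivial
  | var => trivial
  | lam => trivial
  | app => trivial
  | nil => simp [Bag.roots] at h
  | cons t B _ ih =>
    simp only [Bag.roots, List.mem_cons] at h
    obtain rfl | h := h
    · exact ⟨0, rfl⟩
    · obtain ⟨j, rfl⟩ := ih h
      exact ⟨j + 1, by congr 1; omega⟩

theorem not_suffix_of_ne {x y : ℕ} {b o : Vertex} (hxy : x ≠ y) (h : x :: b <:+ o) :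
    ¬ y :: b <:+ o := by
  intro h'
  have := List.suffix_of_suffix_length_le h h' (by simp)
  have := this.eq_of_length (by simp)
  exact hxy (List.cons.inj this).1

/-- The edges of the links of a translation. -/
inductive Edge (t : Tm) (a : Vertex) : Link → Vertex → Vertex → Prop
  | imp₁ {s : Tm} {b : Vertex} : Sub t a (.lam s) b →
      Edge t a (.imp (1 :: b) (0 :: b) b) (1 :: b) b
  | imp₂ {s : Tm} {b : Vertex} : Sub t a (.lam s) b →
      Edge t a (.imp (1 :: b) (0 :: b) b) (0 :: b) b
  | wn {s : Tm} {b o : Vertex} : Sub t a (.lam s) b → 0 :: b <:+ o →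
      Edge t a (.wn (s.occs 0 (0 :: b)) (1 :: b)) o (1 :: b)
  | nimp₁ {s : Tm} {B : Bag} {b : Vertex} : Sub t a (.app s B) b →
      Edge t a (.nimp (1 :: b) b (0 :: b)) (1 :: b) (0 :: b)
  | nimp₂ {s : Tm} {B : Bag} {b : Vertex} : Sub t a (.app s B) b →
      Edge t a (.nimp (1 :: b) b (0 :: b)) b (0 :: b)
  | oc {s : Tm} {B : Bag} {b : Vertex} (i : ℕ) : Sub t a (.app s B) b →
      Edge t a (.oc (B.roots 0 (1 :: b)) (1 :: b)) (i :: 1 :: b) (1 :: b)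

theorem Own.edge {t u : Tm} {a b v : Vertex} {l : Link} (h : Sub t a u b) (hl : Own u b l)
    (hv : v ∈ l.premises) : Edge t a l v l.concl := by
  cases hl with
  | star => simp [Link.premises] at hv
  | imp =>
    simp only [Link.premises, List.mem_cons, List.not_mem_nil, or_false] at hv
    obtain rfl | rfl := hv
    · exact .imp₁ h
    · exact .imp₂ h
  | wn => exact .wn h (mem_occs_suffix.1 _ _ _ _ hv)
  | nimp =>
    simp only [Link.premises, List.mem_cons, List.not_mem_nil, or_false] at hv
    obtain rfl | rfl := hv
    · exact .nimp₁ h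
    · exact .nimp₂ h
  | oc =>
    obtain ⟨j, rfl⟩ := mem_roots hv
    rw [Nat.zero_add]
    exact .oc j h

theorem cons_ne_self' {α : Type*} (x : α) (l : List α) : x :: l ≠ l := by
  intro h
  have := congrArg List.length h
  simp at this

/-- Paths record vertices only, so crossings have a definite link, and hence a definite weight, only
because a premise and a conclusion determine the link between them. -/
theorem Edge.unique {t : Tm} {a u v : Vertex} {l l' : Link} (h : Edge t a l u v)
    (h' : Edge t a l' u v) : l = l' := by
  cases h <;> cases h' <;> grind [Sub.not_bag, Sub.unique]

/-- The direction of a crossing is determined too: no pair of vertices is premise and conclusion of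
one link and conclusion and premise of another. -/
theorem Edge.anti {t : Tm} {a u v : Vertex} {l l' : Link} (h : Edge t a l u v) :
    ¬ Edge t a l' v u := by
  intro h'
  cases h <;> cases h'
  -- Each occurrence lies below the body of its binder, so the two suffix relations force equal
  -- lengths. The addresses would then coincide, although one starts with `0` and the other with
  -- `1`.
  case wn.wn h₁ h₂ =>
    have := h₁.length_le
    have := h₂.length_le
    have := h₁.eq_of_length (by simp at *; omega)
    simp at this
  all_goals grind [Sub.not_bag, Sub.unique, not_cons_suffix]


/-! ### Translations of closed terms -/

theorem mem_verts_iff {l : Link} {v : Vertex} : v ∈ l.verts ↔ v = l.concl ∨ v ∈ l.premises := by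
  simp [Link.verts]

theorem pretrans_suffix :
    (∀ (t : Tm) (a : Vertex), ∀ l ∈ t.pretrans a, ∀ v ∈ l.verts, a <:+ v) ∧
    (∀ (B : Bag) (i : ℕ) (a : Vertex), ∀ l ∈ B.pretrans i a, ∀ v ∈ l.verts, a <:+ v) := by
  refine Tm.ind ?_ ?_ ?_ ?_ ?_ ?_
  · intro a l hl v hv
    simp only [Tm.pretrans, Finset.mem_singleton] at hl
    subst hl
    simp [mem_verts_iff, Link.concl, Link.premises] at hv
    subst hv; exact List.suffix_rfl
  · intro k a l hl
    simp [Tm.pretrans] at hl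
  · intro t ih a l hl v hv
    simp only [Tm.pretrans, Finset.mem_union, Finset.mem_insert, Finset.mem_singleton] at hl
    obtain (rfl | rfl) | hl := hl
    · simp [mem_verts_iff, Link.concl, Link.premises] at hv
      obtain rfl | rfl | rfl := hv <;> simp
    · simp only [mem_verts_iff, Link.concl, Link.premises] at hv
      obtain rfl | hv := hv
      · simp
      · exact (List.suffix_cons _ _).trans (mem_occs_suffix.1 _ _ _ _ hv)
    · exact (List.suffix_cons _ _).trans (ih _ l hl v hv)
  · intro t B iht ihB a l hl v hv
    simp only [Tm.pretrans, Finset.mem_union, Finset.mem_insert, Finset.mem_singleton] at hl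
    obtain ((rfl | rfl) | hl) | hl := hl
    · simp [mem_verts_iff, Link.concl, Link.premises] at hv
      obtain rfl | rfl | rfl := hv <;> simp
    · simp only [mem_verts_iff, Link.concl, Link.premises] at hv
      obtain rfl | hv := hv
      · simp
      · obtain ⟨j, rfl⟩ := mem_roots hv
        exact (List.suffix_cons _ _).trans (List.suffix_cons _ _)
    · exact (List.suffix_cons _ _).trans (iht _ l hl v hv)
    · exact (List.suffix_cons _ _).trans (ihB _ _ l hl v hv)
  · intro i a l hl
    simp [Bag.pretrans] at hl
  · intro t B iht ihB i a l hl v hv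
    simp only [Bag.pretrans, Finset.mem_union] at hl
    obtain hl | hl := hl
    · exact (List.suffix_cons _ _).trans (iht _ l hl v hv)
    · exact ihB _ _ l hl v hv

theorem bag_occs_suffix {B : Bag} {k i : ℕ} {a o : Vertex} (h : o ∈ B.occs k i a) : a <:+ o := by
  obtain ⟨j, hj⟩ := mem_occs_suffix.2 _ _ _ _ _ h
  exact (List.suffix_cons _ _).trans hj

theorem eq_or_suffix_of_mem_occs {t : Tm} {k : ℕ} {a o : Vertex} (h : o ∈ t.occs k a) :
    o = a ∨ 0 :: a <:+ o ∨ 1 :: a <:+ o := by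
  cases t with
  | star => simp [Tm.occs] at h
  | var x =>
    simp only [Tm.occs] at h
    split_ifs at h <;> simp_all
  | lam t => exact .inr (.inl (mem_occs_suffix.1 _ _ _ _ h))
  | app t B =>
    simp only [Tm.occs, List.mem_append] at h
    obtain h | h := h
    · exact .inr (.inl (mem_occs_suffix.1 _ _ _ _ h))
    · exact .inr (.inr (bag_occs_suffix h))

theorem eq_or_suffix_of_mem_pretrans {t : Tm} {a v : Vertex} {l : Link} (hl : l ∈ t.pretrans a)
    (hv : v ∈ l.verts) : v = a ∨ 0 :: a <:+ v ∨ 1 :: a <:+ v := by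
  cases t with
  | star =>
    simp only [Tm.pretrans, Finset.mem_singleton] at hl
    subst hl
    simp [mem_verts_iff, Link.concl, Link.premises] at hv
    exact .inl hv
  | var x => simp [Tm.pretrans] at hl
  | lam t =>
    simp only [Tm.pretrans, Finset.mem_union, Finset.mem_insert, Finset.mem_singleton] at hl
    obtain (rfl | rfl) | hl := hl
    · simp [mem_verts_iff, Link.concl, Link.premises] at hv
      obtain rfl | rfl | rfl := hv <;> simp
    · simp only [mem_verts_iff, Link.concl, Link.premises] at hv
      obtain rfl | hv := hv
      · simp
      · exact .inr (.inl (mem_occs_suffix.1 _ _ _ _ hv))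
    · exact .inr (.inl (pretrans_suffix.1 _ _ l hl v hv))
  | app t B =>
    simp only [Tm.pretrans, Finset.mem_union, Finset.mem_insert, Finset.mem_singleton] at hl
    obtain ((rfl | rfl) | hl) | hl := hl
    · simp [mem_verts_iff, Link.concl, Link.premises] at hv
      obtain rfl | rfl | rfl := hv <;> simp
    · simp only [mem_verts_iff, Link.concl, Link.premises] at hv
      obtain rfl | hv := hv
      · simp
      · obtain ⟨j, rfl⟩ := mem_roots hv
        exact .inr (.inr (List.suffix_cons _ _))
    · exact .inr (.inl (pretrans_suffix.1 _ _ l hl v hv))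
    · exact .inr (.inr (pretrans_suffix.2 _ _ _ l hl v hv))

/-- Apart from the link of the outermost constructor, every link of the pre-translation has its
vertices strictly below the root. -/
theorem root_link_unique {t : Tm} {a : Vertex} {l l' : Link} (hl : l ∈ t.pretrans a)
    (hl' : l' ∈ t.pretrans a) (hv : a ∈ l.verts) (hv' : a ∈ l'.verts) : l = l' := by
  cases t with
  | star => simp_all [Tm.pretrans]
  | var x => simp [Tm.pretrans] at hl
  | lam t =>
    have key : ∀ l ∈ (Tm.lam t).pretrans a, a ∈ l.verts → l = .imp (1 :: a) (0 :: a) a := by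
      intro l hl hv
      simp only [Tm.pretrans, Finset.mem_union, Finset.mem_insert, Finset.mem_singleton] at hl
      obtain (rfl | rfl) | hl := hl
      · rfl
      · simp only [mem_verts_iff, Link.concl, Link.premises] at hv
        obtain hv | hv := hv
        · exact absurd hv.symm (cons_ne_self' _ _)
        · exact absurd (mem_occs_suffix.1 _ _ _ _ hv) (not_cons_suffix _ _)
      · exact absurd (pretrans_suffix.1 _ _ l hl _ hv) (not_cons_suffix _ _)
    rw [key l hl hv, key l' hl' hv']
  | app t B =>
    have key : ∀ l ∈ (Tm.app t B).pretrans a, a ∈ l.verts → l = .nimp (1 :: a) a (0 :: a) := by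
      intro l hl hv
      simp only [Tm.pretrans, Finset.mem_union, Finset.mem_insert, Finset.mem_singleton] at hl
      obtain ((rfl | rfl) | hl) | hl := hl
      · rfl
      · simp only [mem_verts_iff, Link.concl, Link.premises] at hv
        obtain hv | hv := hv
        · exact absurd hv.symm (cons_ne_self' _ _)
        · obtain ⟨j, hj⟩ := mem_roots hv
          have := congrArg List.length hj
          simp at this
          omega
      · exact absurd (pretrans_suffix.1 _ _ l hl _ hv) (not_cons_suffix _ _)
      · exact absurd (pretrans_suffix.2 _ _ _ l hl _ hv) (not_cons_suffix _ _)
    rw [key l hl hv, key l' hl' hv']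

theorem not_special_suffix {a v : Vertex} {k : ℕ} (h : v = a ∨ 0 :: a <:+ v ∨ 1 :: a <:+ v) :
    v ≠ (k + 2) :: a := by
  rintro rfl
  obtain h | h | h := h
  · exact cons_ne_self' _ _ h
  · have := h.eq_of_length (by simp)
    simp at this
  · have := h.eq_of_length (by simp)
    simp at this

/-- The `?`-link of a free variable has a fresh conclusion, linked by nothing else. It would be a
conclusion of the net, hence the only one, but its polarity is `in` and not `out`. -/
theorem fv_eq_empty {t : Tm} {a : Vertex} {A : Ty} (h : (t.trans a).IsClosedOfType A) :
    t.fv = ∅ := by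
  obtain ⟨τ, hn, v, hv, -⟩ := h
  rw [Finset.eq_empty_iff_forall_notMem]
  intro k hk
  set c : Vertex := (k + 2) :: a with hc
  set l : Link := .wn (t.occs k a) c with hl
  have hlm : l ∈ (t.trans a).links :=
    Finset.mem_union_right _ (Finset.mem_image.2 ⟨k, hk, rfl⟩)
  have hcl : c ∈ l.verts := mem_verts_iff.2 (.inl rfl)
  have hcv : c ∈ (t.trans a).verts := Finset.mem_biUnion.2 ⟨l, hlm, hcl⟩
  have hat : (t.trans a).linksAt c = {l} := by
    ext m
    simp only [Graph.linksAt, Finset.mem_filter, Finset.mem_singleton]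
    constructor
    · rintro ⟨hm, hcm⟩
      obtain hm | hm := Finset.mem_union.1 hm
      · exact absurd rfl (not_special_suffix (eq_or_suffix_of_mem_pretrans hm hcm))
      · obtain ⟨k', -, rfl⟩ := Finset.mem_image.1 hm
        rw [mem_verts_iff] at hcm
        obtain hcm | hcm := hcm
        · simp only [Link.concl, hc, List.cons.injEq, Nat.add_right_cancel_iff, and_true] at hcm
          subst hcm; rfl
        · exact absurd rfl (not_special_suffix (eq_or_suffix_of_mem_occs hcm))
    · rintro rfl
      exact ⟨hlm, hcl⟩
  have hcc : c ∈ (t.trans a).conclusions := by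
    simp [Graph.conclusions, hcv, hat]
  rw [hv, Finset.mem_singleton] at hcc
  subst hcc
  have := hn.conclusion_out c hv l (by simp [hat])
  exact absurd rfl (not_special_suffix (eq_or_suffix_of_mem_occs this))

theorem occ_eq_zero_of_notMem_fv :
    (∀ (t : Tm) (k : ℕ), k ∉ t.fv → t.occ k = 0) ∧
    (∀ (B : Bag) (k : ℕ), k ∉ B.fv → B.occ k = 0) := by
  refine Tm.ind ?_ ?_ ?_ ?_ ?_ ?_
  · intro k _; rfl
  · intro x k h
    simp only [Tm.fv, Finset.mem_singleton] at h
    simp [Tm.occ, Ne.symm h]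
  · intro t ih k h
    refine ih _ fun hk => h ?_
    exact Finset.mem_image.2 ⟨k + 1, Finset.mem_erase.2 ⟨by omega, hk⟩, rfl⟩
  · intro t B iht ihB k h
    simp only [Tm.fv, Finset.mem_union, not_or] at h
    simp [Tm.occ, iht _ h.1, ihB _ h.2]
  · intro k _; rfl
  · intro t B iht ihB k h
    simp only [Bag.fv, Finset.mem_union, not_or] at h
    simp [Bag.occ, iht _ h.1, ihB _ h.2]

theorem length_occs :
    (∀ (t : Tm) (k : ℕ) (a : Vertex), (t.occs k a).length = t.occ k) ∧
    (∀ (B : Bag) (k i : ℕ) (a : Vertex), (B.occs k i a).length = B.occ k) := by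
  refine Tm.ind ?_ ?_ ?_ ?_ ?_ ?_
  · intro k a; rfl
  · intro x k a
    simp only [Tm.occs, Tm.occ]
    split_ifs <;> rfl
  · intro t ih k a; exact ih _ _
  · intro t B iht ihB k a
    simp [Tm.occs, Tm.occ, iht, ihB]
  · intro k i a; rfl
  · intro t B iht ihB k i a
    simp [Bag.occs, Bag.occ, iht, ihB]

/-- The type of a subterm is the type of its address. The `?`-link of a binder gives the same type
to all the occurrences that it collects, which is what the context records. -/
theorem hasTy_of_typed (τ : Vertex → Formula) :
    (∀ (t : Tm) (a : Vertex) (Γ : ℕ → Option Ty), (∀ l ∈ t.pretrans a, l.Typed τ) →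
      (∀ k, ∀ o ∈ t.occs k a, ∃ B, Γ k = some B ∧ τ o = .ty B) →
      ∃ A, τ a = .ty A ∧ t.HasTy Γ A) ∧
    (∀ (B : Bag) (i : ℕ) (a : Vertex) (Γ : ℕ → Option Ty) (A : Ty),
      (∀ l ∈ B.pretrans i a, l.Typed τ) →
      (∀ k, ∀ o ∈ B.occs k i a, ∃ B, Γ k = some B ∧ τ o = .ty B) →
      (∀ r ∈ B.roots i a, τ r = .ty A) → B.HasTy Γ A) := by
  refine Tm.ind ?_ ?_ ?_ ?_ ?_ ?_
  · intro a Γ h _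
    exact ⟨.star, h (.star a) (by simp [Tm.pretrans]), rfl⟩
  · intro x a Γ _ h
    obtain ⟨B, hB, hτ⟩ := h x a (by simp [Tm.occs])
    exact ⟨B, hτ, hB⟩
  · intro t ih a Γ h ho
    obtain ⟨A, B, h1, h2, h3⟩ := h (.imp (1 :: a) (0 :: a) a) (by simp [Tm.pretrans])
    obtain ⟨A', h4, h5⟩ := h (.wn (t.occs 0 (0 :: a)) (1 :: a)) (by simp [Tm.pretrans])
    rw [h1] at h5
    cases h5
    obtain ⟨B', h6, h7⟩ := ih (0 :: a) (extend A Γ)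
      (fun l hl => h l (by simp [Tm.pretrans, hl])) (fun k o hok => by
        cases k with
        | zero => exact ⟨A, rfl, h4 o hok⟩
        | succ k => exact ho k o hok)
    rw [h2] at h6
    cases h6
    exact ⟨_, h3, A, B, rfl, h7⟩
  · intro t B iht ihB a Γ h ho
    obtain ⟨A, C, h1, h2, h3⟩ := h (.nimp (1 :: a) a (0 :: a)) (by simp [Tm.pretrans])
    obtain ⟨A', h4, h5⟩ := h (.oc (B.roots 0 (1 :: a)) (1 :: a)) (by simp [Tm.pretrans])
    rw [h1] at h5
    cases h5
    obtain ⟨A', h6, h7⟩ := iht (0 :: a) Γ (fun l hl => h l (by simp [Tm.pretrans, hl]))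
      (fun k o hok => ho k o (by simp [Tm.occs, hok]))
    rw [h3] at h6
    cases h6
    exact ⟨C, h2, A, h7, ihB 0 (1 :: a) Γ A (fun l hl => h l (by simp [Tm.pretrans, hl]))
      (fun k o hok => ho k o (by simp [Tm.occs, hok])) h4⟩
  · intros; trivial
  · intro t B iht ihB i a Γ A h ho hr
    obtain ⟨A', h6, h7⟩ := iht (i :: a) Γ (fun l hl => h l (by simp [Bag.pretrans, hl]))
      (fun k o hok => ho k o (by simp [Bag.occs, hok]))
    rw [hr (i :: a) (by simp [Bag.roots])] at h6
    cases h6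
    exact ⟨h7, ihB (i + 1) a Γ A (fun l hl => h l (by simp [Bag.pretrans, hl]))
      (fun k o hok => ho k o (by simp [Bag.occs, hok]))
      (fun r hr' => hr r (by simp [Bag.roots, hr']))⟩

theorem roots_nodup (B : Bag) (i : ℕ) (a : Vertex) : (B.roots i a).Nodup := by
  induction B using Bag.rec (motive_1 := fun _ => True) generalizing i with
  | star => trivial
  | var => trivial
  | lam => trivial
  | app => trivial
  | nil => exact List.nodup_nil
  | cons t B _ ih =>
    refine List.nodup_cons.2 ⟨fun h => ?_, ih _⟩
    obtain ⟨j, hj⟩ := mem_roots h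
    have := (List.cons.inj hj).1
    omega

/-- The properties of the translations of closed terms on which the execution relies. -/
structure Graph.Tidy (G : Graph) : Prop where
  verts_subset : ∀ l ∈ G.links, l.verts ⊆ G.verts
  exists_link : ∀ v ∈ G.verts, ∃ l ∈ G.links, v ∈ l.verts
  concl_notMem : ∀ l ∈ G.links, l.concl ∉ l.premises
  pol_disjoint : ∀ l ∈ G.links, ∀ v ∈ l.outs, v ∉ l.ins
  edge_unique : ∀ l ∈ G.links, ∀ l' ∈ G.links, ∀ u ∈ l.premises, u ∈ l'.premises →
    l.concl = l'.concl → l = l'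
  edge_anti : ∀ l ∈ G.links, ∀ l' ∈ G.links, l'.concl ∈ l.premises → l.concl ∉ l'.premises
  at_most_two : ∀ l ∈ G.links, ∀ l' ∈ G.links, ∀ l'' ∈ G.links, ∀ v, v ∈ l.verts → v ∈ l'.verts →
    v ∈ l''.verts → l' ≠ l → l'' ≠ l → l' = l''
  pol_unique : ∀ l ∈ G.links, ∀ l' ∈ G.links, ∀ v,
    v ∈ l.outs ∧ v ∈ l'.outs ∨ v ∈ l.ins ∧ v ∈ l'.ins → l = l'
  oc_unique : ∀ us us' w, .oc us w ∈ G.links → .oc us' w ∈ G.links → us = us'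
  oc_nodup : ∀ us w, .oc us w ∈ G.links → us.Nodup

theorem Link.outs_subset {l : Link} {v : Vertex} (h : v ∈ l.outs) : v ∈ l.verts := by
  rw [mem_verts_iff]
  cases l <;> simp [Link.outs, Link.concl, Link.premises] at h ⊢ <;> tauto

theorem Link.ins_subset {l : Link} {v : Vertex} (h : v ∈ l.ins) : v ∈ l.verts := by
  rw [mem_verts_iff]
  cases l <;> simp [Link.ins, Link.concl, Link.premises] at h ⊢ <;> tauto

/-- A closed term translates to a tidy net whose root is linked once and has the type `⋆`. -/
structure ClosedNet (t : Tm) (a : Vertex) (τ : Vertex → Formula) : Prop where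
  tidy : (t.trans a).Tidy
  typed : ∀ l ∈ (t.trans a).links, l.Typed τ
  links_eq : (t.trans a).links = t.pretrans a
  occ_eq_zero : ∀ k, t.occ k = 0
  root_unique : ∀ l ∈ (t.trans a).links, ∀ l' ∈ (t.trans a).links, a ∈ l.verts → a ∈ l'.verts →
    l = l'
  root_mem : a ∈ (t.trans a).verts
  conclusions_eq : (t.trans a).conclusions = {a}
  root_type : τ a = .ty .star
  hasTy : t.HasTy (fun _ => none) .star

/-- The uniqueness of edges and of `!`-links comes from the shape of addresses, whereas the bound of
two links per vertex and the opposition of polarities come from the hypothesis of being a pre-net.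
The root is linked only once, so it is the only conclusion and it carries the type `⋆`. -/
theorem exists_closedNet {t : Tm} {a : Vertex} (h : (t.trans a).IsClosedOfType .star) :
    ∃ τ, ClosedNet t a τ := by
  have hfv := fv_eq_empty h
  have hlinks : (t.trans a).links = t.pretrans a := by
    change t.pretrans a ∪ _ = _
    simp [hfv]
  have hocc : ∀ k, t.occ k = 0 := fun k =>
    occ_eq_zero_of_notMem_fv.1 t k (by simp [hfv])
  have hocs : ∀ k, t.occs k a = [] := fun k =>
    List.length_eq_zero_iff.1 ((length_occs.1 t k a).trans (hocc k))
  obtain ⟨τ, hn, v, hv, hτv⟩ := h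
  have hedge : ∀ l ∈ (t.trans a).links, ∀ u ∈ l.premises, Edge t a l u l.concl := by
    intro l hl u hu
    rw [hlinks] at hl
    obtain ⟨s, b, hs, ho⟩ := (exists_own t a).1 t a .refl l hl
    exact ho.edge hs hu
  have hroot : ∃ l ∈ (t.trans a).links, a ∈ l.verts := by
    rw [hlinks]
    cases t with
    | star => exact ⟨.star a, by simp [Tm.pretrans], by simp [mem_verts_iff, Link.concl]⟩
    | var k => simpa [Tm.occ] using hocc k
    | lam t => exact ⟨.imp (1 :: a) (0 :: a) a, by simp [Tm.pretrans],
        by simp [mem_verts_iff, Link.concl]⟩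
    | app t B => exact ⟨.nimp (1 :: a) a (0 :: a), by simp [Tm.pretrans],
        by simp [mem_verts_iff, Link.premises]⟩
  have hru : ∀ l ∈ (t.trans a).links, ∀ l' ∈ (t.trans a).links, a ∈ l.verts → a ∈ l'.verts →
      l = l' := by
    rw [hlinks]
    exact fun l hl l' hl' h h' => root_link_unique hl hl' h h'
  obtain ⟨l₀, hl₀, ha₀⟩ := hroot
  have hav : a ∈ (t.trans a).verts := hn.link_verts l₀ hl₀ ha₀
  have hac : a ∈ (t.trans a).conclusions := by
    simp only [Graph.conclusions, Finset.mem_filter, hav, true_and, Finset.card_eq_one]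
    refine ⟨l₀, ?_⟩
    ext m
    simp only [Graph.linksAt, Finset.mem_filter, Finset.mem_singleton]
    exact ⟨fun hm => hru m hm.1 l₀ hl₀ hm.2 ha₀, by rintro rfl; exact ⟨hl₀, ha₀⟩⟩
  rw [hv, Finset.mem_singleton] at hac
  subst hac
  have hpd : ∀ l ∈ (t.trans a).links, ∀ v ∈ l.outs, v ∉ l.ins := by
    intro l hl v hv hv'
    have hdisj := hn.link_disjoint l hl
    rw [hlinks] at hl
    obtain ⟨s, b, hs, ho⟩ := (exists_own t a).1 t a .refl l hl
    cases ho <;> simp [Link.outs, Link.ins, Link.concl, Link.premises] at hv hv' hdisj <;>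
      clear hn hru hedge hocs hocc <;> grind [cons_ne_self']
  refine ⟨τ, ⟨hn.link_verts, ?_, hn.link_disjoint, hpd, ?_, ?_, ?_, ?_, ?_, ?_⟩, hn.typed,
    hlinks, hocc, hru, hav, hv, hτv, ?_⟩
  · intro v hv
    exact Finset.mem_biUnion.1 hv
  · intro l hl l' hl' u hu hu' hc
    exact (hedge l hl u hu).unique (hc ▸ hedge l' hl' u hu')
  · intro l hl l' hl' hu hu'
    exact (hedge l hl _ hu).anti (hedge l' hl' _ hu')
  · intro l hl l' hl' l'' hl'' v hv hv' hv'' hne hne'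
    by_contra hne2
    have h2 := (hn.linked v (hn.link_verts l hl hv)).2
    have : ({l, l', l''} : Finset Link) ⊆ (t.trans a).linksAt v := by
      intro m hm
      simp only [Finset.mem_insert, Finset.mem_singleton] at hm
      obtain rfl | rfl | rfl := hm <;> simp_all [Graph.linksAt]
    have := Finset.card_le_card this
    rw [Finset.card_eq_three.2 ⟨l, l', l'', hne.symm, hne'.symm, hne2, rfl⟩] at this
    omega
  · intro l hl l' hl' v h
    by_contra hne
    have hv : v ∈ l.verts ∧ v ∈ l'.verts := by
      obtain h | h := h
      · exact ⟨Link.outs_subset h.1, Link.outs_subset h.2⟩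
      · exact ⟨Link.ins_subset h.1, Link.ins_subset h.2⟩
    have := hn.polarity v (hn.link_verts l hl hv.1) l (by simp [Graph.linksAt, hl, hv.1])
      l' (by simp [Graph.linksAt, hl', hv.2]) hne
    have h1 := hpd l hl v
    have h2 := hpd l' hl' v
    tauto
  · intro us us' w h h'
    rw [hlinks] at h h'
    obtain ⟨s, b, hs, ho⟩ := (exists_own t a).1 t a .refl _ h
    obtain ⟨s', b', hs', ho'⟩ := (exists_own t a).1 t a .refl _ h'
    cases ho
    cases ho'
    cases hs.unique hs'
    rfl
  · intro us w h
    rw [hlinks] at h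
    obtain ⟨s, b, hs, ho⟩ := (exists_own t a).1 t a .refl _ h
    cases ho
    exact roots_nodup _ _ _
  · obtain ⟨A, hA, hT⟩ := (hasTy_of_typed τ).1 t a (fun _ => none)
      (by rw [← hlinks]; exact hn.typed) (by simp [hocs])
    rw [hτv] at hA
    cases hA
    exact hT


/-! ### The dynamic algebra -/

/-- The symbols of the dynamic algebra. -/
inductive Sym : Type
  | p : Sym
  | q : Sym
  | e (n : ℕ) : Sym
  | star : Sym
  deriving DecidableEq

/-- The weight denoted by a symbol. -/
def Sym.toRL : Sym → RL
  | .p => .mk .p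
  | .q => .mk .q
  | .e n => .mk (.e n)
  | .star => .mk .star

theorem RL.mk_eq {a b : Word} (h : Word.Rel a b) : RL.mk a = RL.mk b := Quot.sound h

instance : MonoidWithZero RL where
  mul_assoc := by
    rintro ⟨a⟩ ⟨b⟩ ⟨c⟩
    exact (RL.mk_eq (.assoc a b c)).symm
  one_mul := by
    rintro ⟨a⟩
    exact RL.mk_eq (.one_mul a)
  mul_one := by
    rintro ⟨a⟩
    exact RL.mk_eq (.mul_one a)
  zero_mul := by
    rintro ⟨a⟩
    exact RL.mk_eq (.zero_mul a)
  mul_zero := by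
    rintro ⟨a⟩
    exact RL.mk_eq (.mul_zero a)

theorem Sym.mul_inv (c : Sym) : c.toRL * c.toRL.inv = 1 := by
  cases c
  · exact RL.mk_eq .neutr_p
  · exact RL.mk_eq .neutr_q
  · exact RL.mk_eq (.neutr_e _)
  · exact RL.mk_eq .neutr_star

/-- The partial injection that pushes a symbol on a stack. -/
def pushEquiv (c : Sym) : List Sym ≃. List Sym where
  toFun s := some (c :: s)
  invFun
    | [] => none
    | c' :: s => if c' = c then some s else none
  inv := by
    intro a b
    cases b <;> simp <;> grind

/-- The interpretation of words as partial injections on stacks. -/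
def Word.eval : Word → (List Sym ≃. List Sym)
  | .zero => ⊥
  | .one => PEquiv.refl _
  | .p => pushEquiv .p
  | .q => pushEquiv .q
  | .e n => pushEquiv (.e n)
  | .star => pushEquiv .star
  | .inv a => a.eval.symm
  | .mul a b => a.eval.trans b.eval

theorem pushEquiv_trans_symm (c : Sym) :
    (pushEquiv c).trans (pushEquiv c).symm = PEquiv.refl _ := by
  refine PEquiv.ext fun s => ?_
  change (((pushEquiv c) s).bind (pushEquiv c).symm) = some s
  change ((some (c :: s)).bind _) = some s
  simp [pushEquiv, PEquiv.symm, DFunLike.coe]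

theorem pushEquiv_trans_symm_of_ne {c c' : Sym} (h : c ≠ c') :
    (pushEquiv c).trans (pushEquiv c').symm = ⊥ := by
  refine PEquiv.ext fun s => ?_
  change (((pushEquiv c) s).bind (pushEquiv c').symm) = none
  change ((some (c :: s)).bind _) = none
  simp [pushEquiv, PEquiv.symm, DFunLike.coe, h]

/-- Soundness of the model. Composition is read from left to right: `a a*` pushes a symbol and pops
it again, while `a b*` with distinct symbols tries to pop a symbol that is not on top and is nowhere
defined. -/
theorem Word.eval_eq {a b : Word} (h : Word.Rel a b) : a.eval = b.eval := by
  induction h with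
  | assoc a b c => exact (PEquiv.trans_assoc _ _ _).symm
  | mul_one a => exact PEquiv.trans_refl _
  | one_mul a => exact PEquiv.refl_trans _
  | mul_zero a => exact PEquiv.trans_bot _
  | zero_mul a => exact PEquiv.bot_trans _
  | inv_inv a => exact PEquiv.symm_symm _
  | inv_mul a b => exact PEquiv.symm_trans_rev _ _
  | neutr_p => exact pushEquiv_trans_symm _
  | neutr_q => exact pushEquiv_trans_symm _
  | neutr_e n => exact pushEquiv_trans_symm _
  | neutr_star => exact pushEquiv_trans_symm _
  | annihil_qp => exact pushEquiv_trans_symm_of_ne (by simp)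
  | annihil_pq => exact pushEquiv_trans_symm_of_ne (by simp)
  | annihil_e i j h => exact pushEquiv_trans_symm_of_ne (by simpa using h)
  | congr_inv _ ih => simp [Word.eval, ih]
  | congr_left c _ ih => simp [Word.eval, ih]
  | congr_right c _ ih => simp [Word.eval, ih]

/-- In the model by partial injections the symbol `⋆` acts as a total map and `0` as the empty one.
-/
theorem star_ne_zero : Sym.star.toRL ≠ 0 := by
  intro h
  have : Word.star.eval = Word.zero.eval :=
    congrArg (Quot.lift Word.eval fun _ _ h => Word.eval_eq h) h
  have := congrArg (fun f => f []) this
  simp [Word.eval, pushEquiv] at this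

/-- The weight denoted by a stack. -/
def val : List Sym → RL
  | [] => 1
  | c :: s => val s * c.toRL

/-! ### The stack machine -/

/-- The symbol of the crossing of a link from the premise `x`, when the premises of the `!`-links
are numbered by `S`. -/
def Link.sym (S : Vertex → ℕ) : Link → Vertex → Sym
  | .star _, _ => .star
  | .imp u _ _, x => if x = u then .p else .q
  | .nimp u _ _, x => if x = u then .p else .q
  | .oc _ _, x => .e (S x)
  | .wn us _, x => .e (us.idxOf x)

theorem Link.sym_clash (S : Vertex → ℕ) {l : Link} {u v : Vertex} (hu : u ∈ l.premises)
    (h : l.sym S u ≠ l.sym S v) : (l.sym S u).toRL * (l.sym S v).toRL.inv = 0 := by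
  cases l with
  | star => simp [Link.premises] at hu
  | imp x y w =>
    simp only [Link.sym] at h ⊢
    split_ifs at h ⊢
    · exact absurd rfl h
    · exact RL.mk_eq .annihil_pq
    · exact RL.mk_eq .annihil_qp
    · exact absurd rfl h
  | nimp x y w =>
    simp only [Link.sym] at h ⊢
    split_ifs at h ⊢
    · exact absurd rfl h
    · exact RL.mk_eq .annihil_pq
    · exact RL.mk_eq .annihil_qp
    · exact absurd rfl h
  | oc us w =>
    simp only [Link.sym, ne_eq, Sym.e.injEq] at h
    exact RL.mk_eq (.annihil_e _ _ h)
  | wn us w =>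
    simp only [Link.sym, ne_eq, Sym.e.injEq] at h
    exact RL.mk_eq (.annihil_e _ _ h)

/-- The premises of the `!`-links are numbered by `S` with the natural numbers less than their
number. -/
def IsNumbering (G : Graph) (S : Vertex → ℕ) : Prop :=
  ∀ us w, .oc us w ∈ G.links → (us.map S).Perm (List.range us.length)

theorem IsNumbering.inj {G : Graph} {S : Vertex → ℕ} (h : IsNumbering G S) {us : List Vertex}
    {w u v : Vertex} (hl : .oc us w ∈ G.links) (hu : u ∈ us) (hv : v ∈ us) (huv : S u = S v) :
    u = v := by
  have := (h us w hl).nodup_iff.2 List.nodup_range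
  exact List.inj_on_of_nodup_map this hu hv huv

/-- The source of determinism: when a link is crossed downwards, the symbol on top of the stack
leaves a single choice of premise. -/
theorem Link.sym_inj {G : Graph} {S : Vertex → ℕ} (hS : IsNumbering G S) {l : Link}
    (hl : l ∈ G.links) {u v : Vertex} (hu : u ∈ l.premises) (hv : v ∈ l.premises)
    (h : l.sym S u = l.sym S v) : u = v := by
  cases l with
  | star => simp [Link.premises] at hu
  | imp x y w =>
    simp only [Link.premises, List.mem_cons, List.not_mem_nil, or_false] at hu hv
    simp only [Link.sym] at h
    grind
  | nimp x y w =>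
    simp only [Link.premises, List.mem_cons, List.not_mem_nil, or_false] at hu hv
    simp only [Link.sym] at h
    grind
  | oc us w => exact hS.inj hl hu hv (Sym.e.inj h)
  | wn us w => exact (List.idxOf_inj hu).1 (Sym.e.inj h)

/-- The polarity of a vertex at a link. -/
def Link.Pol (l : Link) (v : Vertex) : Bool → Prop
  | true => v ∈ l.outs
  | false => v ∈ l.ins

/-- The crossings of a link, from a premise to the conclusion (`up`) or vice versa (`dn`). -/
inductive Cr : Type
  | up (l : Link) (u : Vertex) : Cr
  | dn (l : Link) (u : Vertex) : Cr

namespace Cr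

/-- The crossed link. -/
def link : Cr → Link
  | up l _ => l
  | dn l _ => l

/-- The crossed premise. -/
def prem : Cr → Vertex
  | up _ u => u
  | dn _ u => u

/-- The target of a crossing. -/
def tgt : Cr → Vertex
  | up l _ => l.concl
  | dn _ u => u

/-- The reversed crossing. -/
def rev : Cr → Cr
  | up l u => dn l u
  | dn l u => up l u

end Cr

/-- The reversal of a sequence of crossings. -/
def revE (es : List Cr) : List Cr := (es.map Cr.rev).reverse

/-- Runs of the stack machine: `Seg G S u s d es v s' d'` says that the crossings `es` lead from
the vertex `u` to the vertex `v` and transform the stack `s` into `s'`, pushing the symbols of the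
crossings from a premise to the conclusion and popping those of the others. The next link to be
crossed has the polarity `d` at `u` and `d'` at `v`. -/
inductive Seg (G : Graph) (S : Vertex → ℕ) :
    Vertex → List Sym → Bool → List Cr → Vertex → List Sym → Bool → Prop
  | nil (u : Vertex) (s : List Sym) (d : Bool) : Seg G S u s d [] u s d
  | up {l : Link} {u v : Vertex} {s s' : List Sym} {d d₁ d' : Bool} {es : List Cr} :
      l ∈ G.links → u ∈ l.premises → l.Pol u d → l.Pol l.concl (!d₁) →
      Seg G S l.concl (l.sym S u :: s) d₁ es v s' d' → Seg G S u s d (.up l u :: es) v s' d'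
  | dn {l : Link} {u v : Vertex} {s s' : List Sym} {d d₁ d' : Bool} {es : List Cr} :
      l ∈ G.links → u ∈ l.premises → l.Pol l.concl d → l.Pol u (!d₁) →
      Seg G S u s d₁ es v s' d' →
      Seg G S l.concl (l.sym S u :: s) d (.dn l u :: es) v s' d'

namespace Seg

variable {G : Graph} {S : Vertex → ℕ}

theorem append {u v w : Vertex} {s s' s'' : List Sym} {d d' d'' : Bool} {es es' : List Cr}
    (h : Seg G S u s d es v s' d') (h' : Seg G S v s' d' es' w s'' d'') :
    Seg G S u s d (es ++ es') w s'' d'' := by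
  induction h with
  | nil => exact h'
  | up h1 h2 h3 h4 _ ih => exact .up h1 h2 h3 h4 (ih h')
  | dn h1 h2 h3 h4 _ ih => exact .dn h1 h2 h3 h4 (ih h')

theorem frame {u v : Vertex} {s s' : List Sym} {d d' : Bool} {es : List Cr}
    (h : Seg G S u s d es v s' d') (t : List Sym) : Seg G S u (s ++ t) d es v (s' ++ t) d' := by
  induction h with
  | nil => exact .nil _ _ _
  | up h1 h2 h3 h4 _ ih => exact .up h1 h2 h3 h4 ih
  | dn h1 h2 h3 h4 _ ih => exact .dn h1 h2 h3 h4 ih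

theorem single_up {l : Link} {u : Vertex} (s : List Sym) {d d' : Bool} (hl : l ∈ G.links)
    (hu : u ∈ l.premises) (h : l.Pol u d) (h' : l.Pol l.concl (!d')) :
    Seg G S u s d [.up l u] l.concl (l.sym S u :: s) d' :=
  .up hl hu h h' (.nil _ _ _)

theorem single_dn {l : Link} {u : Vertex} (s : List Sym) {d d' : Bool} (hl : l ∈ G.links)
    (hu : u ∈ l.premises) (h : l.Pol l.concl d) (h' : l.Pol u (!d')) :
    Seg G S l.concl (l.sym S u :: s) d [.dn l u] u s d' :=
  .dn hl hu h h' (.nil _ _ _)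

/-- Reversal exchanges pushing and popping as well as the polarities of the next link to be crossed.
-/
theorem reverse {u v : Vertex} {s s' : List Sym} {d d' : Bool} {es : List Cr}
    (h : Seg G S u s d es v s' d') : Seg G S v s' (!d') (revE es) u s (!d) := by
  induction h with
  | nil => exact .nil _ _ _
  | up h1 h2 h3 h4 _ ih =>
    simp only [revE, List.map_cons, List.reverse_cons]
    exact ih.append (.single_dn _ h1 h2 h4 (by simpa using h3))
  | dn h1 h2 h3 h4 _ ih =>
    simp only [revE, List.map_cons, List.reverse_cons]
    exact ih.append (.single_up _ h1 h2 h4 (by simpa using h3))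

theorem of_append {u w : Vertex} {s s'' : List Sym} {d d'' : Bool} {es es' : List Cr}
    (h : Seg G S u s d (es ++ es') w s'' d'') :
    ∃ v s' d', Seg G S u s d es v s' d' ∧ Seg G S v s' d' es' w s'' d'' := by
  induction es generalizing u s d with
  | nil => exact ⟨_, _, _, .nil _ _ _, h⟩
  | cons c es ih =>
    cases h with
    | up h1 h2 h3 h4 h =>
      obtain ⟨v, s', d', h5, h6⟩ := ih h
      exact ⟨v, s', d', .up h1 h2 h3 h4 h5, h6⟩
    | dn h1 h2 h3 h4 h =>
      obtain ⟨v, s', d', h5, h6⟩ := ih h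
      exact ⟨v, s', d', .dn h1 h2 h3 h4 h5, h6⟩

theorem nil_inv {u v : Vertex} {s s' : List Sym} {d d' : Bool} (h : Seg G S u s d [] v s' d') :
    u = v ∧ s = s' ∧ d = d' := by
  cases h
  exact ⟨rfl, rfl, rfl⟩

theorem links_mem {u v : Vertex} {s s' : List Sym} {d d' : Bool} {es : List Cr}
    (h : Seg G S u s d es v s' d') : ∀ c ∈ es, c.link ∈ G.links ∧ c.prem ∈ c.link.premises := by
  induction h with
  | nil => simp
  | up h1 h2 _ _ _ ih => simpa [Cr.link, Cr.prem, h1, h2] using ih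
  | dn h1 h2 _ _ _ ih => simpa [Cr.link, Cr.prem, h1, h2] using ih

/-- The vertices visited by a run determine it. -/
theorem es_unique (hG : G.Tidy) {S' : Vertex → ℕ} {u v v' : Vertex} {s s' t t' : List Sym}
    {d d' e e' : Bool} {es es' : List Cr}
    (h : Seg G S u s d es v s' d') (h' : Seg G S' u t e es' v' t' e')
    (heq : es.map Cr.tgt = es'.map Cr.tgt) : es = es' := by
  induction h generalizing t e es' with
  | nil => simpa using heq.symm
  | @up l u v s s' d d₁ d' es h1 h2 _ _ _ ih =>
    cases h' with
    | nil => simp at heq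
    | @up l' _ _ _ _ _ _ _ es' h1' h2' _ _ h' =>
      simp only [List.map_cons, Cr.tgt, List.cons.injEq] at heq
      obtain rfl := hG.edge_unique l h1 l' h1' u h2 h2' heq.1
      rw [ih h' heq.2]
    | @dn l' u' _ _ _ _ _ _ es' h1' h2' _ _ h' =>
      simp only [List.map_cons, Cr.tgt, List.cons.injEq] at heq
      exact absurd (heq.1 ▸ h2') (hG.edge_anti l h1 l' h1' h2)
  | @dn l u v s s' d d₁ d' es h1 h2 _ _ _ ih =>
    generalize hc : l.concl = w at h'
    cases h' with
    | nil => simp at heq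
    | @up l' _ _ _ _ _ _ _ es' h1' h2' _ _ h' =>
      simp only [List.map_cons, Cr.tgt, List.cons.injEq] at heq
      exact absurd (heq.1 ▸ h2) (hG.edge_anti l' h1' l h1 (hc ▸ h2'))
    | @dn l' u' _ _ _ _ _ _ es' h1' h2' _ _ h' =>
      simp only [List.map_cons, Cr.tgt, List.cons.injEq] at heq
      obtain ⟨rfl, heq⟩ := heq
      obtain rfl := hG.edge_unique l h1 l' h1' u h2 h2' hc
      rw [ih h' heq]

end Seg

/-! ### Crossed tokens -/

/-- Tokens: the premises of the `?`- and of the `!`-links, and the addresses of bags. -/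
inductive Tok : Type
  | occ (o : Vertex) : Tok
  | rt (r : Vertex) : Tok
  | node (a : Vertex) : Tok

/-- The tokens crossed by a crossing. -/
def Cr.toks : Cr → List Tok
  | up (.oc _ _) u => [.rt u]
  | dn (.oc _ _) u => [.rt u]
  | up (.wn _ _) u => [.occ u]
  | dn (.wn _ _) u => [.occ u]
  | _ => []

/-- The tokens crossed by a sequence of crossings. -/
def crossed (es : List Cr) : List Tok := es.flatMap Cr.toks

@[simp] theorem crossed_nil : crossed [] = [] := rfl

@[simp] theorem crossed_append (es es' : List Cr) :
    crossed (es ++ es') = crossed es ++ crossed es' := by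
  simp [crossed]

@[simp] theorem crossed_cons (c : Cr) (es : List Cr) :
    crossed (c :: es) = c.toks ++ crossed es := rfl

theorem Cr.toks_rev (c : Cr) : c.rev.toks = c.toks := by
  rcases c with ⟨l, u⟩ | ⟨l, u⟩ <;> cases l <;> rfl

theorem mem_crossed_revE {es : List Cr} {x : Tok} : x ∈ crossed (revE es) ↔ x ∈ crossed es := by
  simp only [crossed, revE, List.mem_flatMap, List.mem_reverse, List.mem_map]
  constructor
  · rintro ⟨_, ⟨c, hc, rfl⟩, hx⟩
    exact ⟨c, hc, by rwa [Cr.toks_rev] at hx⟩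
  · rintro ⟨c, hc, hx⟩
    exact ⟨_, ⟨c, hc, rfl⟩, by rwa [Cr.toks_rev]⟩

theorem mem_crossed_iff {es : List Cr} {x : Tok} : x ∈ crossed es ↔ ∃ c ∈ es, x ∈ c.toks :=
  List.mem_flatMap

/-- Every `!`-link is crossed from a premise to the conclusion only after it has been crossed from
the conclusion to that premise. -/
def DownFirst (es : List Cr) : Prop :=
  ∀ es₁ us w u es₂, es = es₁ ++ .up (.oc us w) u :: es₂ → .rt u ∈ crossed es₁

theorem DownFirst.nil : DownFirst [] := by
  intro es₁ us w u es₂ h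
  simp at h

theorem DownFirst.append {es es' : List Cr} (h : DownFirst es)
    (h' : ∀ us w u, .up (.oc us w) u ∈ es' → .rt u ∈ crossed es) : DownFirst (es ++ es') := by
  intro es₁ us w u es₂ heq
  obtain ⟨as, h1, h2⟩ | ⟨bs, h1, h2⟩ := List.append_eq_append_iff.1 heq
  · subst h1
    simp [h' us w u (by simp [h2])]
  · cases bs with
    | nil =>
      simp only [List.nil_append] at h2
      simp only [List.append_nil] at h1
      subst h1
      exact h' us w u (by simp [← h2])
    | cons b bs =>
      simp only [List.cons_append, List.cons.injEq] at h2
      obtain ⟨rfl, -⟩ := h2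
      exact h es₁ us w u bs h1

theorem DownFirst.prefix {es es' : List Cr} (h : DownFirst (es ++ es')) : DownFirst es := by
  intro es₁ us w u es₂ heq
  exact h es₁ us w u (es₂ ++ es') (by simp [heq])

/-- A run that crosses the `!`-links downwards first determines the numbers of the premises that
it crosses. -/
theorem Seg.numbering_unique {G : Graph} {S S' : Vertex → ℕ} {u v v' : Vertex}
    {s s' t' : List Sym} {d d' e e' : Bool} {es : List Cr}
    (h : Seg G S u s d es v s' d') (h' : Seg G S' u s e es v' t' e') (hes : DownFirst es) :
    s' = t' ∧ ∀ x, .rt x ∈ crossed es → S x = S' x := by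
  induction es using List.reverseRecOn generalizing v v' s' t' d' e' with
  | nil =>
    cases h
    cases h'
    simp
  | append_singleton es c ih =>
    obtain ⟨w, s₁, d₁, h1, h2⟩ := h.of_append
    obtain ⟨w', s₁', d₁', h1', h2'⟩ := h'.of_append
    obtain ⟨rfl, hS⟩ := ih h1 h1' hes.prefix
    have hup : ∀ l u, c = .up l u → l.sym S u = l.sym S' u := by
      rintro l u rfl
      cases l with
      -- An upward crossing of a `!`-link pushes a number that is already known, since that premise
      -- was crossed downwards before.
      | oc us w => simp only [Link.sym, hS u (hes es us w u [] rfl)]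
      | _ => rfl
    cases h2 with
    | @up l u _ _ _ _ _ _ _ _ _ _ _ h2 =>
      obtain ⟨-, h2, -⟩ := h2.nil_inv
      cases h2' with
      | up _ _ _ _ h2' =>
        obtain ⟨-, h2', -⟩ := h2'.nil_inv
        refine ⟨by rw [← h2, ← h2', hup l _ rfl], ?_⟩
        intro x hx
        rw [crossed_append, List.mem_append] at hx
        obtain hx | hx := hx
        · exact hS x hx
        · cases l <;> simp [Cr.toks] at hx
          subst hx
          exact hS _ (hes es _ _ _ [] rfl)
    | @dn l u _ s₀ _ _ _ _ _ _ _ _ _ h2 =>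
      obtain ⟨-, h2, -⟩ := h2.nil_inv
      generalize hs : l.sym S u :: s₀ = s₂ at h2'
      generalize l.concl = w₂ at h2'
      cases h2' with
      | dn _ _ _ _ h2' =>
        obtain ⟨-, h2', -⟩ := h2'.nil_inv
        -- Both runs pop from the same stack, so the symbols of the crossed premise agree; for a
        -- `!`-link this is equality of the two numbers.
        obtain ⟨h3, h4⟩ := List.cons.inj hs
        refine ⟨by rw [← h2, ← h2', h4], ?_⟩
        intro x hx
        rw [crossed_append, List.mem_append] at hx
        obtain hx | hx := hx
        · exact hS x hx
        · cases l <;> simp [Cr.toks] at hx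
          subst hx
          exact Sym.e.inj h3


/-! ### Weights of runs -/

/-- The numbering of the premises of the `!`-links given by a resource permutation. -/
noncomputable def numbering (G : Graph) (σ : G.ResPerm) (u : Vertex) : ℕ :=
  open Classical in
  if h : ∃ r : {l : Link // l ∈ G.ocLinks}, u ∈ r.1.premises then
    σ h.choose ⟨h.choose.1.premises.idxOf u, List.idxOf_lt_length_of_mem h.choose_spec⟩
  else 0

theorem mem_ocLinks {G : Graph} {l : Link} :
    l ∈ G.ocLinks ↔ ∃ us w, l = .oc us w ∧ .oc us w ∈ G.links := by
  simp only [Graph.ocLinks, Finset.mem_filter]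
  constructor
  · rintro ⟨h, h'⟩
    cases l <;> simp [Link.isOc] at h'
    exact ⟨_, _, rfl, h⟩
  · rintro ⟨us, w, rfl, h⟩
    exact ⟨h, rfl⟩

/-- The choice in `numbering` is harmless: two `!`-links would both give the polarity `in` to a
shared premise, hence they coincide. -/
theorem numbering_eq {G : Graph} (hG : G.Tidy) (σ : G.ResPerm) {u : Vertex}
    (r : {l : Link // l ∈ G.ocLinks}) (hu : u ∈ r.1.premises) :
    numbering G σ u = σ r ⟨r.1.premises.idxOf u, List.idxOf_lt_length_of_mem hu⟩ := by
  have h : ∃ r : {l : Link // l ∈ G.ocLinks}, u ∈ r.1.premises := ⟨r, hu⟩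
  have hr : h.choose = r := by
    have h1 := h.choose_spec
    generalize h.choose = r' at h1
    obtain ⟨l, hl⟩ := r
    obtain ⟨l', hl'⟩ := r'
    obtain ⟨us, w, rfl, hl1⟩ := mem_ocLinks.1 hl
    obtain ⟨us', w', rfl, hl1'⟩ := mem_ocLinks.1 hl'
    exact Subtype.ext (hG.pol_unique _ hl1' _ hl1 u (.inr ⟨h1, hu⟩))
  unfold numbering
  rw [dif_pos h]
  have : ∀ (r' : {l : Link // l ∈ G.ocLinks}) (hr' : r' = r) (h' : u ∈ r'.1.premises),
      (σ r' ⟨r'.1.premises.idxOf u, List.idxOf_lt_length_of_mem h'⟩ : ℕ) =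
        σ r ⟨r.1.premises.idxOf u, List.idxOf_lt_length_of_mem hu⟩ := by
    rintro r' rfl h'
    rfl
  exact this _ hr h.choose_spec

theorem numbering_getElem {G : Graph} (hG : G.Tidy) (σ : G.ResPerm)
    (r : {l : Link // l ∈ G.ocLinks}) (i : Fin r.1.premises.length) :
    numbering G σ (r.1.premises[i.1]'i.2) = σ r i := by
  rw [numbering_eq hG σ r (List.getElem_mem _)]
  congr 2
  obtain ⟨us, w, h, hl⟩ := mem_ocLinks.1 r.2
  have : r.1.premises.Nodup := by
    rw [h]
    exact hG.oc_nodup us w hl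
  exact Fin.ext (this.idxOf_getElem _ _)

theorem isNumbering_numbering {G : Graph} (hG : G.Tidy) (σ : G.ResPerm) :
    IsNumbering G (numbering G σ) := by
  intro us w hl
  let r : {l : Link // l ∈ G.ocLinks} := ⟨.oc us w, mem_ocLinks.2 ⟨us, w, rfl, hl⟩⟩
  obtain ⟨τ, hτ⟩ : ∃ τ : Equiv.Perm (Fin us.length),
      ∀ i : Fin us.length, numbering G σ (us[i.1]'i.2) = τ i :=
    ⟨σ r, fun i => numbering_getElem hG σ r i⟩
  have h1 : us.map (numbering G σ) = ((List.finRange us.length).map τ).map Fin.val := by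
    refine List.ext_getElem (by simp) fun i h h' => ?_
    rw [List.length_map] at h
    simpa using hτ ⟨i, h⟩
  rw [h1, ← List.map_coe_finRange_eq_range]
  exact (Equiv.Perm.map_finRange_perm τ).map _

/-- The alternatives in the definition of the weight exclude one another on a tidy net, because the
two ends of the crossing determine the link, and with it the premises chosen by the existential
clauses. -/
theorem upWeight_up {G : Graph} (hG : G.Tidy) (σ : G.ResPerm) {l : Link} {u : Vertex}
    (hl : l ∈ G.links) (hu : u ∈ l.premises) :
    G.upWeight σ u l.concl = some (l.sym (numbering G σ) u).toRL := by
  have hne : u ≠ l.concl := fun h => hG.concl_notMem l hl (h ▸ hu)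
  have huniq : ∀ m ∈ G.links, u ∈ m.premises → m.concl = l.concl → m = l :=
    fun m hm hum hc => hG.edge_unique m hm l hl u hum hu hc
  unfold Graph.upWeight
  rw [if_neg (fun h => hne h.2)]
  cases l with
  | star => simp [Link.premises] at hu
  | imp x y w =>
    have hc : (Link.imp x y w).concl = w := rfl
    rw [hc]
    by_cases hx : u = x
    · subst hx
      have h : ∃ y, Link.imp u y w ∈ G.links ∨ Link.nimp u y w ∈ G.links := ⟨y, .inl hl⟩
      rw [if_pos h]
      simp [Link.sym, Sym.toRL]
    · rw [if_neg, if_pos]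
      · simp [Link.sym, Sym.toRL, hx]
      · refine ⟨x, .inl ?_⟩
        simp only [Link.premises, List.mem_cons, hx, false_or, List.not_mem_nil, or_false] at hu
        rwa [hu]
      · rintro ⟨z, h | h⟩
        · have := huniq _ h (by simp [Link.premises]) rfl
          exact hx (Link.imp.inj this).1
        · have := huniq _ h (by simp [Link.premises]) rfl
          cases this
  | nimp x y w =>
    have hc : (Link.nimp x y w).concl = w := rfl
    rw [hc]
    by_cases hx : u = x
    · subst hx
      have h : ∃ y, Link.imp u y w ∈ G.links ∨ Link.nimp u y w ∈ G.links := ⟨y, .inr hl⟩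
      rw [if_pos h]
      simp [Link.sym, Sym.toRL]
    · rw [if_neg, if_pos]
      · simp [Link.sym, Sym.toRL, hx]
      · refine ⟨x, .inr ?_⟩
        simp only [Link.premises, List.mem_cons, hx, false_or, List.not_mem_nil, or_false] at hu
        rwa [hu]
      · rintro ⟨z, h | h⟩
        · have := huniq _ h (by simp [Link.premises]) rfl
          cases this
        · have := huniq _ h (by simp [Link.premises]) rfl
          exact hx (Link.nimp.inj this).1
  | wn us w =>
    have hc : (Link.wn us w).concl = w := rfl
    rw [hc]
    have h : ∃ us, Link.wn us w ∈ G.links ∧ u ∈ us := ⟨us, hl, hu⟩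
    rw [if_neg, if_neg, dif_pos h]
    · have h1 := h.choose_spec
      have h2 := huniq _ h1.1 h1.2 rfl
      rw [(Link.wn.inj h2).1]
      rfl
    · rintro ⟨z, h | h⟩ <;> cases huniq _ h (by simp [Link.premises]) rfl
    · rintro ⟨z, h | h⟩ <;> cases huniq _ h (by simp [Link.premises]) rfl
  | oc us w =>
    have hc : (Link.oc us w).concl = w := rfl
    rw [hc]
    have h : ∃ r : {l : Link // l ∈ G.ocLinks}, r.1.concl = w ∧ u ∈ r.1.premises :=
      ⟨⟨.oc us w, mem_ocLinks.2 ⟨us, w, rfl, hl⟩⟩, rfl, hu⟩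
    rw [if_neg, if_neg, dif_neg, dif_pos h]
    · rw [← numbering_eq hG σ h.choose h.choose_spec.2]
      rfl
    · rintro ⟨z, h, h'⟩
      cases huniq _ h h' rfl
    · rintro ⟨z, h | h⟩ <;> cases huniq _ h (by simp [Link.premises]) rfl
    · rintro ⟨z, h | h⟩ <;> cases huniq _ h (by simp [Link.premises]) rfl

/-- No link can be crossed upwards between the ends of a downward crossing, so the base weight falls
through to the inverse of the weight of the opposite crossing. -/
theorem upWeight_dn {G : Graph} (hG : G.Tidy) (σ : G.ResPerm) {l : Link} {u : Vertex}
    (hl : l ∈ G.links) (hu : u ∈ l.premises) : G.upWeight σ l.concl u = none := by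
  have hne : l.concl ≠ u := fun h => hG.concl_notMem l hl (h ▸ hu)
  have hanti : ∀ m ∈ G.links, m.concl = u → l.concl ∉ m.premises :=
    fun m hm hc => hG.edge_anti l hl m hm (hc ▸ hu)
  unfold Graph.upWeight
  rw [if_neg (fun h => hne h.2), if_neg, if_neg, dif_neg, dif_neg]
  · rintro ⟨r, h, h'⟩
    obtain ⟨us, w, h1, h2⟩ := mem_ocLinks.1 r.2
    exact hanti r.1 (h1 ▸ h2) h h'
  · rintro ⟨us, h, h'⟩
    exact hanti _ h rfl h'
  · rintro ⟨z, h | h⟩ <;> exact hanti _ h rfl (by simp [Link.premises])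
  · rintro ⟨z, h | h⟩ <;> exact hanti _ h rfl (by simp [Link.premises])

theorem baseWeight_up {G : Graph} (hG : G.Tidy) (σ : G.ResPerm) {l : Link} {u : Vertex}
    (hl : l ∈ G.links) (hu : u ∈ l.premises) :
    G.baseWeight σ u l.concl = (l.sym (numbering G σ) u).toRL := by
  simp [Graph.baseWeight, upWeight_up hG σ hl hu]

theorem baseWeight_dn {G : Graph} (hG : G.Tidy) (σ : G.ResPerm) {l : Link} {u : Vertex}
    (hl : l ∈ G.links) (hu : u ∈ l.premises) :
    G.baseWeight σ l.concl u = (l.sym (numbering G σ) u).toRL.inv := by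
  simp [Graph.baseWeight, upWeight_up hG σ hl hu, upWeight_dn hG σ hl hu]

theorem baseWeight_star {G : Graph} (σ : G.ResPerm) {z : Vertex} (hz : .star z ∈ G.links) :
    G.baseWeight σ z z = Sym.star.toRL := by
  simp [Graph.baseWeight, Graph.upWeight, hz, Sym.toRL]

theorem permWeight_cons {G : Graph} (σ : G.ResPerm) (u v : Vertex) (π : List Vertex) :
    G.permWeight σ (u :: v :: π) = G.baseWeight σ u v * G.permWeight σ (v :: π) := rfl

/-- The value of the stack times the weight of the path still to be travelled is constant along a
run: a push moves a symbol to the stack, and a pop cancels one through `a a* = 1`. -/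
theorem Seg.val_mul {G : Graph} (hG : G.Tidy) {σ : G.ResPerm} {u v : Vertex}
    {s s' : List Sym} {d d' : Bool} {es : List Cr} (h : Seg G (numbering G σ) u s d es v s' d')
    (π : List Vertex) :
    val s * G.permWeight σ (u :: (es.map Cr.tgt ++ π)) = val s' * G.permWeight σ (v :: π) := by
  induction h with
  | nil => rfl
  | up h1 h2 _ _ _ ih =>
    rw [← ih, List.map_cons, List.cons_append, Cr.tgt, permWeight_cons, baseWeight_up hG σ h1 h2,
      val, mul_assoc]
  | dn h1 h2 _ _ _ ih =>
    rw [← ih, List.map_cons, List.cons_append, Cr.tgt, permWeight_cons, baseWeight_dn hG σ h1 h2,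
      val, mul_assoc, ← mul_assoc _ _ (G.permWeight σ _), Sym.mul_inv, one_mul]


/-! ### Straight maximal paths -/

/-- `u :: π` is a straight path that cannot be prolonged after its end, where the link crossed
just before `u` is `m` (if any). -/
inductive Tail (G : Graph) : Option Link → Vertex → List Vertex → Prop
  | nil {m : Option Link} {u : Vertex} : (∀ l ∈ G.links, u ∈ l.verts → some l = m) → Tail G m u []
  | cons {m : Option Link} {l : Link} {u v : Vertex} {π : List Vertex} : l ∈ G.links →
      some l ≠ m → u ∈ l.verts → v ∈ l.verts →
      (¬ l.IsStar → ¬ (u = l.concl ∧ v = l.concl) ∧ ¬ (u ∈ l.premises ∧ v ∈ l.premises)) →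
      Tail G (some l) v π → Tail G m u (v :: π)

theorem nonTwisting_cons {u v : Vertex} {π : List Vertex} {l : Link} {ls : List Link} :
    Graph.NonTwisting (u :: v :: π) (l :: ls) ↔
      (¬ l.IsStar → ¬ (u = l.concl ∧ v = l.concl) ∧ ¬ (u ∈ l.premises ∧ v ∈ l.premises)) ∧
        Graph.NonTwisting (v :: π) ls := by
  constructor
  · intro h
    exact ⟨fun hl => h 0 u v l rfl rfl rfl hl, fun i x y m h1 h2 h3 =>
      h (i + 1) x y m (by simpa using h1) (by simpa using h2) (by simpa using h3)⟩
  · rintro ⟨h1, h2⟩ i x y m hx hy hm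
    cases i with
    | zero =>
      simp only [List.getElem?_cons_zero, Option.some.injEq, zero_add,
        List.getElem?_cons_succ] at hx hy hm
      subst hx hy hm
      exact h1
    | succ i =>
      exact h2 i x y m (by simpa using hx) (by simpa using hy) (by simpa using hm)

theorem Tail.crosses {G : Graph} {m : Option Link} {u : Vertex} {π : List Vertex}
    (h : Tail G m u π) (hu : u ∈ G.verts) (hG : G.Tidy) :
    ∃ ls, G.Crosses (u :: π) ls ∧ (m.toList ++ ls).IsChain (· ≠ ·) ∧
      Graph.NonTwisting (u :: π) ls := by
  induction h with
  | @nil m u h =>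
    refine ⟨[], .trivial hu, ?_, ?_⟩
    · cases m <;> simp
    · intro i x y l _ _ h
      simp at h
  | @cons m l u v π h1 h2 h3 h4 h5 h6 ih =>
    obtain ⟨ls, h7, h8, h9⟩ := ih (hG.verts_subset l h1 h4)
    refine ⟨l :: ls, .cons h1 h3 h4 h7, ?_, nonTwisting_cons.2 ⟨h5, h9⟩⟩
    cases m with
    | none => exact h8
    | some m => exact List.isChain_cons_cons.2 ⟨fun h => h2 (by rw [h]), h8⟩

theorem tail_of_crosses {G : Graph} {m : Option Link} {u : Vertex} {π : List Vertex}
    {ls : List Link} (h : G.Crosses (u :: π) ls) (hc : (m.toList ++ ls).IsChain (· ≠ ·))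
    (ht : Graph.NonTwisting (u :: π) ls)
    (hend : ∀ v ∈ (u :: π).getLast?, ∀ l ∈ G.links, v ∈ l.verts →
      some l = (m.toList ++ ls).getLast?) : Tail G m u π := by
  induction ls generalizing m u π with
  | nil =>
    cases h
    refine .nil fun l hl hu => ?_
    rw [hend u (by simp) l hl hu]
    cases m <;> simp
  | cons l ls ih =>
    cases h with
    | @cons _ v π _ _ h1 h2 h3 h4 =>
      obtain ⟨h5, h6⟩ := nonTwisting_cons.1 ht
      refine .cons h1 ?_ h2 h3 h5 (ih h4 ?_ h6 ?_)
      · rintro rfl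
        exact (List.isChain_cons_cons.1 hc).1 rfl
      · cases m with
        | none => exact hc
        | some m => exact hc.tail
      · intro x hx k hk hxk
        rw [hend x (by simpa using hx) k hk hxk]
        cases m <;> simp

/-- `u` has been reached by crossing `m`, and the next link to be crossed has the polarity `d` at
`u`. -/
def Arrived (G : Graph) : Option Link → Vertex → Bool → Prop
  | none, u, _ => ∀ l ∈ G.links, ∀ l' ∈ G.links, u ∈ l.verts → u ∈ l'.verts → l = l'
  | some l, u, d => l ∈ G.links ∧ l.Pol u (!d)

theorem Link.Pol.mem_verts {l : Link} {u : Vertex} {d : Bool} (h : l.Pol u d) : u ∈ l.verts := by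
  cases d
  · exact Link.ins_subset h
  · exact Link.outs_subset h

theorem Graph.Tidy.not_pol {G : Graph} (hG : G.Tidy) {l : Link} (hl : l ∈ G.links) {u : Vertex}
    {d : Bool} (h : l.Pol u d) : ¬ l.Pol u (!d) := by
  cases d
  · exact fun h' => hG.pol_disjoint l hl u h' h
  · exact fun h' => hG.pol_disjoint l hl u h h'

theorem Arrived.ne {G : Graph} (hG : G.Tidy) {m : Option Link} {u : Vertex} {d : Bool}
    (h : Arrived G m u d) {l : Link} (hl : l ∈ G.links) (hp : l.Pol u d) : some l ≠ m := by
  rintro rfl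
  exact hG.not_pol hl hp h.2

/-- At a vertex linked by `l` on the side still to be crossed, the path cannot stop, by maximality,
and cannot bounce. As a vertex has at most two links, it must cross `l`. -/
theorem Tail.next {G : Graph} (hG : G.Tidy) {m : Option Link} {u : Vertex} {d : Bool}
    (h : Arrived G m u d) {l : Link} (hl : l ∈ G.links) (hp : l.Pol u d) {π : List Vertex}
    (hπ : Tail G m u π) : ∃ v π', π = v :: π' ∧ v ∈ l.verts ∧
      (¬ l.IsStar → ¬ (u = l.concl ∧ v = l.concl) ∧ ¬ (u ∈ l.premises ∧ v ∈ l.premises)) ∧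
      Tail G (some l) v π' := by
  cases hπ with
  | nil h' => exact absurd (h' l hl hp.mem_verts) (h.ne hG hl hp)
  | @cons _ k _ v π h1 h2 h3 h4 h5 h6 =>
    have hk : k = l := by
      cases m with
      | none => exact h k h1 l hl h3 hp.mem_verts
      | some m =>
        exact hG.at_most_two m h.1 k h1 l hl u h.2.mem_verts h3 hp.mem_verts
          (fun h => h2 (by rw [h])) (fun h' => h.ne hG hl hp (by rw [h']))
    subst hk
    exact ⟨v, π, rfl, h4, h5, h6⟩

theorem not_isStar_of_mem {l : Link} {u : Vertex} (h : u ∈ l.premises) : ¬ l.IsStar := by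
  cases l <;> simp [Link.premises, Link.IsStar] at h ⊢

/-- A straight maximal path of non-zero weight follows the runs of the stack machine. -/
theorem Seg.follow {G : Graph} (hG : G.Tidy) {σ : G.ResPerm} {u v : Vertex}
    {s s' : List Sym} {d d' : Bool} {es : List Cr} (h : Seg G (numbering G σ) u s d es v s' d')
    {m : Option Link} (hm : Arrived G m u d) {π : List Vertex} (hπ : Tail G m u π)
    (hw : val s * G.permWeight σ (u :: π) ≠ 0) :
    ∃ m' π', π = es.map Cr.tgt ++ π' ∧ Arrived G m' v d' ∧ Tail G m' v π' ∧
      val s' * G.permWeight σ (v :: π') ≠ 0 ∧ (m'.isSome ∨ es = [] ∧ m' = m) := by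
  induction h generalizing m π with
  | nil => exact ⟨m, π, rfl, hm, hπ, hw, .inr ⟨rfl, rfl⟩⟩
  | @up l u v s s' d d₁ d' es h1 h2 h3 h4 _ ih =>
    obtain ⟨x, π, rfl, hx, htw, ht⟩ := hπ.next hG hm h1 h3
    -- Going to another premise would be twisting.
    obtain rfl : x = l.concl := by
      rw [mem_verts_iff] at hx
      exact hx.resolve_right fun h => (htw (not_isStar_of_mem h2)).2 ⟨h2, h⟩
    obtain ⟨m', π', rfl, h5, h6, h7, h8⟩ := ih (m := some l) ⟨h1, h4⟩ ht (by
      rwa [permWeight_cons, baseWeight_up hG σ h1 h2, ← mul_assoc] at hw)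
    refine ⟨m', π', rfl, h5, h6, h7, .inl ?_⟩
    obtain h8 | ⟨-, rfl⟩ := h8
    · exact h8
    · rfl
  | @dn l u v s s' d d₁ d' es h1 h2 h3 h4 _ ih =>
    obtain ⟨x, π, rfl, hx, htw, ht⟩ := hπ.next hG hm h1 h3
    have hxp : x ∈ l.premises := by
      rw [mem_verts_iff] at hx
      exact hx.resolve_left fun h => (htw (not_isStar_of_mem h2)).1 ⟨rfl, h⟩
    rw [permWeight_cons, baseWeight_dn hG σ h1 hxp, val, mul_assoc, ← mul_assoc _ _
      (G.permWeight σ _)] at hw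
    -- Another premise would have another symbol, and the weight would contain an annihilating pair.
    obtain rfl : u = x := by
      by_contra hne
      refine hw ?_
      rw [Link.sym_clash _ h2 fun h => hne (Link.sym_inj (isNumbering_numbering hG σ) h1 h2 hxp h)]
      simp
    rw [Sym.mul_inv, one_mul] at hw
    obtain ⟨m', π', rfl, h5, h6, h7, h8⟩ := ih (m := some l) ⟨h1, h4⟩ ht hw
    refine ⟨m', π', rfl, h5, h6, h7, .inl ?_⟩
    obtain h8 | ⟨-, rfl⟩ := h8
    · exact h8
    · rfl

/-- Runs of the stack machine are straight. -/
theorem Seg.tail {G : Graph} (hG : G.Tidy) {S : Vertex → ℕ} {u v : Vertex}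
    {s s' : List Sym} {d d' : Bool} {es : List Cr} (h : Seg G S u s d es v s' d')
    {m : Option Link} (hm : Arrived G m u d) {π : List Vertex}
    (hπ : ∀ m', Arrived G m' v d' → (m'.isSome ∨ m' = m) → Tail G m' v π) :
    Tail G m u (es.map Cr.tgt ++ π) := by
  induction h generalizing m with
  | nil => exact hπ m hm (.inr rfl)
  | @up l u v s s' d d₁ d' es h1 h2 h3 h4 _ ih =>
    refine .cons h1 (hm.ne hG h1 h3) h3.mem_verts h4.mem_verts (fun _ => ⟨?_, ?_⟩)
      (ih ⟨h1, h4⟩ fun m' h5 h6 => hπ m' h5 ?_)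
    · exact fun h => hG.concl_notMem l h1 (h.1 ▸ h2)
    · exact fun h => hG.concl_notMem l h1 h.2
    · exact .inl (h6.elim id fun h => h ▸ rfl)
  | @dn l u v s s' d d₁ d' es h1 h2 h3 h4 _ ih =>
    refine .cons h1 (hm.ne hG h1 h3) h3.mem_verts h4.mem_verts (fun _ => ⟨?_, ?_⟩)
      (ih ⟨h1, h4⟩ fun m' h5 h6 => hπ m' h5 ?_)
    · exact fun h => hG.concl_notMem l h1 (h.2 ▸ h2)
    · exact fun h => hG.concl_notMem l h1 h.1
    · exact .inl (h6.elim id fun h => h ▸ rfl)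

/-- The source of a crossing. -/
def Cr.src : Cr → Vertex
  | up _ u => u
  | dn l _ => l.concl

theorem Seg.pair_infix_iff {G : Graph} {S : Vertex → ℕ} {u v : Vertex}
    {s s' : List Sym} {d d' : Bool} {es : List Cr} (h : Seg G S u s d es v s' d')
    {x y : Vertex} : [x, y] <:+: u :: es.map Cr.tgt ↔ ∃ c ∈ es, c.src = x ∧ c.tgt = y := by
  induction h with
  | nil =>
    simp only [List.map_nil, List.not_mem_nil, false_and, exists_false, iff_false]
    intro h
    simpa using h.length_le
  | up _ _ _ _ _ ih =>
    rw [List.map_cons, List.infix_cons_iff, Cr.tgt, ih]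
    simp [List.cons_prefix_cons, Cr.src, Cr.tgt, eq_comm]
  | dn _ _ _ _ _ ih =>
    rw [List.map_cons, List.infix_cons_iff, Cr.tgt, ih]
    simp [List.cons_prefix_cons, Cr.src, Cr.tgt, eq_comm]

theorem Seg.getLast? {G : Graph} {S : Vertex → ℕ} {u v : Vertex}
    {s s' : List Sym} {d d' : Bool} {es : List Cr} (h : Seg G S u s d es v s' d') :
    (u :: es.map Cr.tgt).getLast? = some v := by
  induction h with
  | nil => simp
  | up _ _ _ _ _ ih => simpa [Cr.tgt] using ih
  | dn _ _ _ _ _ ih => simpa [Cr.tgt] using ih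

theorem pair_infix_append {α : Type*} {x y : α} {P Q : List α} (h : [x, y] <:+: P ++ Q) :
    [x, y] <:+: P ∨ [x, y] <:+: Q ∨ P.getLast? = some x ∧ Q.head? = some y := by
  induction P with
  | nil => exact .inr (.inl h)
  | cons a P ih =>
    rw [List.cons_append, List.infix_cons_iff] at h
    obtain h | h := h
    · rw [List.cons_prefix_cons] at h
      obtain ⟨rfl, h⟩ := h
      cases P with
      | nil =>
        cases Q with
        | nil => simp at h
        | cons b Q =>
          simp only [List.nil_append, List.cons_prefix_cons] at h
          exact .inr (.inr ⟨rfl, by simp [h.1]⟩)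
      | cons b P =>
        simp only [List.cons_append, List.cons_prefix_cons] at h
        obtain ⟨rfl, -⟩ := h
        exact .inl ⟨[], P, rfl⟩
    · obtain h | h | ⟨h, h'⟩ := ih h
      · exact .inl (h.trans (List.suffix_cons _ _).isInfix)
      · exact .inr (.inl h)
      · refine .inr (.inr ⟨?_, h'⟩)
        cases P with
        | nil => simp at h
        | cons b P => simpa using h


/-! ### Execution paths of closed nets -/

/-- A tidy net whose only conclusion is `a`. -/
structure Graph.Rooted (G : Graph) (a : Vertex) : Prop where
  tidy : G.Tidy
  root_unique : ∀ l ∈ G.links, ∀ l' ∈ G.links, a ∈ l.verts → a ∈ l'.verts → l = l'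
  root_mem : a ∈ G.verts
  conclusions_eq : G.conclusions = {a}

theorem crosses_verts {G : Graph} {π : List Vertex} {ls : List Link} (h : G.Crosses π ls)
    (hG : G.Tidy) : ∀ v ∈ π, v ∈ G.verts := by
  induction h with
  | trivial h => simpa using h
  | cons h1 h2 h3 _ ih =>
    simp only [List.mem_cons]
    rintro v (rfl | h)
    · exact hG.verts_subset _ h1 h2
    · exact ih v (by simpa using h)

theorem crosses_concat {G : Graph} {π : List Vertex} {ls : List Link} (h : G.Crosses π ls)
    {v w : Vertex} {l : Link} (hv : v ∈ π.getLast?) (hl : l ∈ G.links) (hvl : v ∈ l.verts)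
    (hwl : w ∈ l.verts) (hG : G.Tidy) : G.Crosses (π ++ [w]) (ls ++ [l]) := by
  induction h with
  | trivial h =>
    simp only [List.getLast?_singleton, Option.mem_def, Option.some.injEq] at hv
    subst hv
    exact .cons hl hvl hwl (.trivial (hG.verts_subset l hl hwl))
  | cons h1 h2 h3 _ ih => exact .cons h1 h2 h3 (ih (by simpa using hv))

theorem crosses_of_append {G : Graph} {xs : List Vertex} {x : Vertex} {π : List Vertex}
    {ls : List Link} (h : G.Crosses (xs ++ x :: π) ls) :
    ∃ ls' ls'', ls = ls' ++ ls'' ∧ G.Crosses (x :: π) ls'' := by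
  induction xs generalizing ls with
  | nil => exact ⟨[], ls, rfl, h⟩
  | cons y xs ih =>
    generalize hρ : (y :: xs) ++ x :: π = ρ at h
    cases h with
    | trivial => simp at hρ
    | @cons u v π' l ls h1 h2 h3 h4 =>
      simp only [List.cons_append, List.cons.injEq] at hρ
      obtain ⟨rfl, hρ⟩ := hρ
      rw [← hρ] at h4
      obtain ⟨ls', ls'', rfl, h5⟩ := ih h4
      exact ⟨l :: ls', ls'', rfl, h5⟩

namespace Graph.Rooted

variable {G : Graph} {a : Vertex}

/-- Only one link is attached to the root, so passing through the root would cross that link twice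
in a row. -/
theorem not_interior (hG : G.Rooted a) {xs ys : List Vertex} {x y : Vertex} {ls : List Link}
    (h : G.Crosses (xs ++ x :: a :: y :: ys) ls) (hls : NonBouncing ls) : False := by
  obtain ⟨ls', ls'', rfl, h'⟩ := crosses_of_append h
  cases h' with
  | @cons _ _ _ l _ h1 h2 h3 h6 =>
    cases h6 with
    | @cons _ _ _ l' ls'' h4 h5 _ _ =>
      have := hls.right_of_append
      exact (List.isChain_cons_cons.1 this).1 (hG.root_unique l h1 l' h4 h3 h5)

/-- The straight maximal paths start from the conclusion. -/
theorem exists_tail (hG : G.Rooted a) {π : List Vertex} (h : G.IsStraight π)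
    (hmax : G.IsMaximal π) : ∃ π', π = a :: π' ∧ Tail G none a π' := by
  obtain ⟨ls, h1, h2, h3⟩ := h
  obtain ⟨x, π, rfl⟩ : ∃ x π', π = x :: π' := by cases h1 <;> exact ⟨_, _, rfl⟩
  have hend : ∀ v ∈ (x :: π).getLast?, ∀ l ∈ G.links, v ∈ l.verts → some l = ls.getLast? := by
    intro v hv l hl hvl
    by_contra hne
    have h4 := crosses_concat h1 hv hl hvl (mem_verts_iff.2 (.inl rfl)) hG.tidy
    have h5 : NonBouncing (ls ++ [l]) := by
      refine List.isChain_append.2 ⟨h2, by simp, ?_⟩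
      intro k hk k' hk'
      simp only [List.head?_cons, Option.mem_def, Option.some.injEq] at hk'
      rintro rfl
      rw [Option.mem_def] at hk
      exact hne (by rw [hk, hk'])
    have := hmax _ _ h4 h5 (List.prefix_append _ _).isInfix
    simpa using congrArg List.length this
  have hxv := crosses_verts h1 hG.tidy x (by simp)
  -- Any link at the first vertex other than the first one crossed could be used to prolong the path
  -- backwards, against maximality. So that vertex is linked only once, and it is the conclusion of
  -- the net.
  have hstart : ∀ l ∈ G.links, x ∈ l.verts → some l = ls.head? := by
    intro l hl hxl
    by_contra hne
    have h4 : G.Crosses (l.concl :: x :: π) (l :: ls) :=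
      .cons hl (mem_verts_iff.2 (.inl rfl)) hxl h1
    have h5 : NonBouncing (l :: ls) := by
      refine List.isChain_cons.2 ⟨?_, h2⟩
      intro k hk
      rintro rfl
      exact hne hk.symm
    have := hmax _ _ h4 h5 (List.suffix_cons _ _).isInfix
    simpa using congrArg List.length this
  have hx : x ∈ G.conclusions := by
    obtain ⟨l, hl, hxl⟩ := hG.tidy.exists_link x hxv
    simp only [Graph.conclusions, Finset.mem_filter, hxv, true_and, Finset.card_eq_one]
    refine ⟨l, ?_⟩
    ext k
    simp only [Graph.linksAt, Finset.mem_filter, Finset.mem_singleton]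
    constructor
    · rintro ⟨hk, hxk⟩
      exact Option.some.inj ((hstart k hk hxk).trans (hstart l hl hxl).symm)
    · rintro rfl
      exact ⟨hl, hxl⟩
  rw [hG.conclusions_eq, Finset.mem_singleton] at hx
  subst hx
  exact ⟨π, rfl, tail_of_crosses h1 h2 h3 hend⟩

end Graph.Rooted

/-- The path that goes from `a` to `z` along the crossings `es`, crosses a `⋆`-link at `z`, and
comes back. -/
def runPath (a : Vertex) (es : List Cr) (z : Vertex) : List Vertex :=
  (a :: es.map Cr.tgt) ++ (z :: (revE es).map Cr.tgt)

namespace Graph.Rooted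

variable {G : Graph} {a z : Vertex} {es : List Cr}

/-- The path is forced along the run as far as `z`, where the `⋆`-link is the only continuation. It
is then forced along the reversed run back to the root, where it ends. -/
theorem eq_runPath (hG : G.Rooted a) {σ : G.ResPerm}
    (h : Seg G (numbering G σ) a [] true es z [] true) (hz : .star z ∈ G.links)
    {π : List Vertex} (hs : G.IsStraight π) (hmax : G.IsMaximal π) (hw : G.permWeight σ π ≠ 0) :
    π = runPath a es z := by
  obtain ⟨π, rfl, ht⟩ := hG.exists_tail hs hmax
  obtain ⟨m, π, rfl, h1, h2, h3, -⟩ := h.follow hG.tidy (m := none) hG.root_unique ht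
    (by simpa [val] using hw)
  obtain ⟨x, π, rfl, h4, -, h5⟩ := h2.next hG.tidy h1 hz (by simp [Link.Pol, Link.outs])
  obtain rfl : x = z := by simpa [mem_verts_iff, Link.concl, Link.premises] using h4
  -- After the `⋆`-link the stack consists of the single symbol `⋆`, which the way back keeps at the
  -- bottom without popping it.
  obtain ⟨m', π, rfl, h6, h7, -, h8⟩ := (h.reverse.frame [.star]).follow hG.tidy
    (m := some (.star x)) ⟨hz, by simp [Link.Pol, Link.outs]⟩ h5 (by
      rw [permWeight_cons, baseWeight_star σ hz] at h3
      simpa [val] using h3)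
  have hm' : ∃ l, m' = some l := by
    obtain h8 | ⟨-, h8⟩ := h8
    · exact Option.isSome_iff_exists.1 h8
    · exact ⟨_, h8⟩
  obtain ⟨l, rfl⟩ := hm'
  -- Back at the root, whose only link has just been crossed, the path cannot go on without
  -- bouncing.
  cases h7 with
  | nil => simp [runPath]
  | cons h9 h10 h11 =>
    exact absurd (congrArg some (hG.root_unique _ h9 l h6.1 h11 h6.2.mem_verts)) h10

/-- No straight maximal path has a non-zero weight when the run that it has to follow gets stuck
at a `!`-link. -/
theorem not_of_stuck (hG : G.Rooted a) {σ : G.ResPerm} {us : List Vertex} {w : Vertex} {j : ℕ}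
    {s : List Sym} (hl : .oc us w ∈ G.links)
    (h : Seg G (numbering G σ) a [] true es w (.e j :: s) true)
    (hj : ∀ u ∈ us, numbering G σ u ≠ j)
    {π : List Vertex} (hs : G.IsStraight π) (hmax : G.IsMaximal π) : G.permWeight σ π = 0 := by
  by_contra hw
  obtain ⟨π, rfl, ht⟩ := hG.exists_tail hs hmax
  obtain ⟨m, π, rfl, h1, h2, h3, -⟩ := h.follow hG.tidy (m := none) hG.root_unique ht
    (by simpa [val] using hw)
  obtain ⟨x, π, rfl, h4, h5, -⟩ := h2.next hG.tidy h1 hl (by simp [Link.Pol, Link.outs])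
  have hx : x ∈ us := by
    rw [mem_verts_iff] at h4
    exact h4.resolve_left fun h => (h5 (by simp [Link.IsStar])).1 ⟨rfl, h⟩
  refine h3 ?_
  have hb : G.baseWeight σ w x = (Sym.e (numbering G σ x)).toRL.inv :=
    baseWeight_dn hG.tidy σ hl hx
  rw [permWeight_cons, hb, val, mul_assoc, ← mul_assoc _ _ (G.permWeight σ _)]
  have : (Sym.e j).toRL * (Sym.e (numbering G σ x)).toRL.inv = 0 :=
    RL.mk_eq (.annihil_e _ _ (hj x hx).symm)
  simp [this]

/-- Both halves start and end with the same stack contents, so each of them cancels completely and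
only the symbol of the `⋆`-link remains. -/
theorem permWeight_runPath (hG : G.Rooted a) {σ : G.ResPerm}
    (h : Seg G (numbering G σ) a [] true es z [] true) (hz : .star z ∈ G.links) :
    G.permWeight σ (runPath a es z) = Sym.star.toRL := by
  have h1 := h.val_mul hG.tidy (z :: (revE es).map Cr.tgt)
  have h2 := (h.reverse.frame [.star]).val_mul hG.tidy []
  simp only [val, one_mul, List.append_nil, List.nil_append] at h1 h2
  rw [runPath, List.cons_append, h1, permWeight_cons, baseWeight_star σ hz, h2]
  simp [Graph.permWeight]

theorem isStraight_runPath (hG : G.Rooted a) {S : Vertex → ℕ}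
    (h : Seg G S a [] true es z [] true) (hz : .star z ∈ G.links) :
    G.IsStraight (runPath a es z) := by
  have h1 : Tail G none a (es.map Cr.tgt ++ z :: (revE es).map Cr.tgt) := by
    refine h.tail hG.tidy (m := none) hG.root_unique fun m hm _ => ?_
    refine .cons hz (hm.ne hG.tidy hz (by simp [Link.Pol, Link.outs]))
      (mem_verts_iff.2 (.inl rfl)) (mem_verts_iff.2 (.inl rfl)) (by simp [Link.IsStar]) ?_
    have := h.reverse.tail (π := []) hG.tidy (m := some (.star z))
      ⟨hz, by simp [Link.Pol, Link.outs]⟩ fun m hm hm' => ?_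
    · simpa using this
    · have : ∃ l, m = some l := by
        obtain h8 | h8 := hm'
        · exact Option.isSome_iff_exists.1 h8
        · exact ⟨_, h8⟩
      obtain ⟨l, rfl⟩ := this
      exact .nil fun k hk hak => congrArg some (hG.root_unique _ hk l hm.1 hak hm.2.mem_verts)
  obtain ⟨ls, h2, h3, h4⟩ := h1.crosses hG.root_mem hG.tidy
  exact ⟨ls, h2, h3, h4⟩

/-- The path has the root at both ends, and a proper extension would put a root in the interior. -/
theorem isMaximal_runPath (hG : G.Rooted a) {S : Vertex → ℕ}
    (h : Seg G S a [] true es z [] true) : G.IsMaximal (runPath a es z) := by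
  rintro π' ls' h1 h2 ⟨xs, ys, rfl⟩
  have hlast := h.reverse.getLast?
  have hxs : xs = [] := by
    by_contra hne
    obtain ⟨xs, x, rfl⟩ := List.eq_nil_or_concat xs |>.resolve_left hne
    obtain ⟨y, ρ, hρ⟩ : ∃ y ρ, es.map Cr.tgt ++ (z :: (revE es).map Cr.tgt) = y :: ρ := by
      cases hc : es.map Cr.tgt ++ (z :: (revE es).map Cr.tgt) with
      | nil => simp at hc
      | cons y ρ => exact ⟨y, ρ, rfl⟩
    refine hG.not_interior (xs := xs) (x := x) (y := y) (ys := ρ ++ ys) (ls := ls') ?_ h2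
    simpa [runPath, hρ] using h1
  have hys : ys = [] := by
    by_contra hne
    obtain ⟨y, ys, rfl⟩ := List.exists_cons_of_ne_nil hne
    obtain ⟨ρ, hρ⟩ := List.getLast?_eq_some_iff.1 hlast
    obtain ⟨ρ', x, hρ'⟩ := List.eq_nil_or_concat (xs ++ a :: (es.map Cr.tgt ++ ρ)) |>.resolve_left
      (by simp)
    refine hG.not_interior (xs := ρ') (x := x) (y := y) (ys := ys) (ls := ls') ?_ h2
    have : xs ++ runPath a es z ++ y :: ys = ρ' ++ x :: a :: y :: ys := by
      have h5 : runPath a es z = a :: (es.map Cr.tgt ++ ρ) ++ [a] := by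
        rw [runPath, hρ]
        simp
      rw [h5, ← List.append_assoc xs, hρ']
      simp
    rwa [← this]
  simp [hxs, hys]

/-- The way back crosses the same premises as the way out, and the jump over the `⋆`-link crosses
none, so only the first half matters. -/
theorem isComprehensive_runPath_iff (hG : G.Rooted a) {S : Vertex → ℕ}
    (h : Seg G S a [] true es z [] true) :
    G.IsComprehensive (runPath a es z) ↔
      ∀ l ∈ G.links, ∀ u ∈ l.premises, ∀ x ∈ (Cr.up l u).toks, x ∈ crossed es := by
  have htgt : ∀ (c : Cr), c.rev.src = c.tgt ∧ c.rev.tgt = c.src := by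
    rintro (⟨l, u⟩ | ⟨l, u⟩) <;> exact ⟨rfl, rfl⟩
  have hrev : ∀ {c : Cr}, c ∈ revE es ↔ c.rev ∈ es := by
    intro c
    have hrr : ∀ c : Cr, c.rev.rev = c := by rintro (⟨l, u⟩ | ⟨l, u⟩) <;> rfl
    simp only [revE, List.mem_reverse, List.mem_map]
    constructor
    · rintro ⟨c, hc, rfl⟩
      rwa [hrr]
    · intro hc
      exact ⟨_, hc, hrr c⟩
  constructor
  · intro hc l hl u hu x hx
    have hexp : l.IsExponential := by
      cases l <;> simp [Cr.toks, Link.IsExponential] at hx ⊢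
    have hne : u ≠ l.concl := fun h => hG.tidy.concl_notMem l hl (h ▸ hu)
    have key : ∀ y w, [y, w] <:+: runPath a es z → y ≠ w → ∃ c ∈ es,
        (c.src = y ∧ c.tgt = w) ∨ (c.src = w ∧ c.tgt = y) := by
      intro y w hyw hne
      obtain h1 | h1 | h1 := pair_infix_append hyw
      · obtain ⟨c, hc, h2⟩ := h.pair_infix_iff.1 h1
        exact ⟨c, hc, .inl h2⟩
      · obtain ⟨c, hc, h2⟩ := h.reverse.pair_infix_iff.1 h1
        refine ⟨c.rev, hrev.1 hc, .inr ?_⟩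
        rw [(htgt c).1, (htgt c).2]
        exact ⟨h2.2, h2.1⟩
      · rw [h.getLast?] at h1
        simp only [Option.some.injEq, List.head?_cons] at h1
        exact absurd (h1.1.symm.trans h1.2) hne
    have : ∃ c ∈ es, (c.src = u ∧ c.tgt = l.concl) ∨ (c.src = l.concl ∧ c.tgt = u) := by
      obtain h1 | h1 := hc l hl hexp u hu
      · exact key _ _ h1 hne
      · obtain ⟨c, h2, h3⟩ := key _ _ h1 hne.symm
        exact ⟨c, h2, h3.symm⟩
    obtain ⟨c, hces, hc⟩ := this
    obtain ⟨h1, h2⟩ := h.links_mem c hces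
    have hlu : c.link = l ∧ c.prem = u := by
      rcases c with ⟨k, v⟩ | ⟨k, v⟩ <;> simp only [Cr.src, Cr.tgt, Cr.link, Cr.prem] at hc h1 h2 ⊢
      · obtain ⟨rfl, h3⟩ | ⟨rfl, rfl⟩ := hc
        · exact ⟨hG.tidy.edge_unique _ h1 l hl v h2 hu h3, rfl⟩
        · exact absurd h2 (hG.tidy.edge_anti l hl k h1 hu)
      · obtain ⟨rfl, rfl⟩ | ⟨h3, rfl⟩ := hc
        · exact absurd h2 (hG.tidy.edge_anti l hl k h1 hu)
        · exact ⟨hG.tidy.edge_unique _ h1 l hl v h2 hu h3, rfl⟩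
    refine mem_crossed_iff.2 ⟨c, hces, ?_⟩
    rcases c with ⟨k, v⟩ | ⟨k, v⟩ <;> obtain ⟨rfl, rfl⟩ := hlu
    · exact hx
    · rw [← Cr.toks_rev]
      exact hx
  · intro hc l hl hexp u hu
    obtain ⟨x, hx⟩ : ∃ x, (Cr.up l u).toks = [x] := by
      cases l <;> simp [Cr.toks, Link.IsExponential] at hexp ⊢
    obtain ⟨c, hces, hxc⟩ := mem_crossed_iff.1 (hc l hl u hu x (by simp [hx]))
    obtain ⟨h1, h2⟩ := h.links_mem c hces
    have hlu : c.link = l ∧ c.prem = u := by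
      rcases c with ⟨k, v⟩ | ⟨k, v⟩ <;> cases l <;> cases k <;>
        simp [Cr.toks] at hx hxc <;> subst hx <;> simp at hxc <;> subst hxc <;>
        exact ⟨hG.tidy.pol_unique _ h1 _ hl u (by
          first | exact .inr ⟨h2, hu⟩ | exact .inl ⟨h2, hu⟩), rfl⟩
    have h3 := h.pair_infix_iff.2 ⟨c, hces, rfl, rfl⟩
    have h4 : [c.src, c.tgt] <:+: runPath a es z := h3.trans (List.prefix_append _ _).isInfix
    rcases c with ⟨k, v⟩ | ⟨k, v⟩ <;> obtain ⟨rfl, rfl⟩ := hlu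
    · exact .inl h4
    · exact .inr h4

/-- Comprehensive runs that cross the `!`-links downwards first determine their resource
permutations. -/
theorem resPerm_unique (hG : G.Rooted a) {σ σ' : G.ResPerm} {es' : List Cr} {z' : Vertex}
    (h : Seg G (numbering G σ) a [] true es z [] true)
    (h' : Seg G (numbering G σ') a [] true es' z' [] true) (hes : DownFirst es)
    (hc : ∀ l ∈ G.links, ∀ u ∈ l.premises, ∀ x ∈ (Cr.up l u).toks, x ∈ crossed es)
    (heq : runPath a es z = runPath a es' z') : σ = σ' := by
  -- A run of length `m` makes a path of `2 * m + 2` vertices, so equal paths have the same middle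
  -- and equal first halves.
  have hlen : es.length = es'.length := by
    have := congrArg List.length heq
    simp [runPath, revE] at this
    omega
  have htgt : es.map Cr.tgt = es'.map Cr.tgt := by
    have := (List.append_inj heq (by simp [hlen])).1
    exact (List.cons.inj this).2
  obtain rfl := h.es_unique hG.tidy h' htgt
  have hS := (h.numbering_unique h' hes).2
  funext r
  ext i
  rw [← numbering_getElem hG.tidy, ← numbering_getElem hG.tidy]
  refine hS _ ?_
  obtain ⟨us, w, hr, hl⟩ := mem_ocLinks.1 r.2
  refine hc _ hl (r.1.premises[i.1]'i.2) ?_ _ (by simp [Cr.toks])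
  have : r.1.premises = us := by rw [hr]; rfl
  change _ ∈ us
  rw [← this]
  exact List.getElem_mem _

end Graph.Rooted


/-! ### Labelled terms -/

/-! Terms whose nodes are labelled with their addresses in a net. The node `jump o T` stands for an
occurrence `o` of a variable that has been replaced with `T`, and `blocked o` for an occurrence
that has been left without any replacement. -/
mutual
  inductive LT : Type
    | star (a : Vertex) : LT
    | var (o : Vertex) (k : ℕ) : LT
    | lam (a : Vertex) (T : LT) : LT
    | app (a : Vertex) (T : LT) (B : LB) : LT
    | jump (o : Vertex) (T : LT) : LT
    | blocked (o : Vertex) : LT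
  inductive LB : Type
    | nil : LB
    | cons (T : LT) (B : LB) : LB
end

theorem LT.ind {P : LT → Prop} {Q : LB → Prop} (star : ∀ a, P (.star a))
    (var : ∀ o k, P (.var o k)) (lam : ∀ a T, P T → P (.lam a T))
    (app : ∀ a T B, P T → Q B → P (.app a T B)) (jump : ∀ o T, P T → P (.jump o T))
    (blocked : ∀ o, P (.blocked o)) (nil : Q .nil) (cons : ∀ T B, P T → Q B → Q (.cons T B)) :
    (∀ T, P T) ∧ (∀ B, Q B) :=
  ⟨fun T => LT.rec (motive_1 := P) (motive_2 := Q) star var lam app jump blocked nil cons T,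
   fun B => LB.rec (motive_1 := P) (motive_2 := Q) star var lam app jump blocked nil cons B⟩

/-- The address of a labelled term. -/
def LT.root : LT → Vertex
  | .star a => a
  | .var o _ => o
  | .lam a _ => a
  | .app a _ _ => a
  | .jump o _ => o
  | .blocked o => o

/-- The elements of a bag. -/
def LB.toList : LB → List LT
  | .nil => []
  | .cons T B => T :: B.toList

/-- The addresses of the elements of a bag. -/
def LB.roots (B : LB) : List Vertex := B.toList.map LT.root

mutual
  /-- The addresses of the occurrences of the variable `k`. -/
  def LT.occs (k : ℕ) : LT → List Vertex
    | .star _ => []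
    | .var o x => if x = k then [o] else []
    | .lam _ T => T.occs (k + 1)
    | .app _ T B => T.occs k ++ B.occs k
    | .jump _ _ => []
    | .blocked _ => []
  def LB.occs (k : ℕ) : LB → List Vertex
    | .nil => []
    | .cons T B => T.occs k ++ B.occs k
end

mutual
  /-- The underlying term, in which a blocked occurrence becomes a stuck term. -/
  def LT.erase : LT → Tm
    | .star _ => .star
    | .var _ k => .var k
    | .lam _ T => .lam T.erase
    | .app _ T B => .app T.erase B.erase
    | .jump _ T => T.erase
    | .blocked _ => .app .star .nil
  def LB.erase : LB → Bag
    | .nil => .nil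
    | .cons T B => .cons T.erase B.erase
end

mutual
  /-- Replacement of the occurrences of the variable `d`. -/
  def LT.subst (g : Vertex → LT) (d : ℕ) : LT → LT
    | .star a => .star a
    | .var o k => if k = d then g o else .var o k
    | .lam a T => .lam a (T.subst g (d + 1))
    | .app a T B => .app a (T.subst g d) (B.subst g d)
    | .jump o T => .jump o T
    | .blocked o => .blocked o
  def LB.subst (g : Vertex → LT) (d : ℕ) : LB → LB
    | .nil => .nil
    | .cons T B => .cons (T.subst g d) (B.subst g d)
end

mutual
  /-- The tokens of a labelled term. -/
  def LT.toks : LT → Multiset Tok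
    | .star _ => 0
    | .var o _ => {.occ o}
    | .lam _ T => T.toks
    | .app a T B => .node (1 :: a) ::ₘ (T.toks + B.toks)
    | .jump o T => .occ o ::ₘ .rt T.root ::ₘ T.toks
    | .blocked _ => 0
  def LB.toks : LB → Multiset Tok
    | .nil => 0
    | .cons T B => .rt T.root ::ₘ (T.toks + B.toks)
end

mutual
  /-- The labels of the nodes match the links of the net, and the free variables are less
  than `d`. -/
  def LT.Ok (G : Graph) (d : ℕ) : LT → Prop
    | .star a => .star a ∈ G.links
    | .var _ k => k < d
    | .lam a T => .imp (1 :: a) (0 :: a) a ∈ G.links ∧ .wn (T.occs 0) (1 :: a) ∈ G.links ∧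
        T.root = 0 :: a ∧ T.Ok G (d + 1)
    | .app a T B => .nimp (1 :: a) a (0 :: a) ∈ G.links ∧ .oc B.roots (1 :: a) ∈ G.links ∧
        T.root = 0 :: a ∧ T.Ok G d ∧ B.Ok G d
    | .jump _ T => T.Ok G 0
    | .blocked _ => True
  def LB.Ok (G : Graph) (d : ℕ) : LB → Prop
    | .nil => True
    | .cons T B => T.Ok G d ∧ B.Ok G d
end

theorem LB.erase_toList (B : LB) : B.erase.toList = B.toList.map LT.erase := by
  induction B using LB.rec (motive_1 := fun _ => True) <;>
    simp_all [LB.erase, LB.toList, Bag.toList]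

theorem LB.ok_iff {G : Graph} {d : ℕ} {B : LB} : B.Ok G d ↔ ∀ L ∈ B.toList, L.Ok G d := by
  induction B using LB.rec (motive_1 := fun _ => True) <;>
    simp_all [LB.Ok, LB.toList]

theorem LB.toks_eq (B : LB) :
    B.toks = (B.toList.map fun L => .rt L.root ::ₘ L.toks).sum := by
  induction B using LB.rec (motive_1 := fun _ => True) <;>
    simp_all [LB.toks, LB.toList]

/-- A replacement keeps the address of the occurrence that it replaces, so the labels go on matching
the premises of the links of the original net. -/
theorem root_subst {g : Vertex → LT} (hg : ∀ o, (g o).root = o) (T : LT) (d : ℕ) :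
    (T.subst g d).root = T.root := by
  cases T with
  | var o k =>
    simp only [LT.subst]
    split_ifs
    · exact hg o
    · rfl
  | _ => rfl

theorem roots_subst {g : Vertex → LT} (hg : ∀ o, (g o).root = o) (B : LB) (d : ℕ) :
    (B.subst g d).roots = B.roots := by
  induction B using LB.rec (motive_1 := fun _ => True) <;>
    simp_all [LB.roots, LB.toList, LB.subst, root_subst]

theorem occs_of_ok {G : Graph} :
    (∀ (T : LT) (d : ℕ), T.Ok G d → ∀ k, d ≤ k → T.occs k = []) ∧
    (∀ (B : LB) (d : ℕ), B.Ok G d → ∀ k, d ≤ k → B.occs k = []) := by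
  refine LT.ind ?_ ?_ ?_ ?_ ?_ ?_ ?_ ?_
  · intros; rfl
  · intro o x d h k hk
    have : x < d := h
    simp only [LT.occs]
    rw [if_neg (by omega)]
  · intro a T ih d h k hk
    exact ih _ h.2.2.2 _ (by omega)
  · intro a T B ih ihB d h k hk
    simp [LT.occs, ih d h.2.2.2.1 k hk, ihB d h.2.2.2.2 k hk]
  · intros; rfl
  · intros; rfl
  · intros; rfl
  · intro T B ih ihB d h k hk
    simp [LB.occs, ih d h.1 k hk, ihB d h.2 k hk]

theorem length_occs_of_ok {G : Graph} :
    (∀ (T : LT) (d : ℕ), T.Ok G d → ∀ k, (T.occs k).length = T.erase.occ k) ∧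
    (∀ (B : LB) (d : ℕ), B.Ok G d → ∀ k, (B.occs k).length = B.erase.occ k) := by
  refine LT.ind ?_ ?_ ?_ ?_ ?_ ?_ ?_ ?_
  · intros; rfl
  · intro o x d h k
    simp only [LT.occs, LT.erase, Tm.occ]
    split_ifs <;> rfl
  · intro a T ih d h k
    exact ih _ h.2.2.2 _
  · intro a T B ih ihB d h k
    simp [LT.occs, LT.erase, Tm.occ, ih d h.2.2.2.1 k, ihB d h.2.2.2.2 k]
  · intro o T ih d h k
    have := ih 0 h k
    rw [occs_of_ok.1 T 0 h k (Nat.zero_le _)] at this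
    exact this
  · intros; rfl
  · intros; rfl
  · intro T B ih ihB d h k
    simp [LB.occs, LB.erase, Bag.occ, ih d h.1 k, ihB d h.2 k]

theorem lift_erase {G : Graph} {T : LT} (h : T.Ok G 0) (d : ℕ) : T.erase.lift 0 d = T.erase := by
  have h0 : ∀ k, T.erase.occ k = 0 := fun k => by
    rw [← length_occs_of_ok.1 T 0 h k, occs_of_ok.1 T 0 h k (Nat.zero_le _)]
    rfl
  rw [lift_zero_eq_ren, ren_congr.1 _ _ (fun x => x) (fun x hx => by simp [h0] at hx), ren_id.1]

theorem occs_subst {g : Vertex → LT} (hg : ∀ o k, (g o).occs k = []) :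
    (∀ (T : LT) (d k : ℕ), k ≠ d → (T.subst g d).occs k = T.occs k) ∧
    (∀ (B : LB) (d k : ℕ), k ≠ d → (B.subst g d).occs k = B.occs k) := by
  refine LT.ind ?_ ?_ ?_ ?_ ?_ ?_ ?_ ?_
  · intros; rfl
  · intro o x d k hk
    simp only [LT.subst, LT.occs]
    split_ifs with h h' h'
    · omega
    · exact hg o k
    · simp [LT.occs, h']
    · simp [LT.occs, h']
  · intro a T ih d k hk
    exact ih _ _ (by omega)
  · intro a T B ih ihB d k hk
    simp [LT.subst, LT.occs, ih d k hk, ihB d k hk]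
  · intros; rfl
  · intros; rfl
  · intros; rfl
  · intro T B ih ihB d k hk
    simp [LB.subst, LB.occs, ih d k hk, ihB d k hk]

theorem ok_subst {G : Graph} {g : Vertex → LT} (hr : ∀ o, (g o).root = o)
    (hg : ∀ o d, (g o).Ok G d) :
    (∀ (T : LT) (d : ℕ), T.Ok G (d + 1) → (T.subst g d).Ok G d) ∧
    (∀ (B : LB) (d : ℕ), B.Ok G (d + 1) → (B.subst g d).Ok G d) := by
  have ho : ∀ o k, (g o).occs k = [] := fun o k => occs_of_ok.1 _ 0 (hg o 0) k (Nat.zero_le _)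
  refine LT.ind ?_ ?_ ?_ ?_ ?_ ?_ ?_ ?_
  · intro a d h; exact h
  · intro o x d h
    have : x < d + 1 := h
    simp only [LT.subst]
    split_ifs with h'
    · exact hg o d
    · change x < d
      omega
  · intro a T ih d h
    refine ⟨h.1, ?_, ?_, ih _ h.2.2.2⟩
    · rw [(occs_subst ho).1 T (d + 1) 0 (by omega)]
      exact h.2.1
    · rw [root_subst hr]
      exact h.2.2.1
  · intro a T B ih ihB d h
    refine ⟨h.1, ?_, ?_, ih _ h.2.2.2.1, ihB _ h.2.2.2.2⟩
    · rw [roots_subst hr]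
      exact h.2.1
    · rw [root_subst hr]
      exact h.2.2.1
  · intro o T _ d h; exact h
  · intros; trivial
  · intros; trivial
  · intro T B ih ihB d h
    exact ⟨ih d h.1, ihB d h.2⟩

/-- Each replaced occurrence gives up its own token and receives those of its replacement. The
balance is written additively to avoid subtraction of multisets. -/
theorem toks_subst {g : Vertex → LT} (hr : ∀ o, (g o).root = o) :
    (∀ (T : LT) (d : ℕ), (T.subst g d).toks + ((T.occs d).map fun o => {Tok.occ o}).sum =
      T.toks + ((T.occs d).map fun o => (g o).toks).sum) ∧
    (∀ (B : LB) (d : ℕ), (B.subst g d).toks + ((B.occs d).map fun o => {Tok.occ o}).sum =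
      B.toks + ((B.occs d).map fun o => (g o).toks).sum) := by
  refine LT.ind ?_ ?_ ?_ ?_ ?_ ?_ ?_ ?_
  · intros; rfl
  · intro o x d
    simp only [LT.subst, LT.occs]
    split_ifs with h
    · simp [LT.toks, add_comm]
    · simp
  · intro a T ih d
    exact ih _
  · intro a T B ih ihB d
    simp only [LT.subst, LT.toks, LT.occs, List.map_append, List.sum_append, Multiset.cons_add]
    rw [add_add_add_comm, ih, ihB, add_add_add_comm]
  · intros; rfl
  · intros; rfl
  · intros; rfl
  · intro T B ih ihB d
    simp only [LB.subst, LB.toks, LB.occs, List.map_append, List.sum_append, Multiset.cons_add]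
    rw [add_add_add_comm, ih, ihB, add_add_add_comm, root_subst hr]

theorem occs_le_toks :
    (∀ (T : LT) (d : ℕ), (((T.occs d).map Tok.occ : List Tok) : Multiset Tok) ≤ T.toks) ∧
    (∀ (B : LB) (d : ℕ), (((B.occs d).map Tok.occ : List Tok) : Multiset Tok) ≤ B.toks) := by
  refine LT.ind ?_ ?_ ?_ ?_ ?_ ?_ ?_ ?_
  · intros; exact Multiset.zero_le _
  · intro o x d
    simp only [LT.occs]
    split_ifs
    · exact le_refl _
    · exact Multiset.zero_le _
  · intro a T ih d
    exact ih _
  · intro a T B ih ihB d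
    simp only [LT.occs, List.map_append, ← Multiset.coe_add]
    exact (add_le_add (ih d) (ihB d)).trans (Multiset.le_cons_self _ _)
  · intros; exact Multiset.zero_le _
  · intros; exact Multiset.zero_le _
  · intros; exact Multiset.zero_le _
  · intro T B ih ihB d
    simp only [LB.occs, List.map_append, ← Multiset.coe_add]
    exact (add_le_add (ih d) (ihB d)).trans (Multiset.le_cons_self _ _)

theorem nodup_occs {T : LT} (h : T.toks.Nodup) (d : ℕ) : (T.occs d).Nodup := by
  have := Multiset.nodup_of_le (occs_le_toks.1 T d) h
  exact List.Nodup.of_map _ (Multiset.coe_nodup.1 this)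

/-- The list of addresses of occurrences and the numbering used by `lsubst` both go from left to
right, so the `j`-th address receives the `j`-th term. The requirement for every lift makes the
substituted terms closed. -/
theorem erase_subst {G : Graph} {g : Vertex → LT} {f : ℕ → Tm} :
    (∀ (T : LT) (d i : ℕ), T.Ok G (d + 1) →
      (∀ j (h : j < (T.occs d).length), ∀ d', (f (i + j)).lift 0 d' = (g (T.occs d)[j]).erase) →
      (T.subst g d).erase = T.erase.lsubst f d i) ∧
    (∀ (B : LB) (d i : ℕ), B.Ok G (d + 1) →
      (∀ j (h : j < (B.occs d).length), ∀ d', (f (i + j)).lift 0 d' = (g (B.occs d)[j]).erase) →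
      (B.subst g d).erase = B.erase.lsubst f d i) := by
  have append : ∀ {as bs : List Vertex} {i n : ℕ}, as.length = n →
      (∀ j (h : j < (as ++ bs).length), ∀ d', (f (i + j)).lift 0 d' = (g (as ++ bs)[j]).erase) →
      (∀ j (h : j < as.length), ∀ d', (f (i + j)).lift 0 d' = (g as[j]).erase) ∧
      (∀ j (h : j < bs.length), ∀ d', (f (i + n + j)).lift 0 d' = (g bs[j]).erase) := by
    rintro as bs i n rfl h
    constructor
    · intro j hj d'
      rw [h j (by simp; omega), List.getElem_append_left hj]
    · intro j hj d'
      rw [add_assoc, h (as.length + j) (by simpa using hj),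
        List.getElem_append_right (Nat.le_add_right _ _)]
      simp
  refine LT.ind ?_ ?_ ?_ ?_ ?_ ?_ ?_ ?_
  · intros; rfl
  · intro o x d i hx h
    have hx : x < d + 1 := hx
    simp only [LT.subst, LT.erase, Tm.lsubst]
    by_cases hxd : x = d
    · subst hxd
      simp only [LT.occs, if_true] at h
      simpa using (h 0 (by simp) x).symm
    · rw [if_neg hxd, if_pos (by omega)]
      rfl
  · intro a T ih d i hT h
    simp only [LT.subst, LT.erase, Tm.lsubst, ih (d + 1) i hT.2.2.2 h]
  · intro a T B ih ihB d i hT h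
    obtain ⟨h1, h2⟩ := append (length_occs_of_ok.1 T (d + 1) hT.2.2.2.1 d) h
    simp only [LT.subst, LT.erase, Tm.lsubst, ih d i hT.2.2.2.1 h1, ihB d _ hT.2.2.2.2 h2]
  · intro o T ih d i hT h
    have hT : T.Ok G 0 := hT
    simp only [LT.subst, LT.erase]
    have h0 : ∀ k, T.erase.occ k = 0 := fun k => by
      rw [← length_occs_of_ok.1 T 0 hT k, occs_of_ok.1 T 0 hT k (Nat.zero_le _)]
      rfl
    rw [(lsubst_eq_ren f).1 _ _ _ (h0 d), ren_congr.1 _ _ (fun x => x)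
      (fun x hx => by simp [h0] at hx), ren_id.1]
  · intros; rfl
  · intros; rfl
  · intro T B ih ihB d i hT h
    obtain ⟨h1, h2⟩ := append (length_occs_of_ok.1 T (d + 1) hT.1 d) h
    simp only [LB.subst, LB.erase, Bag.lsubst, ih d i hT.1 h1, ihB d _ hT.2 h2]

/-! ### Firing a redex of labelled terms -/

/-- The element of the bag with the number `i`. -/
def LB.find (S : Vertex → ℕ) (B : LB) (i : ℕ) : Option LT :=
  B.toList.find? fun L => S L.root = i

/-- The replacement of the occurrence `o`, when the occurrences are `us`. -/
def LB.repl (S : Vertex → ℕ) (us : List Vertex) (B : LB) (o : Vertex) : LT :=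
  match B.find S (us.idxOf o) with
  | some L => .jump o L
  | none => .blocked o

/-- The labelled term obtained by replacing the variable `0` with the elements of the bag: the
`i`-th occurrence is replaced with the element of number `i`. -/
def LT.bind (S : Vertex → ℕ) (T : LT) (B : LB) : LT := T.subst (B.repl S (T.occs 0)) 0

theorem root_repl (S : Vertex → ℕ) (us : List Vertex) (B : LB) (o : Vertex) :
    (B.repl S us o).root = o := by
  unfold LB.repl
  split <;> rfl

theorem LB.mem_of_find {S : Vertex → ℕ} {B : LB} {i : ℕ} {L : LT} (h : B.find S i = some L) :
    L ∈ B.toList ∧ S L.root = i :=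
  ⟨List.mem_of_find?_eq_some h, by simpa using List.find?_some h⟩

theorem ok_repl {G : Graph} {S : Vertex → ℕ} {us : List Vertex} {B : LB} (hB : B.Ok G 0)
    (o : Vertex) (d : ℕ) : (B.repl S us o).Ok G d := by
  unfold LB.repl
  split
  · rename_i L hL
    exact LB.ok_iff.1 hB L (LB.mem_of_find hL).1
  · trivial

theorem ok_bind {G : Graph} {S : Vertex → ℕ} {T : LT} {B : LB} (hT : T.Ok G 1) (hB : B.Ok G 0) :
    (T.bind S B).Ok G 0 :=
  (ok_subst (root_repl S _ B) (ok_repl hB)).1 T 0 hT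

theorem root_bind (S : Vertex → ℕ) (T : LT) (B : LB) : (T.bind S B).root = T.root :=
  root_subst (root_repl S _ B) T 0

/-- The elements of the bag are numbered by `S` with the natural numbers less than their number. -/
def LB.Numbered (S : Vertex → ℕ) (B : LB) : Prop :=
  (B.roots.map S).Perm (List.range B.toList.length)

theorem LB.Numbered.find_root {S : Vertex → ℕ} {B : LB} (h : B.Numbered S) {L : LT}
    (hL : L ∈ B.toList) : B.find S (S L.root) = some L := by
  have hnd : (B.toList.map fun L => S L.root).Nodup := by
    have := h.nodup_iff.2 List.nodup_range
    rwa [LB.roots, List.map_map] at this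
  obtain ⟨L', hL'⟩ : ∃ L', B.find S (S L.root) = some L' :=
    Option.isSome_iff_exists.1 (List.find?_isSome.2 ⟨L, hL, by simp⟩)
  rw [hL']
  obtain ⟨h1, h2⟩ := LB.mem_of_find hL'
  exact congrArg some (List.inj_on_of_nodup_map hnd h1 hL h2)

theorem LB.Numbered.find_isSome {S : Vertex → ℕ} {B : LB} (h : B.Numbered S) {i : ℕ} :
    (B.find S i).isSome ↔ i < B.toList.length := by
  rw [← List.mem_range, ← h.mem_iff, LB.find, List.find?_isSome]
  simp [LB.roots]

/-- The tokens contributed by the element of number `i`. -/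
def LB.toksAt (S : Vertex → ℕ) (B : LB) (i : ℕ) : Multiset Tok :=
  match B.find S i with
  | some L => .rt L.root ::ₘ L.toks
  | none => 0

/-- The elements of the bag are listed again in the order of their numbers, which is the order in
which the occurrences request them. -/
theorem LB.Numbered.toks_eq {S : Vertex → ℕ} {B : LB} (h : B.Numbered S) :
    B.toks = ((List.range B.toList.length).map (B.toksAt S)).sum := by
  rw [LB.toks_eq, ← (h.map (B.toksAt S)).sum_eq, LB.roots, List.map_map, List.map_map]
  congr 1
  refine List.map_congr_left fun L hL => ?_
  simp [LB.toksAt, h.find_root hL]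

theorem mem_sum_of_mem {α : Type*} {l : List (Multiset α)} {m : Multiset α} (h : m ∈ l) {x : α}
    (hx : x ∈ m) : x ∈ l.sum := by
  induction l with
  | nil => simp at h
  | cons n l ih =>
    rw [List.sum_cons, Multiset.mem_add]
    obtain rfl | h := List.mem_cons.1 h
    · exact .inl hx
    · exact .inr (ih h)

theorem map_idxOf_eq_range {us : List Vertex} (h : us.Nodup) :
    us.map us.idxOf = List.range us.length := by
  refine List.ext_getElem (by simp) fun i h1 h2 => ?_
  simp only [List.getElem_map, List.getElem_range]
  exact h.idxOf_getElem _ _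

theorem sum_map_range_split (f : ℕ → Multiset Tok) {m n : ℕ} (h : m ≤ n) :
    ((List.range n).map f).sum =
      ((List.range m).map f).sum + ((List.range (n - m)).map fun i => f (m + i)).sum := by
  obtain ⟨k, rfl⟩ := Nat.exists_eq_add_of_le h
  rw [List.range_add]
  simp [Function.comp_def]

/-- Firing a redex loses tokens, and loses none if and only if the number of occurrences is the
number of elements of the bag. -/
theorem toks_bind {S : Vertex → ℕ} {T : LT} {B : LB} (hB : B.Numbered S) (hT : T.toks.Nodup) :
    ∃ lost : Multiset Tok, (T.bind S B).toks + lost = T.toks + B.toks ∧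
      ((T.occs 0).length = B.toList.length → lost = 0) ∧
      ((T.occs 0).length ≠ B.toList.length → ∃ x ∈ lost, ∀ a, x ≠ .node a) := by
  set us := T.occs 0 with hus
  have hnd : us.Nodup := nodup_occs hT 0
  -- The tokens of the occurrences for which the bag has no element: they become blocked and their
  -- tokens disappear.
  set X : Multiset Tok :=
    (us.map fun o => if us.idxOf o < B.toList.length then 0 else {Tok.occ o}).sum with hX
  have h1 : (us.map fun o => (B.repl S us o).toks).sum + X =
      (us.map fun o => {Tok.occ o}).sum + ((List.range us.length).map (B.toksAt S)).sum := by
    rw [← map_idxOf_eq_range hnd, List.map_map, hX, ← List.sum_map_add, ← List.sum_map_add]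
    congr 1
    refine List.map_congr_left fun o ho => ?_
    simp only [LB.repl, LB.toksAt, Function.comp]
    have := hB.find_isSome (i := us.idxOf o)
    cases hf : B.find S (us.idxOf o) with
    | none => simp_all [LT.toks]
    | some L =>
      rw [hf] at this
      simp only [Option.isSome_some, true_iff] at this
      simp [this, LT.toks, Multiset.cons_swap (Tok.occ o)]
  have h2 := (toks_subst (root_repl S us B)).1 T 0
  have h3 : (T.bind S B).toks + X = T.toks + ((List.range us.length).map (B.toksAt S)).sum := by
    have h4 : (T.bind S B).toks + X + (us.map fun o => {Tok.occ o}).sum =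
        T.toks + ((List.range us.length).map (B.toksAt S)).sum +
          (us.map fun o => {Tok.occ o}).sum := by
      rw [add_right_comm, LT.bind, h2, add_assoc, h1]
      abel
    exact add_right_cancel h4
  have hzero : ∀ i, B.toList.length ≤ i → B.toksAt S i = 0 := by
    intro i hi
    have := hB.find_isSome (i := i)
    unfold LB.toksAt
    cases hf : B.find S i with
    | none => rfl
    | some L =>
      rw [hf] at this
      simp at this
      omega
  by_cases hmn : us.length ≤ B.toList.length
  · refine ⟨X + ((List.range (B.toList.length - us.length)).map
      fun i => B.toksAt S (us.length + i)).sum, ?_, ?_, ?_⟩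
    · rw [← add_assoc, h3, add_assoc, ← sum_map_range_split _ hmn, ← hB.toks_eq]
    · intro h
      rw [h, Nat.sub_self]
      have : X = 0 := by
        refine List.sum_eq_zero fun x hx => ?_
        obtain ⟨o, ho, rfl⟩ := List.mem_map.1 hx
        have := List.idxOf_lt_length_of_mem ho
        simp [← h, this]
      simp [this]
    · intro h
      have hlt : us.length < B.toList.length := lt_of_le_of_ne hmn h
      obtain ⟨L, hL⟩ := Option.isSome_iff_exists.1 (hB.find_isSome.2 hlt)
      -- With too many arguments, the element whose number is the number of occurrences is inserted
      -- nowhere, and the token of its root is lost.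
      refine ⟨.rt L.root, ?_, by simp⟩
      obtain ⟨k, hk⟩ : ∃ k, B.toList.length - us.length = k + 1 := 
        Nat.exists_eq_add_of_lt (Nat.sub_pos_of_lt hlt) |>.imp fun _ h => by omega
      rw [hk, List.range_succ_eq_map]
      simp [LB.toksAt, hL]
  · refine ⟨X, ?_, fun h => absurd h.le hmn, fun _ => ?_⟩
    · rw [h3, hB.toks_eq, sum_map_range_split _ (le_of_not_ge hmn)]
      congr 1
      refine (add_eq_left.2 ?_)
      refine List.sum_eq_zero fun x hx => ?_
      obtain ⟨i, hi, rfl⟩ := List.mem_map.1 hx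
      exact hzero _ (by omega)
    · push Not at hmn
      -- With too few arguments, the first occurrence beyond the numbers of the bag is blocked, and
      -- its token is lost.
      refine ⟨.occ us[B.toList.length], ?_, by simp⟩
      refine mem_sum_of_mem (List.mem_map_of_mem (List.getElem_mem hmn)) ?_
      rw [hnd.idxOf_getElem]
      simp

theorem erase_bind {G : Graph} {S : Vertex → ℕ} {T : LT} {B : LB} (hT : T.Ok G 1) (hB : B.Ok G 0)
    (hnd : (T.occs 0).Nodup) (hlen : (T.occs 0).length = B.toList.length)
    (hS : B.Numbered S) {f : ℕ → Tm}
    (hf : ∀ j L, B.find S j = some L → f j = L.erase) :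
    (T.bind S B).erase = T.erase.lsubst f 0 0 := by
  refine erase_subst.1 T 0 0 hT fun j hj d' => ?_
  have h1 := hS.find_isSome.2 (hlen ▸ hj)
  obtain ⟨L, hL⟩ := Option.isSome_iff_exists.1 h1
  rw [zero_add, hf j L hL, LB.repl, hnd.idxOf_getElem, hL,
    lift_erase (LB.ok_iff.1 hB L (LB.mem_of_find hL).1)]
  rfl


/-! ### Successful evaluations -/

/-- The head reduction of the labelled term `T`, applied to the bags `F`, that follows the
numbering `S` ends with `⋆`, and never fires a redex with the wrong number of elements. -/
inductive Good (S : Vertex → ℕ) : LT → List (Vertex × LB) → Prop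
  | star (a : Vertex) : Good S (.star a) []
  | app {a : Vertex} {T : LT} {B : LB} {F : List (Vertex × LB)} :
      Good S T ((a, B) :: F) → Good S (.app a T B) F
  | lam {l a : Vertex} {T : LT} {B : LB} {F : List (Vertex × LB)} :
      (T.occs 0).length = B.toList.length → Good S (T.bind S B) F →
      Good S (.lam l T) ((a, B) :: F)
  | jump {o : Vertex} {T : LT} {F : List (Vertex × LB)} : Good S T F → Good S (.jump o T) F

/-- The tokens of a labelled term applied to bags. -/
def stToks (T : LT) (F : List (Vertex × LB)) : Multiset Tok :=
  T.toks + (F.map fun p => .node (1 :: p.1) ::ₘ p.2.toks).sum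

/-- A measure that decreases along the head reduction. -/
def stSize (T : LT) (F : List (Vertex × LB)) : ℕ :=
  2 * T.toks.card + (F.map fun p => 2 * p.2.toks.card + 1).sum

/-- The labels of the bags match the links of the net. -/
def FramesOk (G : Graph) (F : List (Vertex × LB)) : Prop :=
  ∀ p ∈ F, .nimp (1 :: p.1) p.1 (0 :: p.1) ∈ G.links ∧ .oc p.2.roots (1 :: p.1) ∈ G.links ∧
    p.2.Ok G 0

theorem stToks_app (a : Vertex) (T : LT) (B : LB) (F : List (Vertex × LB)) :
    stToks (.app a T B) F = stToks T ((a, B) :: F) := by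
  simp only [stToks, LT.toks, List.map_cons, List.sum_cons, ← Multiset.singleton_add]
  abel

/-- A token counts twice and a pending bag once. Turning an application into a pending bag removes
the token of its node and adds a bag, so the measure drops by one; firing the redex later removes
that remaining unit. -/
theorem stSize_app_lt (a : Vertex) (T : LT) (B : LB) (F : List (Vertex × LB)) :
    stSize T ((a, B) :: F) < stSize (.app a T B) F := by
  simp only [stSize, LT.toks, List.map_cons, List.sum_cons, Multiset.card_cons,
    Multiset.card_add]
  omega

theorem stToks_jump (o : Vertex) (T : LT) (F : List (Vertex × LB)) :
    stToks (.jump o T) F = .occ o ::ₘ .rt T.root ::ₘ stToks T F := by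
  simp [stToks, LT.toks]

theorem stSize_jump_lt (o : Vertex) (T : LT) (F : List (Vertex × LB)) :
    stSize T F < stSize (.jump o T) F := by
  simp only [stSize, LT.toks, Multiset.card_cons]
  omega

theorem numbered_of_ok {G : Graph} {S : Vertex → ℕ} (hS : IsNumbering G S) {B : LB} {w : Vertex}
    (h : .oc B.roots w ∈ G.links) : B.Numbered S := by
  have := hS _ _ h
  rwa [LB.roots, List.length_map] at this

/-- The token of the node of the bag is used up by the firing. As tokens are distinct, the
permutation of each `!`-link is consulted in one firing only. -/
theorem stToks_bind {S : Vertex → ℕ} {l a : Vertex} {T : LT} {B : LB} {F : List (Vertex × LB)}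
    (hB : B.Numbered S) (hnd : (stToks (.lam l T) ((a, B) :: F)).Nodup) :
    ∃ lost : Multiset Tok,
      stToks (.lam l T) ((a, B) :: F) = .node (1 :: a) ::ₘ (stToks (T.bind S B) F + lost) ∧
      ((T.occs 0).length = B.toList.length → lost = 0) ∧
      ((T.occs 0).length ≠ B.toList.length → ∃ x ∈ lost, ∀ a, x ≠ .node a) := by
  have hT : T.toks.Nodup := Multiset.nodup_of_le (Multiset.le_add_right _ _) hnd
  obtain ⟨lost, h1, h2, h3⟩ := toks_bind hB hT
  refine ⟨lost, ?_, h2, h3⟩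
  simp only [stToks, LT.toks, List.map_cons, List.sum_cons, ← Multiset.singleton_add]
  calc _ = (T.toks + B.toks) + ({Tok.node (1 :: a)} +
        (F.map fun p => {Tok.node (1 :: p.1)} + p.2.toks).sum) := by abel
    _ = _ := by rw [← h1]; abel

theorem stSize_bind_lt {S : Vertex → ℕ} {l a : Vertex} {T : LT} {B : LB}
    {F : List (Vertex × LB)} (hB : B.Numbered S) (hT : T.toks.Nodup) :
    stSize (T.bind S B) F < stSize (.lam l T) ((a, B) :: F) := by
  obtain ⟨lost, h1, -⟩ := toks_bind hB hT
  have := congrArg Multiset.card h1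
  simp only [Multiset.card_add] at this
  simp only [stSize, LT.toks, List.map_cons, List.sum_cons]
  omega

theorem bind_congr {S S' : Vertex → ℕ} {T : LT} {B : LB} (h : ∀ u ∈ B.roots, S u = S' u) :
    T.bind S B = T.bind S' B := by
  have : ∀ i, B.find S i = B.find S' i := by
    intro i
    unfold LB.find
    have h' : ∀ L ∈ B.toList, S L.root = S' L.root := fun L hL => h _ (List.mem_map_of_mem hL)
    generalize B.toList = Ls at h'
    induction Ls with
    | nil => rfl
    | cons L Ls ih =>
      simp only [List.find?_cons, h' L (by simp), ih fun L hL => h' L (by simp [hL])]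
  unfold LT.bind
  congr 1
  funext o
  simp only [LB.repl, this]

theorem betaReduct_of_length {s : Tm} {ts : List Tm} {n : ℕ} (h : ts.length = n)
    (hn : n = s.occ 0) : betaReduct s ts =
      (Finset.univ : Finset (Equiv.Perm (Fin n))).val.map fun σ =>
        s.lsubst (fun j => if h' : j < n then ts[(σ.symm ⟨j, h'⟩).1]'(by omega) else .star) 0 0 := by
  subst h
  rw [betaReduct, if_pos hn]
  rfl

/-- The number of resource permutations that give a successful evaluation. -/
theorem card_good {G : Graph} (hG : G.Tidy) (σ₀ : G.ResPerm) (T : LT) (F : List (Vertex × LB))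
    (hT : T.Ok G 0) (hF : FramesOk G F) (hnd : (stToks T F).Nodup) :
    open Classical in
    (((Finset.univ.filter fun σ : G.ResPerm =>
      (∀ r, Tok.node r.1.concl ∉ stToks T F → σ r = σ₀ r) ∧
        Good (numbering G σ) T F).card : ℕ) : ℝ≥0∞) =
      count T.erase (F.map fun p => p.2.erase) := by
  classical
  induction hn : stSize T F using Nat.strong_induction_on generalizing σ₀ T F with
  | _ n ih =>
  subst hn
  have empty : (∀ σ, ¬ Good (numbering G σ) T F) → count T.erase (F.map fun p => p.2.erase) = 0 →
      (((Finset.univ.filter fun σ : G.ResPerm =>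
        (∀ r, Tok.node r.1.concl ∉ stToks T F → σ r = σ₀ r) ∧
          Good (numbering G σ) T F).card : ℕ) : ℝ≥0∞) =
        count T.erase (F.map fun p => p.2.erase) := by
    intro h h'
    rw [h', Finset.card_eq_zero.2 (Finset.filter_eq_empty_iff.2 fun σ _ hσ => h σ hσ.2)]
    simp
  cases T with
  | star a =>
    cases F with
    | nil =>
      -- No token is left, so all the permutations are prescribed by `σ₀` and exactly one assignment
      -- is counted, as against the single head reduction of `⋆` in zero steps.
      have : (Finset.univ.filter fun σ : G.ResPerm =>
          (∀ r, Tok.node r.1.concl ∉ stToks (.star a) [] → σ r = σ₀ r) ∧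
            Good (numbering G σ) (.star a) []) = {σ₀} := by
        ext σ
        simp only [Finset.mem_filter, Finset.mem_univ, true_and, Finset.mem_singleton]
        constructor
        · rintro ⟨h, -⟩
          funext r
          exact h r (by simp [stToks, LT.toks])
        · rintro rfl
          exact ⟨fun _ _ => rfl, .star a⟩
      rw [this]
      simp [LT.erase, count_star_nil]
    | cons p F =>
      refine empty (fun σ h => by cases h) ?_
      simp [LT.erase, count, headCount_star_cons]
  | var o k => exact absurd hT (Nat.not_lt_zero k)
  | blocked o =>
    refine empty (fun σ h => by cases h) ?_
    rw [LT.erase, count_app]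
    simp [count, headCount_star_cons]
  | jump o T =>
    rw [LT.erase, ← ih _ (stSize_jump_lt o T F) σ₀ T F hT hF
      (by rw [stToks_jump] at hnd; exact (Multiset.nodup_cons.1 (Multiset.nodup_cons.1 hnd).2).2)
      rfl]
    congr 2
    ext σ
    simp only [Finset.mem_filter, Finset.mem_univ, true_and, stToks_jump, Multiset.mem_cons,
      reduceCtorEq, false_or]
    refine and_congr_right fun _ => ⟨fun h => ?_, .jump⟩
    cases h
    assumption
  | app a T B =>
    have h1 := ih _ (stSize_app_lt a T B F) σ₀ T ((a, B) :: F) hT.2.2.2.1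
      (by
        intro p hp
        obtain rfl | hp := List.mem_cons.1 hp
        · exact ⟨hT.1, hT.2.1, hT.2.2.2.2⟩
        · exact hF p hp)
      (by rwa [stToks_app] at hnd) rfl
    rw [LT.erase, count_app, ← List.map_cons (f := fun p : Vertex × LB => p.2.erase)
      (a := (a, B)), ← h1]
    congr 2
    ext σ
    simp only [Finset.mem_filter, Finset.mem_univ, true_and, stToks_app]
    refine and_congr_right fun _ => ⟨fun h => ?_, .app⟩
    cases h
    assumption
  | lam l T =>
    cases F with
    | nil =>
      refine empty (fun σ h => by cases h) ?_
      simp [LT.erase, count, headCount_lam_nil]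
    | cons p F =>
      obtain ⟨a, B⟩ := p
      obtain ⟨-, hoc, hB⟩ := hF _ List.mem_cons_self
      have hF' : FramesOk G F := fun p hp => hF p (List.mem_cons_of_mem _ hp)
      have hT1 : T.Ok G 1 := hT.2.2.2
      have hTnd : T.toks.Nodup := Multiset.nodup_of_le (Multiset.le_add_right _ _) hnd
      have hlenB : B.erase.toList.length = B.toList.length := by
        rw [LB.erase_toList, List.length_map]
      rw [List.map_cons, LT.erase, count_lam_cons, ← betaReduct_toList]
      by_cases hlen : (T.occs 0).length = B.toList.length
      swap
      -- With the wrong number of arguments the reduct is `0` and no evaluation is successful.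
      · have hne : ¬ B.erase.toList.length = T.erase.occ 0 := by
          rw [hlenB, ← length_occs_of_ok.1 T 1 hT1 0]
          exact Ne.symm hlen
        rw [betaReduct, if_neg hne, Finset.card_eq_zero.2]
        · simp
        · refine Finset.filter_eq_empty_iff.2 fun σ _ hσ => ?_
          cases hσ.2 with
          | lam h => exact hlen h
      let r₀ : {l : Link // l ∈ G.ocLinks} := ⟨.oc B.roots (1 :: a), mem_ocLinks.2 ⟨_, _, rfl, hoc⟩⟩
      have hr₀ : ∀ r : {l : Link // l ∈ G.ocLinks}, r.1.concl = 1 :: a → r = r₀ := by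
        intro r hr
        obtain ⟨us, w, h1, h2⟩ := mem_ocLinks.1 r.2
        obtain rfl : w = 1 :: a := by rw [h1] at hr; exact hr
        refine Subtype.ext ?_
        rw [h1, hG.oc_unique _ _ _ h2 hoc]
      have hn₀ : r₀.1.premises.length = B.toList.length := List.length_map _
      rw [betaReduct_of_length (n := r₀.1.premises.length) (by rw [hlenB, hn₀])
        (by rw [hn₀, ← hlen, length_occs_of_ok.1 T 1 hT1 0])]
      -- The assignments are split according to the permutation `τ` at the `!`-link of the fired
      -- redex, and the addends of the reduct are indexed by the same `τ`.
      rw [Multiset.map_map, Finset.card_eq_sum_card_fiberwise (f := fun σ : G.ResPerm => σ r₀)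
        (t := Finset.univ) (fun _ _ => Finset.mem_coe.2 (Finset.mem_univ _)), Nat.cast_sum]
      change _ = Finset.sum _ _
      refine Finset.sum_congr rfl fun τ _ => ?_
      -- After the firing, the node of this link is no longer a token, so the value `τ` becomes part
      -- of the prescribed data.
      set σ₁ : G.ResPerm := Function.update σ₀ r₀ τ with hσ₁
      have hσ₁r : σ₁ r₀ = τ := Function.update_self _ _ _
      have hBn := numbered_of_ok (isNumbering_numbering hG σ₁) hoc
      obtain ⟨lost, h1, h2, -⟩ := stToks_bind (F := F) hBn hnd
      rw [h2 hlen, add_zero] at h1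
      rw [h1] at hnd
      obtain ⟨hnd1, hnd2⟩ := Multiset.nodup_cons.1 hnd
      have key := ih _ (stSize_bind_lt (l := l) (a := a) (F := F) hBn hTnd) σ₁
        (T.bind (numbering G σ₁) B) F (ok_bind hT1 hB) hF' hnd2 rfl
      have herase : (T.bind (numbering G σ₁) B).erase = T.erase.lsubst (fun j =>
          if h' : j < r₀.1.premises.length then
            B.erase.toList[(τ.symm ⟨j, h'⟩).1]'(by
              rw [hlenB, ← hn₀]; exact (τ.symm ⟨j, h'⟩).2) else .star) 0 0 := by
        -- The element at position `i` has the number `τ i`, so the `j`-th occurrence receives the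
        -- element at position `τ.symm j`, as in `betaReduct`.
        refine erase_bind hT1 hB (nodup_occs hTnd 0) hlen hBn fun j L hL => ?_
        obtain ⟨hLm, hLj⟩ := LB.mem_of_find hL
        obtain ⟨i, hi, rfl⟩ := List.getElem_of_mem hLm
        have hi' : i < r₀.1.premises.length := by rw [hn₀]; exact hi
        have h3 := numbering_getElem hG σ₁ r₀ ⟨i, hi'⟩
        have h4 : r₀.1.premises[i] = B.toList[i].root := List.getElem_map _
        rw [hσ₁r] at h3
        change numbering G σ₁ r₀.1.premises[i] = _ at h3
        rw [h4, hLj] at h3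
        subst h3
        rw [dif_pos (τ ⟨i, hi'⟩).2]
        simp [LB.erase_toList]
      rw [herase] at key
      refine Eq.trans ?_ key
      congr 2
      ext σ
      simp only [Finset.mem_filter, Finset.mem_univ, true_and]
      -- The firing depends only on the numbers of the elements of this bag, which are the premises
      -- of `r₀`.
      have hcongr : σ r₀ = τ → T.bind (numbering G σ) B = T.bind (numbering G σ₁) B := by
        intro hσ
        refine bind_congr fun u hu => ?_
        rw [numbering_eq hG σ r₀ hu, numbering_eq hG σ₁ r₀ hu, hσ, hσ₁r]
      constructor
      · rintro ⟨⟨h3, h4⟩, h5⟩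
        refine ⟨fun r hr => ?_, ?_⟩
        · by_cases hrr : r = r₀
          · subst hrr
            rw [hσ₁r, h5]
          · rw [hσ₁, Function.update_of_ne hrr]
            refine h3 r ?_
            rw [h1, Multiset.mem_cons, not_or]
            refine ⟨fun h => hrr (hr₀ r (Tok.node.inj h)), hr⟩
        · rw [← hcongr h5]
          cases h4
          assumption
      · rintro ⟨h3, h4⟩
        have h5 : σ r₀ = τ := by
          rw [h3 r₀ hnd1, hσ₁r]
        refine ⟨⟨fun r hr => ?_, .lam hlen ?_⟩, h5⟩
        · rw [h1, Multiset.mem_cons, not_or] at hr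
          rw [h3 r hr.2, hσ₁, Function.update_of_ne]
          rintro rfl
          exact hr.1 rfl
        · rw [hcongr h5]
          exact h4


/-! ### The run of a labelled term -/

/-- Runs with empty stacks between vertices of the same type, both linked forwards. -/
def Neutral (G : Graph) (S : Vertex → ℕ) (τ : Vertex → Formula) (u : Vertex) (es : List Cr)
    (v : Vertex) : Prop :=
  Seg G S u [] true es v [] true ∧ τ u = τ v

/-- The run gets stuck at a `!`-link none of whose premises has the number requested. -/
def StuckRun (G : Graph) (S : Vertex → ℕ) (u : Vertex) : Prop :=
  ∃ es us w j s, .oc us w ∈ G.links ∧ Seg G S u [] true es w (.e j :: s) true ∧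
    ∀ v ∈ us, S v ≠ j

mutual
  /-- Every replaced occurrence is linked to its replacement by a run, and every blocked occurrence
  starts a stuck run. The runs cross only tokens in `V`, besides those of the occurrence. -/
  def LT.Linked (G : Graph) (S : Vertex → ℕ) (τ : Vertex → Formula) (V : Tok → Prop) : LT → Prop
    | .star _ => True
    | .var _ _ => True
    | .lam _ T => T.Linked G S τ V
    | .app _ T B => T.Linked G S τ V ∧ B.Linked G S τ V
    | .jump o T => T.Linked G S τ V ∧ ∃ J, Neutral G S τ o J T.root ∧
        (∀ x ∈ crossed J, x = .occ o ∨ x = .rt T.root ∨ V x) ∧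
        .occ o ∈ crossed J ∧ .rt T.root ∈ crossed J ∧
        ∀ us w u, .up (.oc us w) u ∈ J → V (.rt u)
    | .blocked o => StuckRun G S o
  def LB.Linked (G : Graph) (S : Vertex → ℕ) (τ : Vertex → Formula) (V : Tok → Prop) : LB → Prop
    | .nil => True
    | .cons T B => T.Linked G S τ V ∧ B.Linked G S τ V
end

section

variable {G : Graph} {S : Vertex → ℕ} {τ : Vertex → Formula}

theorem linked_mono {V V' : Tok → Prop} (h : ∀ x, V x → V' x) :
    (∀ T : LT, T.Linked G S τ V → T.Linked G S τ V') ∧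
    (∀ B : LB, B.Linked G S τ V → B.Linked G S τ V') := by
  refine LT.ind ?_ ?_ ?_ ?_ ?_ ?_ ?_ ?_
  · intros; trivial
  · intros; trivial
  · intro a T ih hT
    exact ih hT
  · intro a T B ih ihB hT
    exact ⟨ih hT.1, ihB hT.2⟩
  · rintro o T ih ⟨hT, J, h1, h2, h3, h4, h5⟩
    exact ⟨ih hT, J, h1, fun x hx => (h2 x hx).imp_right (Or.imp_right (h x)), h3, h4,
      fun us w u hu => h _ (h5 us w u hu)⟩
  · intro o h
    exact h
  · intros; trivial
  · intro T B ih ihB hT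
    exact ⟨ih hT.1, ihB hT.2⟩

theorem LB.linked_iff {V : Tok → Prop} {B : LB} :
    B.Linked G S τ V ↔ ∀ L ∈ B.toList, L.Linked G S τ V := by
  induction B using LB.rec (motive_1 := fun _ => True) <;>
    simp_all [LB.Linked, LB.toList]

theorem linked_subst {V : Tok → Prop} {g : Vertex → LT} :
    (∀ (T : LT) (d : ℕ), T.Linked G S τ V → (∀ o ∈ T.occs d, (g o).Linked G S τ V) →
      (T.subst g d).Linked G S τ V) ∧
    (∀ (B : LB) (d : ℕ), B.Linked G S τ V → (∀ o ∈ B.occs d, (g o).Linked G S τ V) →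
      (B.subst g d).Linked G S τ V) := by
  refine LT.ind ?_ ?_ ?_ ?_ ?_ ?_ ?_ ?_
  · intros; trivial
  · intro o x d _ h
    simp only [LT.subst]
    split_ifs with hx
    · exact h o (by simp [LT.occs, hx])
    · trivial
  · intro a T ih d hT h
    exact ih _ hT h
  · intro a T B ih ihB d hT h
    exact ⟨ih d hT.1 fun o ho => h o (by simp [LT.occs, ho]),
      ihB d hT.2 fun o ho => h o (by simp [LT.occs, ho])⟩
  · intro o T _ d hT _
    exact hT
  · intro o d h _
    exact h
  · intros; trivial
  · intro T B ih ihB d hT h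
    exact ⟨ih d hT.1 fun o ho => h o (by simp [LB.occs, ho]),
      ihB d hT.2 fun o ho => h o (by simp [LB.occs, ho])⟩

/-- `es` is a run from `a₀` to `v`, made of neutral runs between the functions of the applications
of the bags `F`. -/
inductive Hist (G : Graph) (S : Vertex → ℕ) (τ : Vertex → Formula) (a₀ : Vertex) :
    Vertex → List (Vertex × LB) → List Cr → Prop
  | nil {v : Vertex} {es : List Cr} : Neutral G S τ a₀ es v → Hist G S τ a₀ v [] es
  | cons {a v : Vertex} {B : LB} {F : List (Vertex × LB)} {es es' : List Cr} :
      Hist G S τ a₀ a F es → .nimp (1 :: a) a (0 :: a) ∈ G.links →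
      Neutral G S τ (0 :: a) es' v →
      Hist G S τ a₀ v ((a, B) :: F) (es ++ .up (.nimp (1 :: a) a (0 :: a)) a :: es')

theorem sym_nimp (a : Vertex) : (Link.nimp (1 :: a) a (0 :: a)).sym S a = .q :=
  if_neg fun h => cons_ne_self' _ _ h.symm

theorem seg_nimp {a : Vertex} (h : .nimp (1 :: a) a (0 :: a) ∈ G.links) (s : List Sym) :
    Seg G S a s true [.up (.nimp (1 :: a) a (0 :: a)) a] (0 :: a) (.q :: s) true := by
  have := Seg.single_up (S := S) (u := a) s (d := true) (d' := true) h (by simp [Link.premises])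
    (by simp [Link.Pol, Link.outs]) (by simp [Link.Pol, Link.ins, Link.concl])
  rwa [sym_nimp] at this

theorem seg_imp {l : Vertex} (h : .imp (1 :: l) (0 :: l) l ∈ G.links) (s : List Sym) :
    Seg G S l (.q :: s) true [.dn (.imp (1 :: l) (0 :: l) l) (0 :: l)] (0 :: l) s true := by
  have := Seg.single_dn (S := S) (u := 0 :: l) s (d := true) (d' := true) h
    (by simp [Link.premises]) (by simp [Link.Pol, Link.outs, Link.concl])
    (by simp [Link.Pol, Link.ins])
  simpa [Link.sym, Link.concl] using this

theorem Hist.seg {a₀ v : Vertex} {F : List (Vertex × LB)} {es : List Cr}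
    (h : Hist G S τ a₀ v F es) :
    Seg G S a₀ [] true es v (List.replicate F.length .q) true := by
  induction h with
  | nil h => exact h.1
  | cons _ h1 h2 ih =>
    exact ih.append ((seg_nimp h1 _).append (h2.1.frame _))

theorem Hist.extend {a₀ v w : Vertex} {F : List (Vertex × LB)} {es es' : List Cr}
    (h : Hist G S τ a₀ v F es) (h' : Neutral G S τ v es' w) : Hist G S τ a₀ w F (es ++ es') := by
  cases h with
  | nil h => exact .nil ⟨h.1.append h'.1, h.2.trans h'.2⟩
  | cons h0 h1 h2 =>
    rw [List.append_assoc]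
    exact .cons h0 h1 ⟨h2.1.append h'.1, h2.2.trans h'.2⟩

/-- The symbol `q` pushed at the application is popped at the abstraction, so the pending bag
disappears from the stack. The types of the function at both ends are the same arrow type, hence so
are their targets, and the composite run is neutral. -/
theorem Hist.bind (hτ : ∀ l ∈ G.links, l.Typed τ) {a₀ a l : Vertex} {B : LB}
    {F : List (Vertex × LB)} {es : List Cr} (h : Hist G S τ a₀ l ((a, B) :: F) es)
    (hl : .imp (1 :: l) (0 :: l) l ∈ G.links) :
    Hist G S τ a₀ (0 :: l) F (es ++ [.dn (.imp (1 :: l) (0 :: l) l) (0 :: l)]) := by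
  cases h with
  | @cons _ _ _ _ es es' h0 h1 h2 =>
    rw [List.append_assoc, List.cons_append]
    refine h0.extend ⟨(seg_nimp h1 []).append ((h2.1.frame [.q]).append (seg_imp hl [])), ?_⟩
    obtain ⟨A, C, -, h4, h5⟩ := hτ _ h1
    obtain ⟨A', C', -, h7, h8⟩ := hτ _ hl
    rw [h2.2, h8] at h5
    cases h5
    rw [h4, h7]

/-- The run from an occurrence of a bound variable to the bag of its redex. -/
theorem seg_to_bag {a l o : Vertex} {us : List Vertex} {N : List Cr}
    (hN : Seg G S (0 :: a) [] true N l [] true) (h1 : .nimp (1 :: a) a (0 :: a) ∈ G.links)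
    (h2 : .imp (1 :: l) (0 :: l) l ∈ G.links) (h3 : .wn us (1 :: l) ∈ G.links) (ho : o ∈ us) :
    Seg G S o [] true (.up (.wn us (1 :: l)) o :: .up (.imp (1 :: l) (0 :: l) l) (1 :: l) ::
      (revE N ++ [.dn (.nimp (1 :: a) a (0 :: a)) (1 :: a)])) (1 :: a) [.e (us.idxOf o)] true := by
  refine .up (d₁ := true) h3 ho ho (by simp [Link.Pol, Link.ins, Link.concl]) ?_
  refine .up (u := 1 :: l) (d₁ := false) h2 (by simp [Link.premises])
    (by simp [Link.Pol, Link.outs]) (by simp [Link.Pol, Link.outs, Link.concl]) ?_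
  refine (hN.reverse.frame _).append ?_
  have := Seg.single_dn (S := S) (u := 1 :: a) [.e (us.idxOf o)] (d := false) (d' := true) h1
    (by simp [Link.premises]) (by simp [Link.Pol, Link.ins, Link.concl])
    (by simp [Link.Pol, Link.ins])
  simpa [Link.sym, Link.concl] using this

/-- From the occurrence the run climbs through the `?`-link and the abstraction, pushing its index
and `p`. It goes back along the history to the application of the fired redex and pops `p` there,
towards the bag. The index is then popped at the `!`-link if some element has that number, and
otherwise the run is stuck. -/
theorem linked_repl (hτ : ∀ l ∈ G.links, l.Typed τ) {a₀ a l : Vertex} {B : LB}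
    {F : List (Vertex × LB)} {es : List Cr} {V : Tok → Prop} {us : List Vertex}
    (h : Hist G S τ a₀ l ((a, B) :: F) es) (hV : ∀ x ∈ crossed es, V x)
    (hl : .imp (1 :: l) (0 :: l) l ∈ G.links) (hu : .wn us (1 :: l) ∈ G.links)
    (hoc : .oc B.roots (1 :: a) ∈ G.links) (hB : B.Linked G S τ V) {o : Vertex} (ho : o ∈ us) :
    (B.repl S us o).Linked G S τ V := by
  cases h with
  | @cons _ _ _ _ es es' h0 h1 h2 =>
    have hs := seg_to_bag h2.1 h1 hl hu ho
    unfold LB.repl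
    cases hf : B.find S (us.idxOf o) with
    | none =>
      refine ⟨_, _, _, _, _, hoc, hs, fun v hv heq => ?_⟩
      obtain ⟨L, hL, rfl⟩ := List.mem_map.1 hv
      have := List.find?_eq_none.1 hf L hL
      simp [heq] at this
    | some L =>
      obtain ⟨hL, hLi⟩ := LB.mem_of_find hf
      have hLr : L.root ∈ B.roots := List.mem_map_of_mem hL
      have hdn : Seg G S (1 :: a) [.e (us.idxOf o)] true [.dn (.oc B.roots (1 :: a)) L.root]
          L.root [] true := by
        have := Seg.single_dn (S := S) (u := L.root) [] (d := true) (d' := true) hoc hLr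
          (by simp [Link.Pol, Link.outs, Link.concl]) (by simpa [Link.Pol, Link.ins] using hLr)
        simpa [Link.sym, Link.concl, hLi] using this
      refine ⟨LB.linked_iff.1 hB L hL, _, ⟨hs.append hdn, ?_⟩, ?_, ?_, ?_, ?_⟩
      · obtain ⟨A, C, h3, h4, h5⟩ := hτ _ h1
        obtain ⟨A', C', h6, h7, h8⟩ := hτ _ hl
        obtain ⟨A'', h9, h10⟩ := hτ _ hu
        obtain ⟨A''', h11, h12⟩ := hτ _ hoc
        rw [h2.2, h8] at h5
        cases h5
        rw [h6] at h10
        cases h10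
        rw [h3] at h12
        cases h12
        rw [h9 o ho, h11 _ hLr]
      · intro x hx
        simp only [List.cons_append, crossed_cons, crossed_append, List.mem_append, Cr.toks,
          mem_crossed_revE, crossed_nil, List.mem_cons, List.not_mem_nil,
          or_false, List.nil_append, List.append_nil] at hx
        obtain hx | hx | hx := hx
        · exact .inl hx
        · exact .inr (.inr (hV x (by simp [hx])))
        · exact .inr (.inl hx)
      · simp [Cr.toks]
      · simp [Cr.toks]
      · intro us' w u hu'
        -- An upward crossing of a `!`-link can only come from the reversed part of the history,
        -- where the same premise was crossed downwards.
        have hm : .dn (.oc us' w) u ∈ es' := by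
          simp only [List.cons_append, List.mem_cons, List.mem_append, Cr.up.injEq, reduceCtorEq,
            false_and, false_or, List.not_mem_nil, or_false] at hu'
          simp only [revE, List.mem_reverse, List.mem_map] at hu'
          obtain ⟨c, hc, hcr⟩ := hu'
          rcases c with ⟨k, v⟩ | ⟨k, v⟩
          · cases hcr
          · cases hcr
            exact hc
        exact hV _ (by
          rw [crossed_append, crossed_cons, List.mem_append, List.mem_append]
          exact .inr (.inr (mem_crossed_iff.2 ⟨_, hm, by simp [Cr.toks]⟩)))

theorem linked_bind (hτ : ∀ l ∈ G.links, l.Typed τ) {a₀ a l : Vertex} {T : LT} {B : LB}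
    {F : List (Vertex × LB)} {es : List Cr} {V : Tok → Prop}
    (h : Hist G S τ a₀ l ((a, B) :: F) es) (hV : ∀ x ∈ crossed es, V x)
    (hl : .imp (1 :: l) (0 :: l) l ∈ G.links) (hu : .wn (T.occs 0) (1 :: l) ∈ G.links)
    (hoc : .oc B.roots (1 :: a) ∈ G.links) (hT : T.Linked G S τ V) (hB : B.Linked G S τ V) :
    (T.bind S B).Linked G S τ V :=
  linked_subst.1 T 0 hT fun _ ho => linked_repl hτ h hV hl hu hoc hB ho

/-- The run of a labelled term ends at a `⋆`-link or gets stuck, and it crosses all the tokens if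
and only if the evaluation is successful. -/
theorem exists_run (hS : IsNumbering G S) (hτ : ∀ l ∈ G.links, l.Typed τ) {a₀ : Vertex}
    (ha₀ : τ a₀ = .ty .star) (T : LT) (F : List (Vertex × LB)) (es : List Cr)
    (hT : T.Ok G 0) (hF : FramesOk G F) (hnd : (stToks T F).Nodup)
    (hTl : T.Linked G S τ (· ∈ crossed es)) (hFl : ∀ p ∈ F, p.2.Linked G S τ (· ∈ crossed es))
    (hist : Hist G S τ a₀ T.root F es) (hes : DownFirst es)
    (hdisj : ∀ x ∈ stToks T F, x ∉ crossed es) :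
    (∃ es' z, Seg G S a₀ [] true es' z [] true ∧ .star z ∈ G.links ∧ DownFirst es' ∧
      (∀ x ∈ crossed es, x ∈ crossed es') ∧
      (∀ x ∈ crossed es', x ∈ crossed es ∨ x ∈ stToks T F) ∧
      (Good S T F → ∀ x ∈ stToks T F, (∀ a, x ≠ .node a) → x ∈ crossed es') ∧
      (¬ Good S T F → ∃ x ∈ stToks T F, (∀ a, x ≠ .node a) ∧ x ∉ crossed es')) ∨
    (¬ Good S T F ∧ StuckRun G S a₀) := by
  induction hn : stSize T F using Nat.strong_induction_on generalizing T F es with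
  | _ n ih =>
  subst hn
  cases T with
  | var o k => exact absurd hT (Nat.not_lt_zero k)
  | star z =>
    cases F with
    | nil =>
      refine .inl ⟨es, z, hist.seg, hT, hes, fun x hx => hx, fun x hx => .inl hx, ?_,
        fun h => absurd (.star z) h⟩
      intro _ x hx
      simp [stToks, LT.toks] at hx
    | cons p F =>
      cases hist with
      | cons _ h1 h2 =>
        -- Excluded by typing: a neutral run keeps the type, and the function of a pending
        -- application has an arrow type, not `⋆`.
        obtain ⟨A, C, -, -, h5⟩ := hτ _ h1
        have h6 : τ z = .ty .star := hτ _ hT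
        rw [h2.2] at h5
        cases h5.symm.trans h6
  | blocked o =>
    refine .inr ⟨fun h => (by cases h), ?_⟩
    have h : StuckRun G S o := hTl
    obtain ⟨J, us, w, j, s, h1, h2, h3⟩ := h
    -- The stuck run of the occurrence is prolonged backwards by the history, whose stack lies below
    -- and is never touched.
    exact ⟨_, us, w, j, _, h1, hist.seg.append (h2.frame _), h3⟩
  | jump o T =>
    obtain ⟨hTl, J, hJ, hJx, hJo, hJr, hJup⟩ := hTl
    rw [stToks_jump] at hnd hdisj
    have hnd' := Multiset.nodup_cons.1 hnd
    have hnd'' := Multiset.nodup_cons.1 hnd'.2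
    have hgood : Good S (.jump o T) F ↔ Good S T F := by
      refine ⟨fun h => ?_, .jump⟩
      cases h
      assumption
    have hsub : ∀ x, x ∈ crossed es → x ∈ crossed (es ++ J) := fun x hx => by simp [hx]
    have key := ih _ (stSize_jump_lt o T F) T F (es ++ J) hT hF hnd''.2
      ((linked_mono hsub).1 T hTl) (fun p hp => (linked_mono hsub).2 _ (hFl p hp))
      (hist.extend hJ) (hes.append hJup)
      (by
        intro x hx
        rw [crossed_append, List.mem_append, not_or]
        -- The run of the jump crosses only its own two tokens, which occur once, and tokens that
        -- were already crossed: the tokens still to come stay uncrossed.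
        refine ⟨hdisj x (by simp [hx]), fun hxJ => ?_⟩
        obtain rfl | rfl | h := hJx x hxJ
        · exact hnd'.1 (by simp [hx])
        · exact hnd''.1 hx
        · exact hdisj x (by simp [hx]) h)
      rfl
    rw [hgood, stToks_jump]
    obtain ⟨es', z, h1, h2, h3, h4, h5, h6, h7⟩ | h := key
    · refine .inl ⟨es', z, h1, h2, h3, fun x hx => h4 x (hsub x hx), ?_, ?_, ?_⟩
      · intro x hx
        obtain h | h := h5 x hx
        · rw [crossed_append, List.mem_append] at h
          obtain h | h := h
          · exact .inl h
          · obtain rfl | rfl | h := hJx x h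
            · simp
            · simp
            · exact .inl h
        · simp [h]
      · intro hg x hx hxn
        rw [Multiset.mem_cons, Multiset.mem_cons] at hx
        obtain rfl | rfl | hx := hx
        · exact h4 _ (by simp [hJo])
        · exact h4 _ (by simp [hJr])
        · exact h6 hg x hx hxn
      · intro hg
        obtain ⟨x, hx, h⟩ := h7 hg
        exact ⟨x, by simp [hx], h⟩
    · exact .inr h
  | app a T B =>
    have hgood : Good S (.app a T B) F ↔ Good S T ((a, B) :: F) := by
      refine ⟨fun h => ?_, .app⟩
      cases h
      assumption
    rw [stToks_app] at hnd hdisj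
    rw [hgood, stToks_app]
    have hcr : crossed (es ++ [.up (.nimp (1 :: a) a (0 :: a)) a]) = crossed es := by
      simp [Cr.toks]
    have hroot : T.root = 0 :: a := hT.2.2.1
    have key := ih _ (stSize_app_lt a T B F) T ((a, B) :: F)
      (es ++ [.up (.nimp (1 :: a) a (0 :: a)) a]) hT.2.2.2.1
      (by
        intro p hp
        obtain rfl | hp := List.mem_cons.1 hp
        · exact ⟨hT.1, hT.2.1, hT.2.2.2.2⟩
        · exact hF p hp)
      hnd (by rw [hcr]; exact hTl.1)
      (by
        rw [hcr]
        intro p hp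
        obtain rfl | hp := List.mem_cons.1 hp
        · exact hTl.2
        · exact hFl p hp)
      (.cons (a := a) hist hT.1 ⟨by rw [hroot]; exact .nil _ _ _, by rw [hroot]⟩)
      (hes.append (by simp)) (by rw [hcr]; exact hdisj) rfl
    rwa [hcr] at key
  | lam l T =>
    cases F with
    | nil =>
      cases hist with
      | nil h =>
        -- Without pending bags the type at the end of the run is that of the root, namely `⋆`, so
        -- the term is not an abstraction.
        obtain ⟨A, C, -, -, h5⟩ := hτ _ hT.1
        have h6 : τ a₀ = τ l := h.2
        rw [ha₀, h5] at h6
        cases h6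
    | cons p F =>
      obtain ⟨a, B⟩ := p
      obtain ⟨hnimp, hoc, hB⟩ := hF _ List.mem_cons_self
      have hF' : FramesOk G F := fun p hp => hF p (List.mem_cons_of_mem _ hp)
      have hT1 : T.Ok G 1 := hT.2.2.2
      have hTnd : T.toks.Nodup := Multiset.nodup_of_le (Multiset.le_add_right _ _) hnd
      have hBn := numbered_of_ok hS hoc
      have hroot : (T.bind S B).root = 0 :: l := (root_bind S T B).trans hT.2.2.1
      obtain ⟨lost, h1, hlost, hlost'⟩ := stToks_bind (F := F) hBn hnd
      have hcr : crossed (es ++ [.dn (.imp (1 :: l) (0 :: l) l) (0 :: l)]) = crossed es := by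
        simp [Cr.toks]
      rw [h1] at hnd hdisj ⊢
      have hnd' := Multiset.nodup_add.1 (Multiset.nodup_cons.1 hnd).2
      have key := ih _ (stSize_bind_lt (l := l) (a := a) (F := F) hBn hTnd) (T.bind S B) F
        (es ++ [.dn (.imp (1 :: l) (0 :: l) l) (0 :: l)]) (ok_bind hT1 hB) hF' hnd'.1
        (by
          rw [hcr]
          exact linked_bind hτ hist (fun x hx => hx) hT.1 hT.2.1 hoc hTl
            (hFl _ List.mem_cons_self))
        (by
          rw [hcr]
          exact fun p hp => hFl p (List.mem_cons_of_mem _ hp))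
        (by rw [hroot]; exact hist.bind hτ hT.1)
        (hes.append (by simp))
        (by
          rw [hcr]
          intro x hx
          exact hdisj x (by simp [hx])) rfl
      rw [hcr] at key
      by_cases hlen : (T.occs 0).length = B.toList.length
      · have hgood : Good S (.lam l T) ((a, B) :: F) ↔ Good S (T.bind S B) F := by
          refine ⟨fun h => ?_, .lam hlen⟩
          cases h
          assumption
        rw [hgood, hlost hlen, add_zero]
        obtain ⟨es', z, h2, h3, h4, h5, h6, h7, h8⟩ | h := key
        · refine .inl ⟨es', z, h2, h3, h4, h5, fun x hx => (h6 x hx).imp_right (by simp +contextual), ?_, ?_⟩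
          · intro hg x hx hxn
            obtain rfl | hx := Multiset.mem_cons.1 hx
            · exact absurd rfl (hxn _)
            · exact h7 hg x hx hxn
          · intro hg
            obtain ⟨x, hx, h⟩ := h8 hg
            exact ⟨x, by simp [hx], h⟩
        · exact .inr h
      · have hbad : ¬ Good S (.lam l T) ((a, B) :: F) := by
          intro h
          cases h
          exact hlen (by assumption)
        obtain ⟨es', z, h2, h3, h4, h5, h6, -⟩ | h := key
        · refine .inl ⟨es', z, h2, h3, h4, h5, fun x hx => (h6 x hx).imp_right (by simp +contextual), fun h => absurd h hbad, fun _ => ?_⟩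
          -- Even if the run still reaches a `⋆`-link, a token lost in this firing was not crossed
          -- before and is not among those that can be crossed later.
          obtain ⟨x, hx, hxn⟩ := hlost' hlen
          refine ⟨x, by simp [hx], hxn, fun hx' => ?_⟩
          obtain h | h := h6 x hx'
          · exact hdisj x (by simp [hx]) h
          · exact Multiset.disjoint_left.1 hnd'.2.2 h hx
        · exact .inr ⟨hbad, h.2⟩

end


/-! ### The labelling of a term by its addresses -/

mutual
  /-- The term at the address `a`, with its nodes labelled by their addresses. -/
  def Tm.lab (a : Vertex) : Tm → LT
    | .star => .star a
    | .var k => .var a k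
    | .lam t => .lam a (t.lab (0 :: a))
    | .app t b => .app a (t.lab (0 :: a)) (b.lab 0 (1 :: a))
  def Bag.lab (i : ℕ) (a : Vertex) : Bag → LB
    | .nil => .nil
    | .cons t b => .cons (t.lab (i :: a)) (b.lab (i + 1) a)
end

theorem root_lab (t : Tm) (a : Vertex) : (t.lab a).root = a := by
  cases t <;> rfl

theorem erase_lab :
    (∀ (t : Tm) (a : Vertex), (t.lab a).erase = t) ∧
    (∀ (b : Bag) (i : ℕ) (a : Vertex), (b.lab i a).erase = b) := by
  refine Tm.ind ?_ ?_ ?_ ?_ ?_ ?_ <;>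
    simp +contextual [Tm.lab, Bag.lab, LT.erase, LB.erase]

theorem occs_lab :
    (∀ (t : Tm) (k : ℕ) (a : Vertex), (t.lab a).occs k = t.occs k a) ∧
    (∀ (b : Bag) (k i : ℕ) (a : Vertex), (b.lab i a).occs k = b.occs k i a) := by
  refine Tm.ind ?_ ?_ ?_ ?_ ?_ ?_ <;>
    simp +contextual [Tm.lab, Bag.lab, LT.occs, LB.occs, Tm.occs, Bag.occs]

theorem roots_lab (b : Bag) (i : ℕ) (a : Vertex) : (b.lab i a).roots = b.roots i a := by
  induction b using Bag.rec (motive_1 := fun _ => True) generalizing i with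
  | star => trivial
  | var => trivial
  | lam => trivial
  | app => trivial
  | nil => rfl
  | cons t b _ ih =>
    simp only [Bag.lab, LB.roots, LB.toList, List.map_cons, root_lab, Bag.roots]
    exact congrArg _ (ih (i + 1))

theorem ok_lab {G : Graph} :
    (∀ (t : Tm) (d : ℕ) (a : Vertex), t.pretrans a ⊆ G.links → (∀ k, d ≤ k → t.occ k = 0) →
      (t.lab a).Ok G d) ∧
    (∀ (b : Bag) (d i : ℕ) (a : Vertex), b.pretrans i a ⊆ G.links →
      (∀ k, d ≤ k → b.occ k = 0) → (b.lab i a).Ok G d) := by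
  refine Tm.ind ?_ ?_ ?_ ?_ ?_ ?_
  · intro d a h _
    exact h (by simp [Tm.pretrans])
  · intro x d a _ h
    by_contra hx
    have := h x (not_lt.1 hx)
    simp [Tm.occ] at this
  · intro t ih d a h h'
    refine ⟨h (by simp [Tm.pretrans]), ?_, root_lab _ _, ih _ _ ?_ ?_⟩
    · rw [occs_lab.1]
      exact h (by simp [Tm.pretrans])
    · exact fun l hl => h (by simp [Tm.pretrans, hl])
    · intro k hk
      obtain ⟨k, rfl⟩ : ∃ k', k = k' + 1 := ⟨k - 1, by omega⟩
      exact h' k (by omega)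
  · intro t b iht ihb d a h h'
    refine ⟨h (by simp [Tm.pretrans]), ?_, root_lab _ _, iht _ _ ?_ ?_, ihb _ _ _ ?_ ?_⟩
    · rw [roots_lab]
      exact h (by simp [Tm.pretrans])
    · exact fun l hl => h (by simp [Tm.pretrans, hl])
    · exact fun k hk => (Nat.add_eq_zero_iff.1 (h' k hk)).1
    · exact fun l hl => h (by simp [Tm.pretrans, hl])
    · exact fun k hk => (Nat.add_eq_zero_iff.1 (h' k hk)).2
  · intros; trivial
  · intro t b iht ihb d i a h h'
    refine ⟨iht _ _ ?_ ?_, ihb _ _ _ ?_ ?_⟩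
    · exact fun l hl => h (by simp [Bag.pretrans, hl])
    · exact fun k hk => (Nat.add_eq_zero_iff.1 (h' k hk)).1
    · exact fun l hl => h (by simp [Bag.pretrans, hl])
    · exact fun k hk => (Nat.add_eq_zero_iff.1 (h' k hk)).2

theorem linked_lab {G : Graph} {S : Vertex → ℕ} {τ : Vertex → Formula} {V : Tok → Prop} :
    (∀ (t : Tm) (a : Vertex), (t.lab a).Linked G S τ V) ∧
    (∀ (b : Bag) (i : ℕ) (a : Vertex), (b.lab i a).Linked G S τ V) := by
  refine Tm.ind ?_ ?_ ?_ ?_ ?_ ?_ <;>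
    simp +contextual [Tm.lab, Bag.lab, LT.Linked, LB.Linked]

/-- The address of a token. -/
def Tok.addr : Tok → Vertex
  | .occ o => o
  | .rt r => r
  | .node a => a

/-- Tokens lie below the address of their term. The token of the root is absent because it belongs
to the enclosing bag. -/
theorem addr_of_mem_toks :
    (∀ (t : Tm) (a : Vertex), ∀ x ∈ (t.lab a).toks, a <:+ x.addr ∧ x ≠ .rt a) ∧
    (∀ (b : Bag) (i : ℕ) (a : Vertex), ∀ x ∈ (b.lab i a).toks, ∃ j, (i + j) :: a <:+ x.addr) := by
  have below : ∀ {i : ℕ} {a : Vertex} {x : Tok}, i :: a <:+ x.addr →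
      a <:+ x.addr ∧ x ≠ .rt a := by
    rintro i a x h
    refine ⟨(List.suffix_cons _ _).trans h, ?_⟩
    rintro rfl
    exact not_cons_suffix _ _ h
  refine Tm.ind ?_ ?_ ?_ ?_ ?_ ?_
  · intro a x hx
    simp [Tm.lab, LT.toks] at hx
  · intro k a x hx
    simp only [Tm.lab, LT.toks, Multiset.mem_singleton] at hx
    subst hx
    exact ⟨List.suffix_rfl, by simp⟩
  · intro t ih a x hx
    exact below (ih _ x hx).1
  · intro t b iht ihb a x hx
    simp only [Tm.lab, LT.toks, Multiset.mem_cons, Multiset.mem_add] at hx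
    obtain rfl | hx | hx := hx
    · exact ⟨List.suffix_cons _ _, by simp⟩
    · exact below (iht _ x hx).1
    · obtain ⟨j, hj⟩ := ihb _ _ x hx
      exact below ((List.suffix_cons _ _).trans hj)
  · intro i a x hx
    simp [Bag.lab, LB.toks] at hx
  · intro t b iht ihb i a x hx
    simp only [Bag.lab, LB.toks, Multiset.mem_cons, Multiset.mem_add, root_lab] at hx
    obtain rfl | hx | hx := hx
    · exact ⟨0, List.suffix_rfl⟩
    · exact ⟨0, (iht _ x hx).1⟩
    · obtain ⟨j, hj⟩ := ihb _ _ x hx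
      exact ⟨j + 1, by rwa [show i + (j + 1) = i + 1 + j by omega]⟩

theorem nodup_toks_lab :
    (∀ (t : Tm) (a : Vertex), (t.lab a).toks.Nodup) ∧
    (∀ (b : Bag) (i : ℕ) (a : Vertex), (b.lab i a).toks.Nodup) := by
  refine Tm.ind ?_ ?_ ?_ ?_ ?_ ?_
  · intro a
    exact Multiset.nodup_zero
  · intro k a
    exact Multiset.nodup_singleton _
  · intro t ih a
    exact ih _
  · intro t b iht ihb a
    simp only [Tm.lab, LT.toks, Multiset.nodup_cons, Multiset.nodup_add, Multiset.mem_add, not_or]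
    refine ⟨⟨fun h => ?_, fun h => ?_⟩, iht _, ihb _ _, Multiset.disjoint_left.2 fun h h' => ?_⟩
    · exact not_suffix_of_ne (by simp) (addr_of_mem_toks.1 _ _ _ h).1 List.suffix_rfl
    · obtain ⟨j, hj⟩ := addr_of_mem_toks.2 _ _ _ _ h
      exact not_cons_suffix _ _ hj
    · obtain ⟨j, hj⟩ := addr_of_mem_toks.2 _ _ _ _ h'
      exact not_suffix_of_ne (by simp) (addr_of_mem_toks.1 _ _ _ h).1
        ((List.suffix_cons _ _).trans hj)
  · intro i a
    exact Multiset.nodup_zero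
  · intro t b iht ihb i a
    simp only [Bag.lab, LB.toks, Multiset.nodup_cons, Multiset.nodup_add, Multiset.mem_add, not_or,
      root_lab]
    refine ⟨⟨fun h => ?_, fun h => ?_⟩, iht _, ihb _ _, Multiset.disjoint_left.2 fun h h' => ?_⟩
    · exact (addr_of_mem_toks.1 _ _ _ h).2 rfl
    · obtain ⟨j, hj⟩ := addr_of_mem_toks.2 _ _ _ _ h
      exact not_suffix_of_ne (by omega) hj List.suffix_rfl
    · obtain ⟨j, hj⟩ := addr_of_mem_toks.2 _ _ _ _ h'
      exact not_suffix_of_ne (by omega) hj (addr_of_mem_toks.1 _ _ _ h).1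

theorem rt_mem_toks {b : Bag} {i : ℕ} {a r : Vertex} (h : r ∈ b.roots i a) :
    .rt r ∈ (b.lab i a).toks := by
  rw [← roots_lab, LB.roots] at h
  obtain ⟨L, hL, rfl⟩ := List.mem_map.1 h
  rw [LB.toks_eq]
  exact mem_sum_of_mem (List.mem_map_of_mem hL) (Multiset.mem_cons_self _ _)

theorem occ_mem_toks {t : Tm} {k : ℕ} {a o : Vertex} (h : o ∈ t.occs k a) :
    .occ o ∈ (t.lab a).toks :=
  Multiset.mem_of_le (occs_le_toks.1 _ k) (by
    rw [occs_lab.1]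
    exact Multiset.mem_coe.2 (List.mem_map_of_mem h))

/-- The tokens of a labelled term are all those of the links of its translation. -/
theorem mem_toks_of_link :
    (∀ (t : Tm) (a : Vertex), ∀ l ∈ t.pretrans a, (∀ u ∈ l.premises, ∀ x ∈ (Cr.up l u).toks,
      x ∈ (t.lab a).toks) ∧ (l.isOc → .node l.concl ∈ (t.lab a).toks)) ∧
    (∀ (b : Bag) (i : ℕ) (a : Vertex), ∀ l ∈ b.pretrans i a, (∀ u ∈ l.premises,
      ∀ x ∈ (Cr.up l u).toks, x ∈ (b.lab i a).toks) ∧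
        (l.isOc → .node l.concl ∈ (b.lab i a).toks)) := by
  refine Tm.ind ?_ ?_ ?_ ?_ ?_ ?_
  · intro a l hl
    simp only [Tm.pretrans, Finset.mem_singleton] at hl
    subst hl
    simp [Link.premises, Link.isOc]
  · intro k a l hl
    simp [Tm.pretrans] at hl
  · intro t ih a l hl
    simp only [Tm.pretrans, Finset.mem_union, Finset.mem_insert, Finset.mem_singleton] at hl
    obtain (rfl | rfl) | hl := hl
    · simp [Cr.toks, Link.isOc]
    · refine ⟨fun u hu x hx => ?_, by simp [Link.isOc]⟩
      obtain rfl : x = .occ u := by simpa [Cr.toks] using hx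
      exact occ_mem_toks (t := t) hu
    · exact ih _ l hl
  · intro t b iht ihb a l hl
    simp only [Tm.pretrans, Finset.mem_union, Finset.mem_insert, Finset.mem_singleton] at hl
    simp only [Tm.lab, LT.toks, Multiset.mem_cons, Multiset.mem_add]
    obtain ((rfl | rfl) | hl) | hl := hl
    · simp [Cr.toks, Link.isOc]
    · refine ⟨fun u hu x hx => ?_, fun _ => .inl rfl⟩
      obtain rfl : x = .rt u := by simpa [Cr.toks] using hx
      exact .inr (.inr (rt_mem_toks hu))
    · exact ⟨fun u hu x hx => .inr (.inl ((iht _ l hl).1 u hu x hx)),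
        fun h => .inr (.inl ((iht _ l hl).2 h))⟩
    · exact ⟨fun u hu x hx => .inr (.inr ((ihb _ _ l hl).1 u hu x hx)),
        fun h => .inr (.inr ((ihb _ _ l hl).2 h))⟩
  · intro i a l hl
    simp [Bag.pretrans] at hl
  · intro t b iht ihb i a l hl
    simp only [Bag.pretrans, Finset.mem_union] at hl
    simp only [Bag.lab, LB.toks, Multiset.mem_cons, Multiset.mem_add]
    obtain hl | hl := hl
    · exact ⟨fun u hu x hx => .inr (.inl ((iht _ l hl).1 u hu x hx)),
        fun h => .inr (.inl ((iht _ l hl).2 h))⟩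
    · exact ⟨fun u hu x hx => .inr (.inr ((ihb _ _ l hl).1 u hu x hx)),
        fun h => .inr (.inr ((ihb _ _ l hl).2 h))⟩

/-- The tokens of free occurrences and of the roots of a bag are premises of links that lie outside.
For a closed term these exceptions are void, and every token other than a node is a premise of an
exponential link. -/
theorem link_of_mem_toks :
    (∀ (t : Tm) (a : Vertex), ∀ x ∈ (t.lab a).toks, (∀ v, x ≠ .node v) →
      (∃ k, ∃ o ∈ t.occs k a, x = .occ o) ∨
        ∃ l ∈ t.pretrans a, ∃ u ∈ l.premises, x ∈ (Cr.up l u).toks) ∧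
    (∀ (b : Bag) (i : ℕ) (a : Vertex), ∀ x ∈ (b.lab i a).toks, (∀ v, x ≠ .node v) →
      (∃ k, ∃ o ∈ b.occs k i a, x = .occ o) ∨ (∃ r ∈ b.roots i a, x = .rt r) ∨
        ∃ l ∈ b.pretrans i a, ∃ u ∈ l.premises, x ∈ (Cr.up l u).toks) := by
  refine Tm.ind ?_ ?_ ?_ ?_ ?_ ?_
  · intro a x hx
    simp [Tm.lab, LT.toks] at hx
  · intro k a x hx _
    simp only [Tm.lab, LT.toks, Multiset.mem_singleton] at hx
    exact .inl ⟨k, a, by simp [Tm.occs], hx⟩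
  · intro t ih a x hx hn
    obtain ⟨k, o, ho, rfl⟩ | ⟨l, hl, u, hu, h⟩ := ih _ x hx hn
    · cases k with
      | zero => exact .inr ⟨.wn (t.occs 0 (0 :: a)) (1 :: a), by simp [Tm.pretrans], o, ho,
          by simp [Cr.toks]⟩
      | succ k => exact .inl ⟨k, o, ho, rfl⟩
    · exact .inr ⟨l, by simp [Tm.pretrans, hl], u, hu, h⟩
  · intro t b iht ihb a x hx hn
    simp only [Tm.lab, LT.toks, Multiset.mem_cons, Multiset.mem_add] at hx
    obtain rfl | hx | hx := hx
    · exact absurd rfl (hn _)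
    · obtain ⟨k, o, ho, rfl⟩ | ⟨l, hl, u, hu, h⟩ := iht _ x hx hn
      · exact .inl ⟨k, o, by simp [Tm.occs, ho], rfl⟩
      · exact .inr ⟨l, by simp [Tm.pretrans, hl], u, hu, h⟩
    · obtain ⟨k, o, ho, rfl⟩ | ⟨r, hr, rfl⟩ | ⟨l, hl, u, hu, h⟩ := ihb _ _ x hx hn
      · exact .inl ⟨k, o, by simp [Tm.occs, ho], rfl⟩
      · exact .inr ⟨.oc (b.roots 0 (1 :: a)) (1 :: a), by simp [Tm.pretrans], r, hr,
          by simp [Cr.toks]⟩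
      · exact .inr ⟨l, by simp [Tm.pretrans, hl], u, hu, h⟩
  · intro i a x hx
    simp [Bag.lab, LB.toks] at hx
  · intro t b iht ihb i a x hx hn
    simp only [Bag.lab, LB.toks, Multiset.mem_cons, Multiset.mem_add, root_lab] at hx
    obtain rfl | hx | hx := hx
    · exact .inr (.inl ⟨i :: a, by simp [Bag.roots], rfl⟩)
    · obtain ⟨k, o, ho, rfl⟩ | ⟨l, hl, u, hu, h⟩ := iht _ x hx hn
      · exact .inl ⟨k, o, by simp [Bag.occs, ho], rfl⟩
      · exact .inr (.inr ⟨l, by simp [Bag.pretrans, hl], u, hu, h⟩)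
    · obtain ⟨k, o, ho, rfl⟩ | ⟨r, hr, rfl⟩ | ⟨l, hl, u, hu, h⟩ := ihb _ _ x hx hn
      · exact .inl ⟨k, o, by simp [Bag.occs, ho], rfl⟩
      · exact .inr (.inl ⟨r, by simp [Bag.roots, hr], rfl⟩)
      · exact .inr (.inr ⟨l, by simp [Bag.pretrans, hl], u, hu, h⟩)

/-! ### Counting the regular paths -/

/-- Coefficients are natural numbers, so non-zero addends of a weight cannot cancel. -/
theorem isRegular_iff {G : Graph} {π : List Vertex} :
    G.IsRegular π ↔ ∃ σ : G.ResPerm, G.permWeight σ π ≠ 0 := by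
  classical
  have happ : ∀ a : RL, G.weight π a = ∑ σ : G.ResPerm, if G.permWeight σ π = a then 1 else 0 := by
    intro a
    simp [Graph.weight, Finsupp.finsetSum_apply, Finsupp.single_apply]
  unfold Graph.IsRegular SumEq
  push Not
  constructor
  · rintro ⟨a, ha, h⟩
    by_contra hall
    push Not at hall
    refine h ?_
    rw [happ]
    exact Finset.sum_eq_zero fun σ _ => if_neg fun h => ha (h.symm.trans (hall σ))
  · rintro ⟨σ, hσ⟩
    refine ⟨_, hσ, ?_⟩
    rw [happ]
    intro h
    have := Finset.sum_eq_zero_iff.1 h σ (Finset.mem_univ _)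
    simp at this

/-- The run `es` from `a` to a `⋆`-link follows `σ` and crosses all the tokens. -/
def IsFullRun (G : Graph) (a : Vertex) (σ : G.ResPerm) (π : List Vertex) : Prop :=
  ∃ es z, Seg G (numbering G σ) a [] true es z [] true ∧ .star z ∈ G.links ∧ DownFirst es ∧
    (∀ l ∈ G.links, ∀ u ∈ l.premises, ∀ x ∈ (Cr.up l u).toks, x ∈ crossed es) ∧
    π = runPath a es z

namespace IsFullRun

variable {G : Graph} {a : Vertex} {σ σ' : G.ResPerm} {π π' : List Vertex}

theorem permWeight_ne_zero (hG : G.Rooted a) (h : IsFullRun G a σ π) :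
    G.permWeight σ π ≠ 0 := by
  obtain ⟨es, z, h1, h2, h3, h4, rfl⟩ := h
  rw [hG.permWeight_runPath h1 h2]
  exact star_ne_zero

theorem mem_ecPaths (hG : G.Rooted a) (h : IsFullRun G a σ π) : π ∈ G.ecPaths := by
  obtain ⟨es, z, h1, h2, h3, h4, rfl⟩ := h
  exact ⟨hG.isStraight_runPath h1 h2, hG.isMaximal_runPath h1,
    (hG.isComprehensive_runPath_iff h1).2 h4⟩

theorem path_unique (hG : G.Rooted a) (h : IsFullRun G a σ π) (h' : IsFullRun G a σ π') :
    π' = π := by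
  have h2 := h'.permWeight_ne_zero hG
  have h3 := h'.mem_ecPaths hG
  obtain ⟨es, z, h4, h5, -, -, rfl⟩ := h
  exact hG.eq_runPath h4 h5 h3.1 h3.2.1 h2

theorem perm_unique (hG : G.Rooted a) (h : IsFullRun G a σ π) (h' : IsFullRun G a σ' π) :
    σ = σ' := by
  obtain ⟨es, z, h1, h2, h3, h4, rfl⟩ := h
  obtain ⟨es', z', h1', -, -, -, h5⟩ := h'
  exact hG.resPerm_unique h1 h1' h3 h4 h5

end IsFullRun

theorem ClosedNet.rooted {t : Tm} {a : Vertex} {τ : Vertex → Formula} (h : ClosedNet t a τ) :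
    (t.trans a).Rooted a :=
  ⟨h.tidy, h.root_unique, h.root_mem, h.conclusions_eq⟩

/-- The number of regular comprehensive execution paths of a closed term. -/
theorem ClosedNet.encard {t : Tm} {a : Vertex} {τ : Vertex → Formula} (h : ClosedNet t a τ) :
    ∃ m : ℕ, {π | π ∈ (t.trans a).ecPaths ∧ (t.trans a).IsRegular π}.encard = m ∧
      (m : ℝ≥0∞) = count t [] := by
  classical
  set G := t.trans a with hGdef
  have hG : G.Rooted a := h.rooted
  have hpre : t.pretrans a ⊆ G.links := h.links_eq.symm.subset
  have hok : (t.lab a).Ok G 0 := ok_lab.1 t 0 a hpre fun k _ => h.occ_eq_zero k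
  have hst : stToks (t.lab a) [] = (t.lab a).toks := by simp [stToks]
  have hnd : (stToks (t.lab a) []).Nodup := hst ▸ nodup_toks_lab.1 t a
  have hocs : ∀ k, t.occs k a = [] := fun k =>
    List.length_eq_zero_iff.1 ((length_occs.1 t k a).trans (h.occ_eq_zero k))
  have hlinks : ∀ l ∈ G.links, l ∈ t.pretrans a := fun l hl => h.links_eq ▸ hl
  -- At the start the history is empty and nothing has been crossed.
  have hrun := fun σ : G.ResPerm => exists_run (isNumbering_numbering h.tidy σ) h.typed
    h.root_type (t.lab a) [] [] hok (by simp [FramesOk]) hnd (linked_lab.1 t a) (by simp)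
    (.nil ⟨by rw [root_lab]; exact .nil _ _ _, by rw [root_lab]⟩) .nil (by simp)
  have hgood : ∀ σ, Good (numbering G σ) (t.lab a) [] → ∃ π, IsFullRun G a σ π := by
    intro σ hσ
    obtain ⟨es, z, h1, h2, h3, -, -, h4, -⟩ | h1 := hrun σ
    · refine ⟨_, es, z, h1, h2, h3, fun l hl u hu x hx => h4 hσ x ?_ ?_, rfl⟩
      · rw [hst]
        exact (mem_toks_of_link.1 t a l (hlinks l hl)).1 u hu x hx
      · rintro v rfl
        cases l <;> simp [Cr.toks] at hx
    · exact absurd hσ h1.1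
  -- For some permutation the weight of a regular path is non-zero. The run of that permutation is
  -- not stuck, and the path is the one made from it. A bad evaluation would leave a token
  -- uncrossed, against comprehensiveness.
  have hreg : ∀ π, π ∈ G.ecPaths → G.IsRegular π →
      ∃ σ, Good (numbering G σ) (t.lab a) [] ∧ IsFullRun G a σ π := by
    rintro π ⟨h1, h2, h3⟩ h4
    obtain ⟨σ, hσ⟩ := isRegular_iff.1 h4
    refine ⟨σ, ?_⟩
    obtain ⟨es, z, h5, h6, h7, -, -, -, h8⟩ | ⟨-, es, us, w, j, s, h5, h6, h7⟩ := hrun σ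
    · obtain rfl := hG.eq_runPath h5 h6 h1 h2 hσ
      have hc := (hG.isComprehensive_runPath_iff h5).1 h3
      refine ⟨?_, es, z, h5, h6, h7, hc, rfl⟩
      by_contra hbad
      obtain ⟨x, hx, hxn, hxes⟩ := h8 hbad
      rw [hst] at hx
      obtain ⟨k, o, ho, -⟩ | ⟨l, hl, u, hu, hxl⟩ := link_of_mem_toks.1 t a x hx hxn
      · simp [hocs] at ho
      · exact hxes (hc l (hpre hl) u hu x hxl)
    · exact absurd (hG.not_of_stuck h5 h6 h7 h1 h2) hσ
  choose f hf using hgood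
  let A : Finset G.ResPerm := Finset.univ.filter fun σ => Good (numbering G σ) (t.lab a) []
  have hA : ∀ {σ}, σ ∈ A ↔ Good (numbering G σ) (t.lab a) [] := by simp [A]
  let g : A → List Vertex := fun σ => f σ.1 (hA.1 σ.2)
  have hset : {π | π ∈ G.ecPaths ∧ G.IsRegular π} = Set.range g := by
    ext π
    constructor
    · rintro ⟨h1, h2⟩
      obtain ⟨σ, h3, h4⟩ := hreg π h1 h2
      exact ⟨⟨σ, hA.2 h3⟩, h4.path_unique hG (hf σ h3)⟩
    · rintro ⟨σ, rfl⟩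
      have h1 := hf σ.1 (hA.1 σ.2)
      exact ⟨h1.mem_ecPaths hG, isRegular_iff.2 ⟨σ.1, h1.permWeight_ne_zero hG⟩⟩
  have hinj : Function.Injective g := by
    intro σ σ' hσ
    refine Subtype.ext ((hf σ.1 (hA.1 σ.2)).perm_unique hG ?_)
    have : f σ.1 (hA.1 σ.2) = f σ'.1 (hA.1 σ'.2) := hσ
    rw [this]
    exact hf σ'.1 (hA.1 σ'.2)
  refine ⟨A.card, ?_, ?_⟩
  · rw [hset, ← Set.image_univ, hinj.injOn.encard_image, Set.encard_univ]
    simp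
  -- The prescribed assignment is arbitrary: the node of every `!`-link is still a token, so nothing
  -- is prescribed.
  · have h1 := card_good h.tidy (fun _ => 1) (t.lab a) [] hok (by simp [FramesOk]) hnd
    rw [erase_lab.1] at h1
    rw [← List.map_nil (f := fun p : Vertex × LB => p.2.erase), ← h1]
    congr 2
    ext σ
    simp only [A, Finset.mem_filter, Finset.mem_univ, true_and]
    refine ⟨fun h => ⟨fun r hr => absurd ?_ hr, h⟩, fun h => h.2⟩
    obtain ⟨us, w, h1, h2⟩ := mem_ocLinks.1 r.2
    rw [hst, h1]
    exact (mem_toks_of_link.1 t a _ (hlinks _ h2)).2 rfl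

/-- The same for the sums of closed terms. -/
theorem encard_regularPaths (ts : List Tm) (k : ℕ)
    (h : ∀ (i : ℕ) (t : Tm), ts[i]? = some t → (t.trans [k + i]).IsClosedOfType .star) :
    ∃ m : ℕ, {π | ∃ (i : ℕ) (t : Tm), ts[i]? = some t ∧ π ∈ (t.trans [k + i]).ecPaths ∧
      (t.trans [k + i]).IsRegular π}.encard = m ∧ (m : ℝ≥0∞) = (ts.map (count · [])).sum := by
  induction ts generalizing k with
  | nil => exact ⟨0, by simp, by simp⟩
  | cons t ts ih =>
    obtain ⟨τ, hτ⟩ := exists_closedNet (h 0 t rfl)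
    obtain ⟨m, h1, h2⟩ := hτ.encard
    have hts : ∀ (i : ℕ) (t : Tm), ts[i]? = some t → (t.trans [k + 1 + i]).IsClosedOfType .star := by
      intro i t hi
      have := h (i + 1) t (by simpa using hi)
      rwa [show k + (i + 1) = k + 1 + i by omega] at this
    obtain ⟨m', h3, h4⟩ := ih (k + 1) hts
    refine ⟨m + m', ?_, by simp [h2, h4]⟩
    rw [Nat.cast_add, ← h1, ← h3, ← Set.encard_union_eq]
    · congr 1
      ext π
      constructor
      · rintro ⟨i, u, hi, hπ⟩
        cases i with
        | zero =>
          simp only [List.getElem?_cons_zero, Option.some.injEq] at hi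
          subst hi
          exact .inl hπ
        | succ i =>
          refine .inr ⟨i, u, by simpa using hi, ?_⟩
          rwa [show k + 1 + i = k + (i + 1) by omega]
      · rintro (hπ | ⟨i, u, hi, hπ⟩)
        · exact ⟨0, t, rfl, hπ⟩
        · refine ⟨i + 1, u, by simpa using hi, ?_⟩
          rwa [show k + (i + 1) = k + 1 + i by omega]
    -- An execution path starts at the root of its net, and the addends have distinct roots.
    · rw [Set.disjoint_left]
      rintro π hπ ⟨i, u, hi, hπ'⟩
      obtain ⟨τ', hτ'⟩ := exists_closedNet (hts i u hi)
      obtain ⟨ρ, rfl, -⟩ := hτ.rooted.exists_tail hπ.1.1 hπ.1.2.1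
      obtain ⟨ρ', hρ', -⟩ := hτ'.rooted.exists_tail hπ'.1.1 hπ'.1.2.1
      simp at hρ'
      omega

end RC


-- The normal form and the regular paths have the same count

theorem mainTheorem4 (t : List RC.Tm)
    (ht : ∀ G ∈ RC.transSum t, G.IsClosedOfType RC.Ty.star) :
    ∃ n : ℕ,
      RC.Term.IsNormalForm (t.map RC.Tm.toSTerm : List RC.STerm)
        (Multiset.replicate n RC.Tm.star.toSTerm) ∧
      (∀ S : RC.Term, RC.Term.IsNormalForm (t.map RC.Tm.toSTerm : List RC.STerm) S →
        S = Multiset.replicate n RC.Tm.star.toSTerm) ∧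
      (RC.regularPaths (RC.transSum t)).encard = n := by
  have hcl : ∀ (i : ℕ) (u : RC.Tm), t[i]? = some u → (u.trans [0 + i]).IsClosedOfType .star := by
    intro i u hi
    refine ht _ (List.mem_of_getElem? (i := i) ?_)
    simp [RC.transSum, List.getElem?_mapIdx, hi]
  have hty : ∀ u ∈ t, u.HasTy (fun _ => none) .star := by
    intro u hu
    obtain ⟨i, hi⟩ := List.getElem?_of_mem hu
    obtain ⟨τ, hτ⟩ := RC.exists_closedNet (hcl i u hi)
    exact hτ.hasTy
  obtain ⟨n, h1, h2, h3⟩ := RC.normal_form t hty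
  obtain ⟨m, h4, h5⟩ := RC.encard_regularPaths t 0 hcl
  obtain rfl : m = n := by
    have := h5.trans h3
    exact_mod_cast this
  refine ⟨m, h1, h2, ?_⟩
  rw [← h4]
  congr 1
  ext π
  simp only [RC.regularPaths, RC.transSum, Set.mem_ofPred_eq, List.mem_mapIdx, zero_add]
  constructor
  · rintro ⟨G, ⟨i, hi, rfl⟩, hπ⟩
    exact ⟨i, t[i], List.getElem?_eq_getElem hi, hπ⟩
  · rintro ⟨i, u, hi, hπ⟩
    obtain ⟨hi', rfl⟩ := List.getElem?_eq_some_iff.1 hi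
    exact ⟨_, ⟨i, hi', rfl⟩, hπ⟩
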